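/- **Definitions.** A *polygon* (an $n$-gon, $n\ge 3$) in $\mathbb E^3$ is given by a cyclic sequence of $n$ distinct points and consists of these points (its vertices) and the segments joining consecutive ones (its edges). A (finite) *geometric polyhedron* $P$ in $\mathbb E^3$ consists of a finite set of points (vertices), a set of segments joining vertices (edges) and a set of polygons made up of these segments (faces), such that the edge graph is connected, the vertex-figure at every vertex $v$ (the graph on the neighbours of $v$ in which $u,w$ are joined if $\{u,v\},\{v,w\}$ are edges of a common face) is connected, and each edge lies in exactly two faces. Let $\Gamma(P)$ be the automorphism group of the underlying abstract polyhedron, i.e. of the set of vertices, edges and faces partially ordered by incidence, and let $G(P)$ be the group of isometries of $\mathbb E^3$ that map $P$ to itself, viewed as a subgroup of $\Gamma(P)$. A flag is a maximal chain of the partially ordered set. $P$ is *regular* (regular of index $1$) if $G(P)$ is transitive on flags. $P$ is a *regular polyhedron of index $2$* if $\Gamma(P)$ is transitive on flags and $|\Gamma(P):G(P)|=2$. A *Petrie polygon* of $P$ is a polygon along edges of $P$ such that any two, but no three, consecutive edges belong to a common face; the *Petrie dual* of $P$ has the same vertices and edges as $P$, and the Petrie polygons of $P$ as faces. **Lemma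 10.** Let $Q$ be one of the $18$ finite regular polyhedra, i.e. one of the five Platonic solids or the four Kepler–Poinsot polyhedra or the Petrie dual of one of these nine, with centre at the origin $o$ of $\mathbb E^3$ (up to similarity). For a real number $\lambda>0$, $\lambda\ne1$, construct $P_\lambda$ from $Q$ as follows. * If $Q$ is not the cube or its Petrie dual, put $v^\diamond=\lambda v$ and $Q^\diamond=\lambda Q$. The vertices of $P_\lambda$ are those of $Q$ and of $Q^\diamond$; each pair of edges $\{v_0,v_1\}$ of $Q$ and $\{v_0^\diamond,v_1^\diamond\}$ of $Q^\diamond$ is replaced by the two edges $\{v_0,v_1^\diamond\}$ and $\{v_0^\diamond,v_1\}$; the faces of $P_\lambda$ are the polygons $(v_0,v_1^\diamond,v_2,v_3^\diamond,\dots)$ obtained by tracing the face boundaries $(v_0,v_1,\dots,v_{p-1})$ of $Q$, alternating between $Q$ and $Q^\diamond$, until the path closes up (so a $p$-gonal face of $Q$ gives one $2p$-gon if $p$ is odd, and two $p$-gons if $p$ is even). * If $Q$ is the cube or its Petrie dual, then the vertices of $Q$ are those of two regular tetrahedra $S$ and $-S$; $P_\lambda$ is obtained from $Q$ by replacing each vertex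 $v$ of $-S$ by $\lambda v$, keeping the vertices of $S$ and the combinatorics of the edges and faces. Then $Q$ is a regular geometric polyhedron, and for every $\lambda>0$, $\lambda\neq1$, the figure $P_\lambda$ is a geometric polyhedron that is regular of index $2$; its vertices form exactly two orbits under $G(P_\lambda)$, and none of its faces is planar. Moreover, the $P_\lambda$ form an infinite family up to similarity: if $P_\lambda$ and $P_\mu$ are similar (with $\lambda,\mu>0$ and $\lambda,\mu\ne1$), then $\mu=\lambda$ or $\mu=\lambda^{-1}$. -/

import Mathlib

/-- Euclidean 3-space. -/
abbrev E3 : Type := EuclideanSpace ℝ (Fin 3)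

/-! ### Polygons and skeletal polyhedra -/

/-- The (closed) polygon with the cyclic sequence of vertices `v`, given by its set of edges;
the line segment joining `x` and `y` is represented by the unordered pair `s(x, y)`. -/
def polygon {p : ℕ} (v : ZMod p → E3) : Set (Sym2 E3) :=
  Set.range fun i => s(v i, v (i + 1))

/-- `F` is the edge set of a `p`-gon with `p ≥ 3` distinct vertices. -/
def IsPolygon (p : ℕ) (F : Set (Sym2 E3)) : Prop :=
  3 ≤ p ∧ ∃ v : ZMod p → E3, Function.Injective v ∧ F = polygon v

/-- The vertices of a polygon given by its edges. -/
def polygonVertices (F : Set (Sym2 E3)) : Set E3 :=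
  {x | ∃ e ∈ F, x ∈ e}

/-- The data of a skeletal figure in space: points (vertices), line segments (edges), and
polygons (faces), each polygon being given by its set of edges. -/
@[ext] structure Skeletal where
  verts : Set E3
  edges : Set (Sym2 E3)
  faces : Set (Set (Sym2 E3))

namespace Skeletal

/-- The edge graph. -/
def edgeGraph (P : Skeletal) : SimpleGraph P.verts where
  Adj x y := x ≠ y ∧ s((x : E3), (y : E3)) ∈ P.edges
  symm := ⟨fun x y h => ⟨h.1.symm, by rw [Sym2.eq_swap]; exact h.2⟩⟩
  loopless := ⟨fun _ h => h.1 rfl⟩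

/-- The vertex-figure at `v`: its nodes are the neighbours of `v` in the edge graph, and two of
them, `u` and `w`, are joined if `{u, v}` and `{v, w}` are edges of a common face. -/
def vertexFigure (P : Skeletal) (v : P.verts) :
    SimpleGraph {u : P.verts // P.edgeGraph.Adj v u} where
  Adj u w := u ≠ w ∧
    ∃ F ∈ P.faces, s((u.1 : E3), (v : E3)) ∈ F ∧ s((v : E3), (w.1 : E3)) ∈ F
  symm := ⟨fun u w h => ⟨h.1.symm, by
    obtain ⟨F, hF, h1, h2⟩ := h.2
    exact ⟨F, hF, by rw [Sym2.eq_swap]; exact h2, by rw [Sym2.eq_swap]; exact h1⟩⟩⟩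
  loopless := ⟨fun _ h => h.1 rfl⟩

/-- A (finite) geometric polyhedron in Euclidean 3-space. -/
structure IsPolyhedron (P : Skeletal) : Prop where
  finite_verts : P.verts.Finite
  edge_spec : ∀ e ∈ P.edges, ¬ e.IsDiag ∧ ∀ x ∈ e, x ∈ P.verts
  face_spec : ∀ F ∈ P.faces, (∃ p, IsPolygon p F) ∧ F ⊆ P.edges
  connected : P.edgeGraph.Connected
  vertexFigure_connected : ∀ v, (P.vertexFigure v).Connected
  two_faces : ∀ e ∈ P.edges, {F | F ∈ P.faces ∧ e ∈ F}.ncard = 2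

/-! ### The underlying abstract polyhedron and its automorphisms -/

/-- The proper elements (vertices, edges, faces) of the underlying abstract polyhedron. -/
inductive Cell (P : Skeletal) : Type
  | vertex (v : P.verts)
  | edge (e : P.edges)
  | face (F : P.faces)

/-- Incidence of the proper elements. -/
def Cell.Incident {P : Skeletal} : Cell P → Cell P → Prop
  | .vertex v, .vertex w => v = w
  | .vertex v, .edge e => (v : E3) ∈ (e : Sym2 E3)
  | .vertex v, .face F => (v : E3) ∈ polygonVertices F
  | .edge e, .edge d => e = d
  | .edge e, .face F => (e : Sym2 E3) ∈ (F : Set (Sym2 E3))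
  | .face F, .face G => F = G
  | _, _ => False

instance (P : Skeletal) : PartialOrder (Cell P) where
  le := Cell.Incident
  le_refl a := by cases a <;> simp [Cell.Incident]
  le_trans a b c hab hbc := by
    cases a <;> cases b <;> cases c <;> simp_all [Cell.Incident, polygonVertices]
    exact ⟨_, hbc, hab⟩
  le_antisymm a b hab hba := by
    cases a <;> cases b <;> simp_all [Cell.Incident]

/-- The combinatorial automorphism group: all automorphisms of the partially ordered set of
proper elements. -/
abbrev Aut (P : Skeletal) : Type := Cell P ≃o Cell P

/-! ### Images and geometric symmetries -/

/-- The image of a figure under a map of the ambient space acting on the vertices. -/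
def map (f : E3 → E3) (P : Skeletal) : Skeletal where
  verts := f '' P.verts
  edges := Sym2.map f '' P.edges
  faces := (fun F => Sym2.map f '' F) '' P.faces

theorem map_id (P : Skeletal) : P.map id = P := by
  ext <;> simp [map]

theorem map_map (f g : E3 → E3) (P : Skeletal) : (P.map f).map g = P.map (g ∘ f) := by
  ext x
  · simp [map]
  · simp [map, Sym2.map_map]
  · simp [map, Set.image_image, Sym2.map_map]

/-- The (geometric) symmetry group: all isometries of space that map the figure to itself. -/
def symmetryGroup (P : Skeletal) : Subgroup (E3 ≃ᵢ E3) where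
  carrier := {g | P.map g = P}
  one_mem' := P.map_id
  mul_mem' {a b} ha hb := by
    have h : P.map (a ∘ b) = P := by
      rw [← map_map, show P.map b = P from hb, show P.map a = P from ha]
    exact h
  inv_mem' {a} ha := by
    have h : (P.map a).map (a⁻¹ : E3 ≃ᵢ E3) = P := by
      rw [map_map]
      convert P.map_id using 2
      funext x
      exact a.symm_apply_apply x
    rwa [show P.map a = P from ha] at h

theorem mem_of_map_eq {P : Skeletal} {f : E3 → E3} (h : P.map f = P) :
    (∀ v ∈ P.verts, f v ∈ P.verts) ∧ (∀ e ∈ P.edges, Sym2.map f e ∈ P.edges) ∧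
      ∀ F ∈ P.faces, Sym2.map f '' F ∈ P.faces := by
  refine ⟨fun v hv => ?_, fun e he => ?_, fun F hF => ?_⟩
  · have : f v ∈ (P.map f).verts := ⟨v, hv, rfl⟩
    rwa [h] at this
  · have : Sym2.map f e ∈ (P.map f).edges := ⟨e, he, rfl⟩
    rwa [h] at this
  · have : Sym2.map f '' F ∈ (P.map f).faces := ⟨F, hF, rfl⟩
    rwa [h] at this

/-- The action of a symmetry on vertices, edges and faces. -/
noncomputable def symmetryAct (P : Skeletal) (g : P.symmetryGroup) : Cell P → Cell P
  | .vertex v => .vertex ⟨(g : E3 ≃ᵢ E3) v, (mem_of_map_eq g.2).1 _ v.2⟩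
  | .edge e => .edge ⟨Sym2.map (g : E3 ≃ᵢ E3) e, (mem_of_map_eq g.2).2.1 _ e.2⟩
  | .face F => .face ⟨Sym2.map (g : E3 ≃ᵢ E3) '' F, (mem_of_map_eq g.2).2.2 _ F.2⟩

theorem symmetryAct_one (P : Skeletal) (x : Cell P) : P.symmetryAct 1 x = x := by
  cases x with
  | vertex v => rfl
  | edge e =>
    have h : Sym2.map (id : E3 → E3) e = e := by simp
    exact congrArg Cell.edge (Subtype.ext h)
  | face F =>
    have h : Sym2.map (id : E3 → E3) '' F = F := by simp
    exact congrArg Cell.face (Subtype.ext h)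

theorem symmetryAct_mul (P : Skeletal) (g h : P.symmetryGroup) (x : Cell P) :
    P.symmetryAct (g * h) x = P.symmetryAct g (P.symmetryAct h x) := by
  have key : ∀ e : Sym2 E3, Sym2.map ((g * h : P.symmetryGroup) : E3 ≃ᵢ E3) e =
      Sym2.map (g : E3 ≃ᵢ E3) (Sym2.map (h : E3 ≃ᵢ E3) e) := by
    intro e
    rw [Sym2.map_map]
    rfl
  cases x with
  | vertex v => rfl
  | edge e => simp only [symmetryAct, key]
  | face F => simp only [symmetryAct, Set.image_image, key]

theorem symmetryAct_mono (P : Skeletal) (g : P.symmetryGroup) {x y : Cell P} (hxy : x ≤ y) :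
    P.symmetryAct g x ≤ P.symmetryAct g y := by
  change Cell.Incident _ _
  replace hxy : Cell.Incident x y := hxy
  cases x <;> cases y <;> simp only [Cell.Incident, symmetryAct, polygonVertices] at hxy ⊢
  · rw [hxy]
  · exact Sym2.mem_map.2 ⟨_, hxy, rfl⟩
  · obtain ⟨e, he, hv⟩ := hxy
    exact ⟨_, ⟨e, he, rfl⟩, Sym2.mem_map.2 ⟨_, hv, rfl⟩⟩
  · rw [hxy]
  · exact ⟨_, hxy, rfl⟩
  · rw [hxy]

/-- The homomorphism by which symmetries are viewed as automorphisms of the underlying abstract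
polyhedron. -/
noncomputable def symmetryToAut (P : Skeletal) : P.symmetryGroup →* P.Aut where
  toFun g :=
    { toFun := P.symmetryAct g
      invFun := P.symmetryAct g⁻¹
      left_inv := fun x => by rw [← symmetryAct_mul, inv_mul_cancel, symmetryAct_one]
      right_inv := fun x => by rw [← symmetryAct_mul, mul_inv_cancel, symmetryAct_one]
      map_rel_iff' := by
        intro x y
        refine ⟨fun h => ?_, fun h => P.symmetryAct_mono g h⟩
        have := P.symmetryAct_mono g⁻¹ h
        simpa [← symmetryAct_mul, symmetryAct_one] using this }
  map_one' := by
    ext x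
    exact P.symmetryAct_one x
  map_mul' g h := by
    ext x
    exact P.symmetryAct_mul g h x

/-- The index of a figure: the index of its symmetry group in its automorphism group. -/
noncomputable def index (P : Skeletal) : ℕ := P.symmetryToAut.range.index

/-- A geometric polyhedron is (geometrically) regular if its symmetry group is transitive on the
flags (maximal chains of the underlying abstract polyhedron). -/
def IsRegular (P : Skeletal) : Prop :=
  P.IsPolyhedron ∧ ∀ Φ Ψ : Flag (Cell P), ∃ g : P.symmetryGroup, P.symmetryToAut g • Φ = Ψ

/-- A geometric polyhedron is combinatorially regular if the automorphism group of the underlying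
abstract polyhedron is transitive on the flags. -/
def IsCombinatoriallyRegular (P : Skeletal) : Prop :=
  P.IsPolyhedron ∧ ∀ Φ Ψ : Flag (Cell P), ∃ γ : P.Aut, γ • Φ = Ψ

/-- Regular polyhedra of index 2. -/
def IsRegularOfIndexTwo (P : Skeletal) : Prop :=
  P.IsCombinatoriallyRegular ∧ P.index = 2

/-- The set of vertex orbits under the symmetry group. -/
def vertexOrbits (P : Skeletal) : Set (Set E3) :=
  {O | ∃ v ∈ P.verts, O = {w | ∃ g ∈ P.symmetryGroup, g v = w}}

/-- Similarity of figures. -/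
def Similar (P P' : Skeletal) : Prop :=
  ∃ r : ℝ, 0 < r ∧ ∃ g : E3 ≃ᵢ E3, P' = P.map fun x => r • g x

/-! ### Petrie duals -/

/-- `F` is a Petrie polygon of `P`: a polygon along edges of `P` such that any two, but no three,
consecutive edges belong to a common face. -/
def IsPetriePolygon (P : Skeletal) (F : Set (Sym2 E3)) : Prop :=
  ∃ p : ℕ, 3 ≤ p ∧ ∃ v : ZMod p → E3, Function.Injective v ∧ F = polygon v ∧ F ⊆ P.edges ∧
    ∀ i : ZMod p,
      (∃ G ∈ P.faces, s(v i, v (i + 1)) ∈ G ∧ s(v (i + 1), v (i + 2)) ∈ G) ∧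
      ¬ ∃ G ∈ P.faces, s(v i, v (i + 1)) ∈ G ∧ s(v (i + 1), v (i + 2)) ∈ G ∧
          s(v (i + 2), v (i + 3)) ∈ G

/-- The Petrie dual: same vertices and edges, the faces being the Petrie polygons. -/
def petrieDual (P : Skeletal) : Skeletal where
  verts := P.verts
  edges := P.edges
  faces := {F | P.IsPetriePolygon F}

/-! ### The Platonic solids and the Kepler-Poinsot polyhedra -/

/-- The figure with vertex set `V`, whose edges join the pairs of distinct points of `V` with inner
product `c`, and whose faces are all planar `p`-gons formed by such edges. -/
def ofVertices (V : Set E3) (c : ℝ) (p : ℕ) : Skeletal where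
  verts := V
  edges := {e | ∃ x ∈ V, ∃ y ∈ V, x ≠ y ∧ inner ℝ x y = c ∧ e = s(x, y)}
  faces := {F | IsPolygon p F ∧
    (∀ e ∈ F, ∃ x ∈ V, ∃ y ∈ V, x ≠ y ∧ inner ℝ x y = c ∧ e = s(x, y)) ∧
    Coplanar ℝ (polygonVertices F)}

end Skeletal

/-- The vertices of the cube. -/
def cubeVerts : Set E3 :=
  {x | ∀ i, x i = 1 ∨ x i = -1}

/-- The vertices of one of the two regular tetrahedra inscribed in the cube. -/
def tetrahedronVerts : Set E3 :=
  {x | x ∈ cubeVerts ∧ x 0 * x 1 * x 2 = 1}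

/-- The vertices of the octahedron. -/
def octahedronVerts : Set E3 :=
  {x | ∃ s : ℝ, (s = 1 ∨ s = -1) ∧ (x = !₂[s, 0, 0] ∨ x = !₂[0, s, 0] ∨ x = !₂[0, 0, s])}

/-- The points `(0, ±a, ±b)` and their cyclic shifts. -/
def cyclicPoints (a b : ℝ) : Set E3 :=
  {x | ∃ s t : ℝ, (s = 1 ∨ s = -1) ∧ (t = 1 ∨ t = -1) ∧
    (x = !₂[0, s * a, t * b] ∨ x = !₂[t * b, 0, s * a] ∨ x = !₂[s * a, t * b, 0])}

/-- The vertices of the icosahedron. -/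
def icosahedronVerts : Set E3 :=
  cyclicPoints 1 Real.goldenRatio

/-- The vertices of the dodecahedron. -/
def dodecahedronVerts : Set E3 :=
  cubeVerts ∪ cyclicPoints Real.goldenRatio⁻¹ Real.goldenRatio

/-- Names of the five Platonic solids and the four Kepler-Poinsot polyhedra. -/
inductive ClassicalPolyhedron : Type
  | tetrahedron
  | octahedron
  | cube
  | icosahedron
  | dodecahedron
  | greatDodecahedron
  | smallStellatedDodecahedron
  | greatIcosahedron
  | greatStellatedDodecahedron

namespace ClassicalPolyhedron

/-- The Platonic solids and the Kepler-Poinsot polyhedra, centred at the origin. The four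
Kepler-Poinsot polyhedra have the vertices of the icosahedron or dodecahedron; the edges of the
great dodecahedron are those of the icosahedron, and those of the other three are the second
longest segments between vertices (diameters being the longest). -/
noncomputable def toSkeletal : ClassicalPolyhedron → Skeletal
  | tetrahedron => .ofVertices tetrahedronVerts (-1) 3
  | octahedron => .ofVertices octahedronVerts 0 3
  | cube => .ofVertices cubeVerts 1 4
  | icosahedron => .ofVertices icosahedronVerts Real.goldenRatio 3
  | dodecahedron => .ofVertices dodecahedronVerts √5 5
  | greatDodecahedron => .ofVertices icosahedronVerts Real.goldenRatio 5
  | smallStellatedDodecahedron => .ofVertices icosahedronVerts (-Real.goldenRatio) 5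
  | greatIcosahedron => .ofVertices icosahedronVerts (-Real.goldenRatio) 3
  | greatStellatedDodecahedron => .ofVertices dodecahedronVerts (-√5) 5

end ClassicalPolyhedron

namespace Skeletal

/-! ### The two constructions -/

/-- The points `v 0, t v 1, v 2, t v 3, …` met when the closed polygon `v` is traced repeatedly,
alternating between `v` and its homothetic copy `t v`. -/
def alternate {p : ℕ} (v : ZMod p → E3) (t : ℝ) (j : ℤ) : E3 :=
  if Even j then v (j : ZMod p) else t • v (j : ZMod p)

/-- The crossing of `Q` with its homothetic copy `t Q`: the vertices are those of `Q` and `t Q`;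
each pair of edges `{x, y}`, `{t x, t y}` is replaced by the pair `{x, t y}`, `{t x, y}`; the
faces are the polygons that track the faces of `Q`, alternating between `Q` and `t Q`. For a
`p`-gonal face this is one `2 p`-gon when `p` is odd, and two `p`-gons when `p` is even (one for each
choice of the vertex `v 0`). -/
def cross (Q : Skeletal) (t : ℝ) : Skeletal where
  verts := Q.verts ∪ {x | ∃ y ∈ Q.verts, x = t • y}
  edges := {e | ∃ x y, s(x, y) ∈ Q.edges ∧ e = s(x, t • y)}
  faces := {F | ∃ p : ℕ, 3 ≤ p ∧ ∃ v : ZMod p → E3, Function.Injective v ∧ polygon v ∈ Q.faces ∧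
    F = Set.range fun j : ℤ => s(alternate v t j, alternate v t (j + 1))}

open scoped Classical in
/-- Rescaling of a figure on the vertices of the cube: the vertices of one inscribed tetrahedron
are fixed, those of the other one are multiplied by `t`. -/
noncomputable def rescaleHalf (Q : Skeletal) (t : ℝ) : Skeletal :=
  Q.map fun x => if x ∈ tetrahedronVerts then x else t • x

end Skeletal

/-- The one-parameter family of figures constructed from `Q`, where `Q` is the classical polyhedron
with name `k` or its Petrie dual. -/
noncomputable def indexTwoFamily (k : ClassicalPolyhedron) (Q : Skeletal) (t : ℝ) : Skeletal :=
  match k with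
  | .cube => Q.rescaleHalf t
  | _ => Q.cross t

/-!
A face traced as a periodic sequence of points with a chosen start and direction is a flag, and an
automorphism of a polyhedron is determined by its effect on one flag. Hence regularity and index 2
are statements about the action of isometries and automorphisms on tracings.

Nine of the polyhedra `Q` are recognised as regular from three reflections acting on a base face;
exact arithmetic in `ℤ[φ]` suffices for this. A product of the three reflections moves a Petrie
polygon by one step, which makes the Petrie dual of a regular polyhedron regular as well.

The faces of `P_t` are the tracings `a 0, t a 1, a 2, t a 3, …` for tracings `a` of faces of `Q`, so
its vertices lie on two concentric spheres of radii with ratio `t`, and each edge joins the two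
spheres. An isometry preserving `P_t` fixes the centroid of the vertices and therefore preserves
both spheres; the isometries of `Q` provide all automorphisms that preserve the two layers, and an
interchange of the layers provides the others. So the index and the number of vertex orbits are 2,
and the ratio of the radii is a similarity invariant up to inversion. A plane containing a face of
`P_t` would pass through the centre of `Q`, by comparison of the centroids of the vertices in the
two layers, and would thus contain a whole face of `Q` and the centre.
-/

/-! ### Closed polygons as periodic sequences -/

/-- The sequence `w` runs round and round a closed polygon with `p ≥ 3` distinct vertices. Indexing
by `ℤ` rather than `ZMod p` makes shifts, reflections and alternation uniform in `p`. -/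
structure IsTracing {α : Type*} (p : ℕ) (w : ℤ → α) : Prop where
  three_le : 3 ≤ p
  apply_eq_iff : ∀ i j, w i = w j ↔ (p : ℤ) ∣ i - j

/-- The edges, as unordered pairs, joining consecutive terms of a sequence of points. -/
def traceEdges {α : Type*} (w : ℤ → α) : Set (Sym2 α) :=
  Set.range fun i : ℤ => s(w i, w (i + 1))

section traceEdges

variable {α β : Type*} {w : ℤ → α}

theorem mk_mem_traceEdges {i j : ℤ} (h : j = i + 1) : s(w i, w j) ∈ traceEdges w :=
  ⟨i, by rw [h]⟩

theorem mk_mem_traceEdges_symm {i j : ℤ} (h : i = j + 1) : s(w i, w j) ∈ traceEdges w := by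
  rw [Sym2.eq_swap]
  exact mk_mem_traceEdges h

theorem traceEdges_shift (w : ℤ → α) (k : ℤ) :
    traceEdges (fun j => w (k + j)) = traceEdges w := by
  apply Set.Subset.antisymm
  · rintro _ ⟨i, rfl⟩
    exact mk_mem_traceEdges (by ring)
  · rintro _ ⟨i, rfl⟩
    exact ⟨i - k, by simp only [add_sub_cancel, ← add_assoc]⟩

theorem traceEdges_reflect (w : ℤ → α) (k : ℤ) :
    traceEdges (fun j => w (k - j)) = traceEdges w := by
  apply Set.Subset.antisymm
  · rintro _ ⟨i, rfl⟩
    exact mk_mem_traceEdges_symm (by ring)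
  · rintro _ ⟨i, rfl⟩
    exact ⟨k - i - 1, by
      beta_reduce
      rw [Sym2.eq_swap, show k - (k - i - 1) = i + 1 by ring, show k - (k - i - 1 + 1) = i by ring]⟩

theorem image_traceEdges (f : α → β) (w : ℤ → α) :
    Sym2.map f '' traceEdges w = traceEdges fun j => f (w j) := by
  rw [traceEdges, ← Set.range_comp]
  rfl

theorem exists_apply_eq_of_mk_mem_traceEdges {x y : α} (he : s(x, y) ∈ traceEdges w) :
    ∃ k, w k = x ∧ (w (k + 1) = y ∨ w (k - 1) = y) := by
  obtain ⟨k, hk⟩ := he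
  rcases Sym2.eq_iff.1 hk with ⟨hx, hy⟩ | ⟨hy, hx⟩
  · exact ⟨k, hx, .inl hy⟩
  · exact ⟨k + 1, hx, .inr (by simpa using hy)⟩

end traceEdges

theorem polygonVertices_traceEdges (w : ℤ → E3) :
    polygonVertices (traceEdges w) = Set.range w := by
  ext x
  constructor
  · rintro ⟨_, ⟨i, rfl⟩, hx⟩
    rcases Sym2.mem_iff.1 hx with rfl | rfl
    exacts [⟨_, rfl⟩, ⟨_, rfl⟩]
  · rintro ⟨i, rfl⟩
    exact ⟨_, mk_mem_traceEdges rfl, Sym2.mem_mk_left _ (w (i + 1))⟩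

namespace IsTracing

variable {α β : Type*} {p q : ℕ} {w a b : ℤ → α}

theorem apply_ne_apply_add (h : IsTracing p w) (i : ℤ) {k : ℤ} (hk : 0 < k) (hk3 : k < 3) :
    w i ≠ w (i + k) := by
  rw [Ne, h.apply_eq_iff, show i - (i + k) = -k by ring, Int.dvd_neg]
  intro hd
  have := Int.le_of_dvd hk hd
  have := h.three_le
  omega

theorem shift (h : IsTracing p w) (k : ℤ) : IsTracing p fun j => w (k + j) :=
  ⟨h.three_le, fun i j => by rw [h.apply_eq_iff, add_sub_add_left_eq_sub]⟩

theorem reflect (h : IsTracing p w) (k : ℤ) : IsTracing p fun j => w (k - j) :=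
  ⟨h.three_le, fun i j => by rw [h.apply_eq_iff, sub_sub_sub_cancel_left, dvd_sub_comm]⟩

theorem comp (h : IsTracing p w) {f : α → β} (hf : Set.InjOn f (Set.range w)) :
    IsTracing p fun j => f (w j) :=
  ⟨h.three_le, fun i j => (hf.eq_iff ⟨i, rfl⟩ ⟨j, rfl⟩).trans (h.apply_eq_iff i j)⟩

theorem apply_add_one_eq (ha : IsTracing p a) (hb : IsTracing q b)
    (hE : traceEdges b ⊆ traceEdges a) {i : ℤ} (h0 : a i = b i) (h1 : a (i + 1) = b (i + 1)) :
    a (i + 1 + 1) = b (i + 1 + 1) := by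
  obtain ⟨k, hk, hk' | hk'⟩ :=
    exists_apply_eq_of_mk_mem_traceEdges (hE (mk_mem_traceEdges (i := i + 1) rfl))
  · rw [← hk', ha.apply_eq_iff]
    rw [← h1, ha.apply_eq_iff] at hk
    rwa [add_sub_add_right_eq_sub, dvd_sub_comm]
  · -- otherwise `b` would return along the edge by which it came
    refine absurd ?_ (hb.apply_ne_apply_add i (k := 2) (by norm_num) (by norm_num))
    rw [← h1, ha.apply_eq_iff] at hk
    rw [← h0, show i + 2 = i + 1 + 1 by ring, ← hk', ha.apply_eq_iff, dvd_sub_comm]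
    rwa [sub_sub, add_comm 1 i]

theorem natCast_eq (ha : IsTracing p a) (hb : IsTracing q b) (hE : traceEdges b ⊆ traceEdges a)
    (h0 : a 0 = b 0) (h1 : a 1 = b 1) (n : ℕ) : a n = b n ∧ a (n + 1) = b (n + 1) := by
  induction n with
  | zero => simpa using ⟨h0, h1⟩
  | succ n ih =>
    push_cast
    exact ⟨ih.2, ha.apply_add_one_eq hb hE ih.1 ih.2⟩

theorem eq_of_traceEdges_eq (ha : IsTracing p a) (hb : IsTracing q b)
    (hE : traceEdges a = traceEdges b) (h0 : a 0 = b 0) (h1 : a 1 = b 1) : a = b := by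
  funext i
  obtain ⟨n, rfl | rfl⟩ := i.eq_nat_or_neg
  · exact (natCast_eq ha hb hE.ge h0 h1 n).1
  · have := (natCast_eq (ha.reflect 1) (hb.reflect 1)
      (by rw [traceEdges_reflect, traceEdges_reflect, hE]) (by simpa using h1)
      (by simpa using h0) n).2
    simpa using this

theorem eq_shift_or_reflect (ha : IsTracing p a) (hb : IsTracing q b)
    (hE : traceEdges a = traceEdges b) :
    ∃ k, (b = fun j => a (k + j)) ∨ (b = fun j => a (k - j)) := by
  have he : s(b 0, b 1) ∈ traceEdges a := hE ▸ mk_mem_traceEdges rfl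
  obtain ⟨k, h0, h1 | h1⟩ := exists_apply_eq_of_mk_mem_traceEdges he
  · exact ⟨k, .inl (hb.eq_of_traceEdges_eq (ha.shift k) (by rw [traceEdges_shift, hE])
      (by simp [h0]) (by simp [h1]))⟩
  · exact ⟨k, .inr (hb.eq_of_traceEdges_eq (ha.reflect k) (by rw [traceEdges_reflect, hE])
      (by simp [h0]) (by simp [h1]))⟩

theorem eq_one_or_neg_one_of_mk_mem (h : IsTracing p w) {y : α} (hy : s(w 0, y) ∈ traceEdges w) :
    y = w 1 ∨ y = w (-1) := by
  obtain ⟨k, h0, h1⟩ := exists_apply_eq_of_mk_mem_traceEdges hy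
  have hk : (p : ℤ) ∣ k := by simpa using (h.apply_eq_iff k 0).1 h0
  refine h1.imp (fun h1 => ?_) fun h1 => ?_ <;> rw [← h1, h.apply_eq_iff] <;> simpa using hk

theorem exists_zmod (h : IsTracing p w) :
    ∃ v : ZMod p → α, Function.Injective v ∧ w = fun j : ℤ => v (j : ZMod p) := by
  have : NeZero p := ⟨by have := h.three_le; omega⟩
  have eq_iff (i j : ℤ) : w i = w j ↔ (i : ZMod p) = j := by
    rw [h.apply_eq_iff, dvd_sub_comm, ← ZMod.intCast_eq_intCast_iff_dvd_sub]
  have val_eq (j : ℤ) : w ((j : ZMod p).val : ℤ) = w j := (eq_iff _ _).2 (by simp)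
  refine ⟨fun i => w i.val, fun i j hij => ?_, funext fun j => (val_eq j).symm⟩
  simpa using (eq_iff _ _).1 hij

end IsTracing

theorem polygon_eq_traceEdges {p : ℕ} (v : ZMod p → E3) :
    polygon v = traceEdges fun j => v (j : ZMod p) := by
  apply Set.Subset.antisymm
  · rintro _ ⟨i, rfl⟩
    obtain ⟨k, rfl⟩ := ZMod.intCast_surjective i
    exact ⟨k, by push_cast; rfl⟩
  · rintro _ ⟨k, rfl⟩
    exact ⟨k, by push_cast; rfl⟩

theorem isTracing_intCast {α : Type*} {p : ℕ} (hp : 3 ≤ p) {v : ZMod p → α}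
    (hv : Function.Injective v) : IsTracing p fun j : ℤ => v j :=
  ⟨hp, fun i j => by
    rw [hv.eq_iff, ZMod.intCast_eq_intCast_iff_dvd_sub, dvd_sub_comm]⟩

theorem isPolygon_iff_exists_isTracing {p : ℕ} {F : Set (Sym2 E3)} :
    IsPolygon p F ↔ ∃ w, IsTracing p w ∧ F = traceEdges w := by
  constructor
  · rintro ⟨hp, v, hv, rfl⟩
    exact ⟨_, isTracing_intCast hp hv, polygon_eq_traceEdges v⟩
  · rintro ⟨w, hw, rfl⟩
    obtain ⟨v, hv, rfl⟩ := hw.exists_zmod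
    exact ⟨hw.three_le, v, hv, (polygon_eq_traceEdges v).symm⟩

namespace Skeletal

variable {P : Skeletal} {w a b : ℤ → E3}

/-- The sequence `w` runs round a face of `P`. -/
def Tracks (P : Skeletal) (w : ℤ → E3) : Prop :=
  (∃ p, IsTracing p w) ∧ traceEdges w ∈ P.faces

namespace Tracks

theorem shift (h : P.Tracks w) (k : ℤ) : P.Tracks fun j => w (k + j) :=
  ⟨h.1.imp fun _ hp => hp.shift k, by rw [traceEdges_shift]; exact h.2⟩

theorem reflect (h : P.Tracks w) (k : ℤ) : P.Tracks fun j => w (k - j) :=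
  ⟨h.1.imp fun _ hp => hp.reflect k, by rw [traceEdges_reflect]; exact h.2⟩

theorem ext (ha : P.Tracks a) (hb : P.Tracks b) (hE : traceEdges a = traceEdges b)
    (h0 : a 0 = b 0) (h1 : a 1 = b 1) : a = b := by
  obtain ⟨p, hp⟩ := ha.1
  obtain ⟨q, hq⟩ := hb.1
  exact hp.eq_of_traceEdges_eq hq hE h0 h1

theorem eq_shift_or_reflect (ha : P.Tracks a) (hb : P.Tracks b)
    (hE : traceEdges a = traceEdges b) :
    ∃ k, (b = fun j => a (k + j)) ∨ (b = fun j => a (k - j)) := by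
  obtain ⟨p, hp⟩ := ha.1
  obtain ⟨q, hq⟩ := hb.1
  exact hp.eq_shift_or_reflect hq hE

theorem exists_start (h : P.Tracks w) {x y : E3} (he : s(x, y) ∈ traceEdges w) :
    ∃ a, P.Tracks a ∧ traceEdges a = traceEdges w ∧ a 0 = x ∧ a 1 = y := by
  obtain ⟨k, h0, h1 | h1⟩ := exists_apply_eq_of_mk_mem_traceEdges he
  · exact ⟨_, h.shift k, traceEdges_shift w k, by simpa using h0, h1⟩
  · exact ⟨_, h.reflect k, traceEdges_reflect w k, by simpa using h0, h1⟩

theorem apply_ne_apply_add_two (h : P.Tracks w) (i : ℤ) : w i ≠ w (i + 2) :=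
  h.1.elim fun _ hp => hp.apply_ne_apply_add i (by norm_num) (by norm_num)

theorem apply_neg_one_ne_apply_one (h : P.Tracks w) : w (-1) ≠ w 1 := by
  simpa using h.apply_ne_apply_add_two (-1)

theorem eq_one_or_neg_one_of_mk_mem (h : P.Tracks w) {y : E3} (hy : s(w 0, y) ∈ traceEdges w) :
    y = w 1 ∨ y = w (-1) :=
  h.1.elim fun _ hp => hp.eq_one_or_neg_one_of_mk_mem hy

end Tracks

end Skeletal

/-! ### Polyhedra and the tracings of their faces -/

namespace Skeletal

variable {P : Skeletal} {w a b : ℤ → E3}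

namespace IsPolyhedron

variable (hP : P.IsPolyhedron)
include hP

theorem exists_tracks {F : Set (Sym2 E3)} (hF : F ∈ P.faces) :
    ∃ w, P.Tracks w ∧ traceEdges w = F := by
  obtain ⟨p, hp⟩ := (hP.face_spec F hF).1
  obtain ⟨w, hw, rfl⟩ := isPolygon_iff_exists_isTracing.1 hp
  exact ⟨w, ⟨⟨p, hw⟩, hF⟩, rfl⟩

theorem exists_tracks_start {F : Set (Sym2 E3)} (hF : F ∈ P.faces) {x y : E3} (he : s(x, y) ∈ F) :
    ∃ w, P.Tracks w ∧ traceEdges w = F ∧ w 0 = x ∧ w 1 = y := by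
  obtain ⟨a, ha, rfl⟩ := hP.exists_tracks hF
  exact ha.exists_start he

theorem mk_mem_edges (h : P.Tracks w) (i : ℤ) : s(w i, w (i + 1)) ∈ P.edges :=
  (hP.face_spec _ h.2).2 (mk_mem_traceEdges rfl)

theorem apply_mem_verts (h : P.Tracks w) (i : ℤ) : w i ∈ P.verts :=
  (hP.edge_spec _ (hP.mk_mem_edges h i)).2 _ (Sym2.mem_mk_left _ _)

theorem ne_of_edge {x y : E3} (h : s(x, y) ∈ P.edges) : x ≠ y :=
  (hP.edge_spec _ h).1

theorem left_mem_verts {x y : E3} (h : s(x, y) ∈ P.edges) : x ∈ P.verts :=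
  (hP.edge_spec _ h).2 _ (Sym2.mem_mk_left _ _)

theorem right_mem_verts {x y : E3} (h : s(x, y) ∈ P.edges) : y ∈ P.verts :=
  (hP.edge_spec _ h).2 _ (Sym2.mem_mk_right _ _)

theorem exists_face {e : Sym2 E3} (he : e ∈ P.edges) : ∃ F ∈ P.faces, e ∈ F :=
  Set.nonempty_of_ncard_ne_zero ((hP.two_faces e he).trans_ne two_ne_zero)

theorem exists_other_face {e : Sym2 E3} (he : e ∈ P.edges) {F : Set (Sym2 E3)} (hF : F ∈ P.faces)
    (heF : e ∈ F) : ∃ G ∈ P.faces, e ∈ G ∧ G ≠ F ∧ ∀ H ∈ P.faces, e ∈ H → H = F ∨ H = G := by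
  obtain ⟨A, B, hAB, h⟩ := Set.ncard_eq_two.1 (hP.two_faces e he)
  replace h (H) : H ∈ P.faces ∧ e ∈ H ↔ H = A ∨ H = B := Set.ext_iff.1 h H
  have hA := (h A).2 (.inl rfl)
  have hB := (h B).2 (.inr rfl)
  rcases (h F).1 ⟨hF, heF⟩ with rfl | rfl
  · exact ⟨B, hB.1, hB.2, hAB.symm, fun H hH heH => (h H).1 ⟨hH, heH⟩⟩
  · exact ⟨A, hA.1, hA.2, hAB, fun H hH heH => ((h H).1 ⟨hH, heH⟩).symm⟩

theorem exists_edge {x : E3} (hx : x ∈ P.verts) : ∃ y, s(x, y) ∈ P.edges := by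
  obtain ⟨⟨u, hu⟩⟩ := (hP.vertexFigure_connected ⟨x, hx⟩).nonempty
  exact ⟨u, hu.2⟩

theorem exists_tracks_of_edge {x y : E3} (he : s(x, y) ∈ P.edges) :
    ∃ w, P.Tracks w ∧ w 0 = x ∧ w 1 = y := by
  obtain ⟨F, hF, heF⟩ := hP.exists_face he
  obtain ⟨w, hw, -, h0, h1⟩ := hP.exists_tracks_start hF heF
  exact ⟨w, hw, h0, h1⟩

theorem edge_induction {p : E3 → Prop} {x₀ : E3} (hx₀ : x₀ ∈ P.verts) (h0 : p x₀)
    (hs : ∀ x y, s(x, y) ∈ P.edges → p x → p y) : ∀ x ∈ P.verts, p x := by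
  intro x hx
  have walk_induction (u v : P.verts) (W : P.edgeGraph.Walk u v) : p u → p v := by
    induction W with
    | nil => exact id
    | cons h _ ih => exact fun hu => ih (hs _ _ h.2 hu)
  obtain ⟨W⟩ := hP.connected.preconnected ⟨x₀, hx₀⟩ ⟨x, hx⟩
  exact walk_induction _ _ W h0

theorem vertexFigure_induction {x : E3} {p : E3 → Prop} {y₀ : E3} (hy₀ : s(x, y₀) ∈ P.edges)
    (h0 : p y₀) (hs : ∀ w, P.Tracks w → w 0 = x → p (w (-1)) → p (w 1)) :
    ∀ y, s(x, y) ∈ P.edges → p y := by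
  intro y hy
  let v : P.verts := ⟨x, hP.left_mem_verts hy⟩
  let neighbour (z) (hz : s(x, z) ∈ P.edges) : {u : P.verts // P.edgeGraph.Adj v u} :=
    ⟨⟨z, hP.right_mem_verts hz⟩, fun e => hP.ne_of_edge hz (congrArg Subtype.val e), hz⟩
  have walk_induction (u u') (W : (P.vertexFigure v).Walk u u') : p u.1 → p u'.1 := by
    induction W with
    | nil => exact id
    | @cons u w _ h _ ih =>
      obtain ⟨hne, F, hF, h1, h2⟩ := h
      obtain ⟨a, ha, rfl, a0, a1⟩ := hP.exists_tracks_start hF h2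
      have hu : (u.1 : E3) = a (-1) := by
        rw [Sym2.eq_swap, ← a0] at h1
        refine (ha.eq_one_or_neg_one_of_mk_mem h1).resolve_left fun e => hne ?_
        exact Subtype.ext (Subtype.ext (e.trans a1))
      exact fun h => ih (a1 ▸ hs a ha a0 (hu ▸ h))
  obtain ⟨W⟩ := (hP.vertexFigure_connected v).preconnected (neighbour y₀ hy₀) (neighbour y hy)
  exact walk_induction _ _ W h0

end IsPolyhedron

/-! ### Automorphisms induced by permutations of space -/

theorem map_symm_eq {f : Equiv.Perm E3} (h : P.map f = P) : P.map f.symm = P := by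
  conv_lhs => rw [← h]
  rw [map_map, show f.symm ∘ f = id from funext f.symm_apply_apply, map_id]

theorem Tracks.map (h : P.Tracks w) {f : E3 → E3} (hf : Function.Injective f) :
    (P.map f).Tracks fun i => f (w i) :=
  ⟨h.1.imp fun _ hp => hp.comp hf.injOn, _, h.2, image_traceEdges f w⟩

theorem Tracks.of_map_eq (h : P.Tracks w) {f : E3 → E3} (hf : Function.Injective f)
    (hP : P.map f = P) : P.Tracks fun i => f (w i) :=
  hP ▸ h.map hf

/-- The action of a permutation of space preserving `P` on the cells of `P`. -/
noncomputable def permAct (f : Equiv.Perm E3) (h : P.map f = P) : Cell P → Cell P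
  | .vertex v => .vertex ⟨f v, (mem_of_map_eq h).1 _ v.2⟩
  | .edge e => .edge ⟨Sym2.map f e, (mem_of_map_eq h).2.1 _ e.2⟩
  | .face F => .face ⟨Sym2.map f '' F, (mem_of_map_eq h).2.2 _ F.2⟩

theorem permAct_mono (f : Equiv.Perm E3) (h : P.map f = P) {x y : Cell P} (hxy : x ≤ y) :
    permAct f h x ≤ permAct f h y := by
  change Cell.Incident _ _
  replace hxy : Cell.Incident x y := hxy
  cases x <;> cases y <;> simp only [Cell.Incident, permAct, polygonVertices] at hxy ⊢
  · rw [hxy]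
  · exact Sym2.mem_map.2 ⟨_, hxy, rfl⟩
  · obtain ⟨e, he, hv⟩ := hxy
    exact ⟨_, ⟨e, he, rfl⟩, Sym2.mem_map.2 ⟨_, hv, rfl⟩⟩
  · rw [hxy]
  · exact ⟨_, hxy, rfl⟩
  · rw [hxy]

theorem permAct_permAct (f f' : Equiv.Perm E3) (h : P.map f = P) (h' : P.map f' = P)
    (hff' : ∀ x, f (f' x) = x) (x : Cell P) : permAct f h (permAct f' h' x) = x := by
  have map_map_eq (e : Sym2 E3) : Sym2.map f (Sym2.map f' e) = e := by
    rw [Sym2.map_map, show f ∘ f' = id from funext hff', Sym2.map_id, id]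
  cases x with
  | vertex v => exact congrArg Cell.vertex (Subtype.ext (hff' v))
  | edge e => exact congrArg Cell.edge (Subtype.ext (map_map_eq e))
  | face F =>
    refine congrArg Cell.face (Subtype.ext ?_)
    simp only [Set.image_image, map_map_eq, Set.image_id']

/-- The automorphism induced by a permutation of space preserving `P`. -/
noncomputable def permAut (f : Equiv.Perm E3) (h : P.map f = P) : P.Aut where
  toFun := permAct f h
  invFun := permAct f.symm (map_symm_eq h)
  left_inv := permAct_permAct _ _ _ _ f.symm_apply_apply
  right_inv := permAct_permAct _ _ _ _ f.apply_symm_apply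
  map_rel_iff' {x y} := by
    refine ⟨fun hxy => ?_, permAct_mono f h⟩
    simpa only [Equiv.coe_fn_mk, permAct_permAct _ _ _ _ f.symm_apply_apply]
      using permAct_mono f.symm (map_symm_eq h) hxy

theorem symmetryToAut_eq_permAut (g : P.symmetryGroup) :
    P.symmetryToAut g = permAut (g : E3 ≃ᵢ E3).toEquiv g.2 := by
  ext c
  cases c <;> rfl

end Skeletal

/-! ### Flags -/

namespace Skeletal

variable {P : Skeletal} {w a b c : ℤ → E3}

namespace Cell

/-- The rank of a cell in the underlying abstract polyhedron. -/
def rank : Cell P → Fin 3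
  | .vertex _ => 0
  | .edge _ => 1
  | .face _ => 2

theorem rank_strictMono : StrictMono (rank (P := P)) := by
  intro x y hxy
  have hle : Incident x y := hxy.le
  have hne := hxy.ne
  cases x <;> cases y <;> simp_all [Incident, rank]

theorem eq_of_comparable {x y : Cell P} (hxy : x ≤ y ∨ y ≤ x) (hr : rank x = rank y) : x = y :=
  hxy.elim (fun h => h.eq_of_not_lt fun hlt => (rank_strictMono hlt).ne hr)
    fun h => (h.eq_of_not_lt fun hlt => (rank_strictMono hlt).ne hr.symm).symm

end Cell

namespace IsPolyhedron

variable (hP : P.IsPolyhedron)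

/-- The vertex of the flag given by a tracing of a face. -/
def vert (h : P.Tracks w) : Cell P := .vertex ⟨w 0, hP.apply_mem_verts h 0⟩

/-- The edge of the flag given by a tracing of a face. -/
def edge (h : P.Tracks w) : Cell P := .edge ⟨s(w 0, w 1), hP.mk_mem_edges h 0⟩

/-- The face of the flag given by a tracing of a face. -/
def face (_hP : P.IsPolyhedron) (h : P.Tracks w) : Cell P := .face ⟨traceEdges w, h.2⟩

include hP

theorem vert_eq_iff {ha : P.Tracks a} {hb : P.Tracks b} :
    hP.vert ha = hP.vert hb ↔ a 0 = b 0 := by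
  simp [vert]

theorem edge_eq_iff {ha : P.Tracks a} {hb : P.Tracks b} :
    hP.edge ha = hP.edge hb ↔ s(a 0, a 1) = s(b 0, b 1) := by
  simp only [edge, Cell.edge.injEq, Subtype.mk.injEq]

theorem face_eq_iff {ha : P.Tracks a} {hb : P.Tracks b} :
    hP.face ha = hP.face hb ↔ traceEdges a = traceEdges b := by
  simp only [face, Cell.face.injEq, Subtype.mk.injEq]

theorem vert_le_edge (h : P.Tracks w) : hP.vert h ≤ hP.edge h :=
  Sym2.mem_mk_left (w 0) (w 1)

theorem edge_le_face (h : P.Tracks w) : hP.edge h ≤ hP.face h :=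
  mk_mem_traceEdges (w := w) (i := 0) rfl

theorem exists_vertex_le (x : Cell P) : ∃ v, Cell.vertex v ≤ x := by
  have edge_case (e : P.edges) : ∃ v, Cell.vertex v ≤ Cell.edge e :=
    ⟨⟨_, (hP.edge_spec _ e.2).2 _ (Sym2.out_fst_mem _)⟩, Sym2.out_fst_mem (e : Sym2 E3)⟩
  cases x with
  | vertex v => exact ⟨v, le_rfl⟩
  | edge e => exact edge_case e
  | face F =>
    obtain ⟨w, hw, hF⟩ := hP.exists_tracks F.2
    refine (edge_case ⟨_, hP.mk_mem_edges hw 0⟩).imp fun v hv => hv.trans ?_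
    exact hF.subset (mk_mem_traceEdges rfl)

theorem exists_le_face (x : Cell P) : ∃ F, x ≤ Cell.face F := by
  have edge_case (e : P.edges) : ∃ F, Cell.edge e ≤ Cell.face F :=
    let ⟨F, hF, he⟩ := hP.exists_face e.2
    ⟨⟨F, hF⟩, he⟩
  cases x with
  | vertex v =>
    obtain ⟨y, hy⟩ := hP.exists_edge v.2
    refine (edge_case ⟨_, hy⟩).imp fun F => le_trans ?_
    exact Sym2.mem_mk_left (v : E3) y
  | edge e => exact edge_case e
  | face F => exact ⟨F, le_rfl⟩

theorem isMin_iff {x : Cell P} : IsMin x ↔ ∃ v, x = .vertex v := by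
  constructor
  · intro h
    obtain ⟨v, hv⟩ := hP.exists_vertex_le x
    exact ⟨v, h.eq_of_ge hv⟩
  · rintro ⟨v, rfl⟩ (y | y | y) hy
    exacts [le_of_eq (congrArg Cell.vertex (Eq.symm hy)), hy.elim, hy.elim]

theorem isMax_iff {x : Cell P} : IsMax x ↔ ∃ F, x = .face F := by
  constructor
  · intro h
    obtain ⟨F, hF⟩ := hP.exists_le_face x
    exact ⟨F, h.eq_of_le hF⟩
  · rintro ⟨v, rfl⟩ (y | y | y) hy
    exacts [hy.elim, hy.elim, le_of_eq (congrArg Cell.face (Eq.symm hy))]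

theorem flag_nonempty (Φ : Flag (Cell P)) : (Φ : Set (Cell P)).Nonempty := by
  obtain ⟨v⟩ := hP.connected.nonempty
  by_contra hΦ
  have hv : Cell.vertex v ∈ Φ := Flag.mem_iff_forall_le_or_ge.2 fun x hx => (hΦ ⟨x, hx⟩).elim
  exact hΦ ⟨_, hv⟩

theorem exists_vertex_mem_flag (Φ : Flag (Cell P)) : ∃ v, Cell.vertex v ∈ Φ := by
  have := Cell.rank_strictMono (P := P).wellFoundedLT
  obtain ⟨m, hm, hmin⟩ := wellFounded_lt.has_min (Φ : Set (Cell P)) (hP.flag_nonempty Φ)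
  obtain ⟨v, hv⟩ := hP.exists_vertex_le m
  refine ⟨v, Flag.mem_iff_forall_le_or_ge.2 fun x hx => .inl (hv.trans ?_)⟩
  exact (Φ.le_or_le hm hx).elim id fun h => (h.eq_of_not_lt (hmin x hx)).ge

theorem exists_face_mem_flag (Φ : Flag (Cell P)) : ∃ F, Cell.face F ∈ Φ := by
  have := Cell.rank_strictMono (P := P).wellFoundedGT
  obtain ⟨m, hm, hmax⟩ := wellFounded_gt.has_min (Φ : Set (Cell P)) (hP.flag_nonempty Φ)
  obtain ⟨F, hF⟩ := hP.exists_le_face m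
  refine ⟨F, Flag.mem_iff_forall_le_or_ge.2 fun x hx => .inr (le_trans ?_ hF)⟩
  exact (Φ.le_or_le hx hm).elim id fun h => (h.eq_of_not_lt (hmax x hx)).ge

theorem exists_edge_mem_flag (Φ : Flag (Cell P)) : ∃ e, Cell.edge e ∈ Φ := by
  by_contra! hΦ
  obtain ⟨v, hv⟩ := hP.exists_vertex_mem_flag Φ
  obtain ⟨F, hF⟩ := hP.exists_face_mem_flag Φ
  have hvF : Cell.vertex v ≤ Cell.face F := (Φ.le_or_le hv hF).resolve_right id
  obtain ⟨e, heF, hve⟩ := hvF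
  have he : e ∈ P.edges := (hP.face_spec _ F.2).2 heF
  refine hΦ ⟨e, he⟩ (Flag.mem_iff_forall_le_or_ge.2 fun x hx => ?_)
  cases x with
  | vertex u => exact .inr (Cell.eq_of_comparable (Φ.le_or_le hx hv) rfl ▸ hve)
  | edge d => exact (hΦ d hx).elim
  | face G => exact .inl (Cell.eq_of_comparable (Φ.le_or_le hx hF) rfl ▸ heF)

theorem exists_tracks_cells {v : P.verts} {e : P.edges} {F : P.faces}
    (hve : Cell.vertex v ≤ Cell.edge e) (heF : Cell.edge e ≤ Cell.face F) :
    ∃ w, ∃ h : P.Tracks w, hP.vert h = .vertex v ∧ hP.edge h = .edge e ∧ hP.face h = .face F := by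
  obtain ⟨e, he⟩ := e
  obtain ⟨u, rfl⟩ := Sym2.mem_iff_exists.1 hve
  obtain ⟨w, hw, hF, h0, h1⟩ := hP.exists_tracks_start F.2 heF
  exact ⟨w, hw, congrArg Cell.vertex (Subtype.ext h0),
    congrArg Cell.edge (Subtype.ext (congrArg₂ Sym2.mk h0 h1)), congrArg Cell.face (Subtype.ext hF)⟩

theorem exists_tracks_flag (Φ : Flag (Cell P)) :
    ∃ w, ∃ h : P.Tracks w, (Φ : Set (Cell P)) = {hP.vert h, hP.edge h, hP.face h} := by
  obtain ⟨v, hv⟩ := hP.exists_vertex_mem_flag Φ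
  obtain ⟨e, he⟩ := hP.exists_edge_mem_flag Φ
  obtain ⟨F, hF⟩ := hP.exists_face_mem_flag Φ
  obtain ⟨w, hw, hwv, hwe, hwF⟩ := hP.exists_tracks_cells
    ((Φ.le_or_le hv he).resolve_right id) ((Φ.le_or_le he hF).resolve_right id)
  refine ⟨w, hw, Set.Subset.antisymm (fun x hx => ?_) ?_⟩
  · rw [hwv, hwe, hwF]
    cases x with
    | vertex u => exact .inl (Cell.eq_of_comparable (Φ.le_or_le hx hv) rfl)
    | edge d => exact .inr (.inl (Cell.eq_of_comparable (Φ.le_or_le hx he) rfl))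
    | face G => exact .inr (.inr (Cell.eq_of_comparable (Φ.le_or_le hx hF) rfl))
  · rw [hwv, hwe, hwF]
    rintro _ (rfl | rfl | rfl)
    exacts [hv, he, hF]

/-- `γ` maps the flag of the tracing `a` to that of `b`. -/
def Carries (γ : P.Aut) (ha : P.Tracks a) (hb : P.Tracks b) : Prop :=
  γ (hP.vert ha) = hP.vert hb ∧ γ (hP.edge ha) = hP.edge hb ∧ γ (hP.face ha) = hP.face hb

theorem Carries.symm_trans {γ δ : P.Aut} {ha : P.Tracks a} {hb : P.Tracks b} {hc : P.Tracks c}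
    (hγ : hP.Carries γ ha hb) (hδ : hP.Carries δ ha hc) : hP.Carries (δ * γ⁻¹) hb hc := by
  simp only [Carries, RelIso.mul_apply, ← hγ.1, ← hγ.2.1, ← hγ.2.2, RelIso.inv_apply_self]
  exact hδ

theorem Carries.smul_flag_eq {Φ Ψ : Flag (Cell P)} {ha : P.Tracks a} {hb : P.Tracks b}
    (hΦ : (Φ : Set (Cell P)) = {hP.vert ha, hP.edge ha, hP.face ha})
    (hΨ : (Ψ : Set (Cell P)) = {hP.vert hb, hP.edge hb, hP.face hb}) {γ : P.Aut}
    (hγ : hP.Carries γ ha hb) : γ • Φ = Ψ := by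
  apply SetLike.coe_injective
  rw [Flag.coe_smul, hΦ, hΨ, ← hγ.1, ← hγ.2.1, ← hγ.2.2]
  ext x
  simp [Set.mem_smul_set, eq_comm]

theorem carries_permAut {f : Equiv.Perm E3} (h : P.map f = P) (ha : P.Tracks a) (hb : P.Tracks b)
    (hab : ∀ i, f (a i) = b i) : hP.Carries (permAut f h) ha hb := by
  refine ⟨congrArg Cell.vertex (Subtype.ext (hab 0)), congrArg Cell.edge (Subtype.ext ?_),
    congrArg Cell.face (Subtype.ext ?_)⟩
  · exact congrArg₂ (fun x y => s(x, y)) (hab 0) (hab 1)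
  · exact (image_traceEdges f a).trans (congrArg traceEdges (funext hab))

theorem exists_apply_vertex (γ : P.Aut) (v : P.verts) : ∃ x, γ (.vertex v) = .vertex x := by
  rw [← hP.isMin_iff, γ.isMin_apply, hP.isMin_iff]
  exact ⟨v, rfl⟩

theorem exists_apply_face (γ : P.Aut) (F : P.faces) : ∃ x, γ (.face F) = .face x := by
  rw [← hP.isMax_iff, γ.isMax_apply, hP.isMax_iff]
  exact ⟨F, rfl⟩

theorem exists_apply_edge (γ : P.Aut) (e : P.edges) : ∃ x, γ (.edge e) = .edge x := by
  have hmin : ¬ IsMin (γ (.edge e)) := by simp [γ.isMin_apply, hP.isMin_iff]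
  have hmax : ¬ IsMax (γ (.edge e)) := by simp [γ.isMax_apply, hP.isMax_iff]
  rw [hP.isMin_iff] at hmin
  rw [hP.isMax_iff] at hmax
  cases h : γ (.edge e) with
  | vertex v => exact (hmin ⟨v, h⟩).elim
  | edge d => exact ⟨d, rfl⟩
  | face F => exact (hmax ⟨F, h⟩).elim

theorem exists_carries (γ : P.Aut) (ha : P.Tracks a) :
    ∃ b, ∃ hb : P.Tracks b, hP.Carries γ ha hb := by
  obtain ⟨v, hv⟩ := hP.exists_apply_vertex γ ⟨a 0, hP.apply_mem_verts ha 0⟩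
  obtain ⟨e, he⟩ := hP.exists_apply_edge γ ⟨s(a 0, a 1), hP.mk_mem_edges ha 0⟩
  obtain ⟨F, hF⟩ := hP.exists_apply_face γ ⟨traceEdges a, ha.2⟩
  have hve : γ (hP.vert ha) ≤ γ (hP.edge ha) := γ.monotone (hP.vert_le_edge ha)
  have heF : γ (hP.edge ha) ≤ γ (hP.face ha) := γ.monotone (hP.edge_le_face ha)
  rw [vert, edge, hv, he] at hve
  rw [edge, face, he, hF] at heF
  obtain ⟨b, hb, hbv, hbe, hbF⟩ := hP.exists_tracks_cells hve heF
  exact ⟨b, hb, hv.trans hbv.symm, he.trans hbe.symm, hF.trans hbF.symm⟩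

/-! ### Automorphisms are determined by their effect on a flag -/

theorem Carries.reflect_one {γ : P.Aut} {h : P.Tracks w} (hγ : hP.Carries γ h h) :
    hP.Carries γ (h.reflect 1) (h.reflect 1) := by
  have hE : hP.edge (h.reflect 1) = hP.edge h := by
    simp only [edge_eq_iff, sub_zero, sub_self, Sym2.eq_swap]
  have hF : hP.face (h.reflect 1) = hP.face h := hP.face_eq_iff.2 (traceEdges_reflect w 1)
  obtain ⟨c, hc, hcv, hce, -⟩ := hP.exists_carries γ (h.reflect 1)
  suffices hc0 : c 0 = w 1 by
    refine ⟨hcv.trans (hP.vert_eq_iff.2 (by simpa using hc0)), by rw [hE, hγ.2.1],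
      by rw [hF, hγ.2.2]⟩
  have hcw : s(c 0, c 1) = s(w 0, w 1) := by rw [← hP.edge_eq_iff (ha := hc), ← hce, hE, hγ.2.1]
  rcases Sym2.eq_iff.1 hcw with ⟨h0, -⟩ | ⟨h0, -⟩
  · have hv : γ (hP.vert (h.reflect 1)) = γ (hP.vert h) := by rw [hcv, hγ.1, hP.vert_eq_iff, h0]
    have h10 : w (1 - 0) = w 0 := hP.vert_eq_iff.1 (γ.injective hv)
    rw [h0, ← h10, sub_zero]
  · exact h0

theorem Carries.reflect_zero {γ : P.Aut} {h : P.Tracks w} (hγ : hP.Carries γ h h) :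
    hP.Carries γ (h.reflect 0) (h.reflect 0) := by
  have hV : hP.vert (h.reflect 0) = hP.vert h := by simp [vert_eq_iff]
  have hF : hP.face (h.reflect 0) = hP.face h := hP.face_eq_iff.2 (traceEdges_reflect w 0)
  obtain ⟨c, hc, hcv, hce, hcF⟩ := hP.exists_carries γ (h.reflect 0)
  have hc0 : c 0 = w 0 := by rw [← hP.vert_eq_iff (ha := hc) (hb := h), ← hcv, hV, hγ.1]
  suffices hc1 : s(w 0, c 1) = s(w 0, w (-1)) by
    refine ⟨by rw [hV, hγ.1], hce.trans (hP.edge_eq_iff.2 ?_), by rw [hF, hγ.2.2]⟩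
    simpa [hc0] using hc1
  have hcw : traceEdges c = traceEdges w := by
    rw [← hP.face_eq_iff (ha := hc) (hb := h), ← hcF, hF, hγ.2.2]
  have hmem : s(w 0, c 1) ∈ traceEdges w := hcw ▸ hc0 ▸ mk_mem_traceEdges rfl
  rcases h.eq_one_or_neg_one_of_mk_mem hmem with h1 | h1
  · have he : γ (hP.edge (h.reflect 0)) = γ (hP.edge h) := by
      rw [hce, hγ.2.1, hP.edge_eq_iff, hc0, h1]
    have h01 := hP.edge_eq_iff.1 (γ.injective he)
    simpa [h1] using h01.symm
  · rw [h1]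

theorem Carries.across {γ : P.Aut} {ha : P.Tracks a} (hγ : hP.Carries γ ha ha)
    (hb : P.Tracks b) (h0 : a 0 = b 0) (h1 : a 1 = b 1) : hP.Carries γ hb hb := by
  have hV : hP.vert hb = hP.vert ha := hP.vert_eq_iff.2 h0.symm
  have hE : hP.edge hb = hP.edge ha := hP.edge_eq_iff.2 (by rw [h0, h1])
  refine ⟨by rw [hV, hγ.1], by rw [hE, hγ.2.1], ?_⟩
  obtain ⟨c, hc, -, hce, hcF⟩ := hP.exists_carries γ hb
  have hec : s(a 0, a 1) ∈ traceEdges c := by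
    rw [← hP.edge_eq_iff.1 (hce.symm.trans (by rw [hE, hγ.2.1]) : hP.edge hc = hP.edge ha)]
    exact mk_mem_traceEdges rfl
  obtain ⟨G, -, -, -, hG⟩ :=
    hP.exists_other_face (hP.mk_mem_edges ha 0) ha.2 (mk_mem_traceEdges rfl)
  have hbG := hG _ hb.2 (by rw [h0, zero_add, h1]; exact mk_mem_traceEdges rfl)
  have fix_of_eq (h : traceEdges b = traceEdges a) : γ (hP.face hb) = hP.face hb := by
    rw [hP.face_eq_iff.2 h, hγ.2.2]
  rcases hG _ hc.2 hec with hca | hcG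
  · exact fix_of_eq (hP.face_eq_iff.1 (γ.injective (by rw [hcF, hγ.2.2, hP.face_eq_iff, hca])))
  · exact hbG.elim fix_of_eq fun hbG => hcF.trans (hP.face_eq_iff.2 (hcG.trans hbG.symm))

theorem Carries.of_apply_zero_eq {γ : P.Aut} {ha : P.Tracks a} (hγ : hP.Carries γ ha ha)
    (hb : P.Tracks b) (h0 : a 0 = b 0) : hP.Carries γ hb hb := by
  refine hP.vertexFigure_induction (x := a 0) (y₀ := a 1)
    (p := fun y => ∀ b, ∀ hb : P.Tracks b, a 0 = b 0 → y = b 1 → hP.Carries γ hb hb)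
    (hP.mk_mem_edges ha 0) (fun b hb => hγ.across hP hb) ?_ (b 1) (h0 ▸ hP.mk_mem_edges hb 0)
    b hb h0 rfl
  intro c hc hc0 ih b hb h0 h1
  have hγc := ih _ (hc.reflect 0) (by simpa using hc0.symm) (by simp)
  exact (hγc.reflect_zero hP).across hP hb (by simpa using hc0.trans h0) (by simpa using h1)

theorem Carries.of_tracks {γ : P.Aut} {ha : P.Tracks a} (hγ : hP.Carries γ ha ha)
    (hb : P.Tracks b) : hP.Carries γ hb hb := by
  refine hP.edge_induction (p := fun x => ∀ b, ∀ hb : P.Tracks b, x = b 0 → hP.Carries γ hb hb)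
    (hP.apply_mem_verts ha 0) (fun b hb => hγ.of_apply_zero_eq hP hb) ?_ _
    (hP.apply_mem_verts hb 0) b hb rfl
  intro x y hxy ih b hb hy
  obtain ⟨c, hc, h0, h1⟩ := hP.exists_tracks_of_edge hxy
  exact ((ih c hc h0.symm).reflect_one hP).of_apply_zero_eq hP hb (by simpa [h1] using hy)

theorem eq_one_of_carries {γ : P.Aut} {h : P.Tracks w} (hγ : hP.Carries γ h h) : γ = 1 := by
  ext c
  change γ c = c
  rcases c with v | ⟨⟨x, y⟩, he⟩ | F
  · obtain ⟨y, hy⟩ := hP.exists_edge v.2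
    obtain ⟨a, ha, h0, -⟩ := hP.exists_tracks_of_edge hy
    have hv : hP.vert ha = .vertex v := congrArg Cell.vertex (Subtype.ext h0)
    rw [← hv, (hγ.of_tracks hP ha).1]
  · obtain ⟨a, ha, rfl, rfl⟩ := hP.exists_tracks_of_edge he
    exact (hγ.of_tracks hP ha).2.1
  · obtain ⟨a, ha, h0⟩ := hP.exists_tracks F.2
    have hF : hP.face ha = .face F := congrArg Cell.face (Subtype.ext h0)
    rw [← hF, (hγ.of_tracks hP ha).2.2]

theorem eq_of_carries {γ δ : P.Aut} {ha : P.Tracks a} {hb : P.Tracks b}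
    (hγ : hP.Carries γ ha hb) (hδ : hP.Carries δ ha hb) : γ = δ :=
  (mul_inv_eq_one.1 (hP.eq_one_of_carries (hγ.symm_trans hP hδ))).symm

theorem exists_smul_flag_eq {H : Subgroup P.Aut} (h : P.Tracks w)
    (hH : ∀ a, ∀ ha : P.Tracks a, ∃ γ ∈ H, hP.Carries γ h ha) (Φ Ψ : Flag (Cell P)) :
    ∃ γ ∈ H, γ • Φ = Ψ := by
  obtain ⟨a, ha, hΦ⟩ := hP.exists_tracks_flag Φ
  obtain ⟨b, hb, hΨ⟩ := hP.exists_tracks_flag Ψ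
  obtain ⟨γ, hγ, hγa⟩ := hH a ha
  obtain ⟨δ, hδ, hδb⟩ := hH b hb
  exact ⟨δ * γ⁻¹, H.mul_mem hδ (H.inv_mem hγ), (hγa.symm_trans hP hδb).smul_flag_eq hP hΦ hΨ⟩

theorem carries_symmetryToAut {L : E3 ≃ₗᵢ[ℝ] E3} (hL : P.map L = P) (ha : P.Tracks a)
    (hb : P.Tracks b) (hab : ∀ i, L (a i) = b i) :
    hP.Carries (P.symmetryToAut ⟨L.toIsometryEquiv, hL⟩) ha hb := by
  rw [symmetryToAut_eq_permAut]
  exact hP.carries_permAut _ ha hb hab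

theorem isRegular_of_forall_tracks (h : P.Tracks w)
    (htrans : ∀ a, P.Tracks a → ∃ L : E3 ≃ₗᵢ[ℝ] E3, P.map L = P ∧ ∀ i, L (w i) = a i) :
    P.IsRegular := by
  refine ⟨hP, fun Φ Ψ => ?_⟩
  have hrange (a) (ha : P.Tracks a) : ∃ γ ∈ P.symmetryToAut.range, hP.Carries γ h ha := by
    obtain ⟨L, hL, hLa⟩ := htrans a ha
    exact ⟨_, ⟨_, rfl⟩, hP.carries_symmetryToAut hL h ha hLa⟩
  obtain ⟨_, ⟨g, rfl⟩, hg⟩ := hP.exists_smul_flag_eq h hrange Φ Ψ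
  exact ⟨g, hg⟩

theorem isCombinatoriallyRegular_of_forall_tracks (h : P.Tracks w)
    (htrans : ∀ a, P.Tracks a → ∃ f : Equiv.Perm E3, P.map f = P ∧ ∀ i, f (w i) = a i) :
    P.IsCombinatoriallyRegular := by
  refine ⟨hP, fun Φ Ψ => ?_⟩
  have htop (a) (ha : P.Tracks a) : ∃ γ ∈ (⊤ : Subgroup P.Aut), hP.Carries γ h ha := by
    obtain ⟨f, hf, hfa⟩ := htrans a ha
    exact ⟨_, Subgroup.mem_top _, hP.carries_permAut hf h ha hfa⟩
  obtain ⟨γ, -, hγ⟩ := hP.exists_smul_flag_eq h htop Φ Ψ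
  exact ⟨γ, hγ⟩

end IsPolyhedron

end Skeletal

/-! ### Isometries between centred finite sets -/

section Centred

variable {V V' : Set E3} {r : ℝ} {g : E3 ≃ᵢ E3}

theorem apply_zero_of_centred (hfin : V.Finite) (hne : V.Nonempty) (hV : ∑ᶠ x ∈ V, x = 0)
    (hV' : ∑ᶠ x ∈ V', x = 0) (hr : r ≠ 0) (hg : (fun x => r • g x) '' V = V') : g 0 = 0 := by
  have hinj : Function.Injective fun x => r • g x := fun x y h =>
    g.injective (smul_right_injective E3 hr h)
  rw [← hg, finsum_mem_image hinj.injOn, finsum_mem_eq_finite_toFinset_sum _ hfin] at hV'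
  rw [finsum_mem_eq_finite_toFinset_sum _ hfin] at hV
  have hlin : ∀ x, g x = g.toRealLinearIsometryEquiv x + g 0 := fun x => by simp
  have hsum : ∑ x ∈ hfin.toFinset, r • g x = r • (hfin.toFinset.card • g 0) := by
    rw [← Finset.smul_sum]
    congr 1
    rw [Finset.sum_congr rfl fun x _ => hlin x, Finset.sum_add_distrib, ← map_sum, hV, map_zero,
      zero_add, Finset.sum_const]
  have hcard : hfin.toFinset.card ≠ 0 := by
    simpa only [ne_eq, Finset.card_eq_zero, Set.Finite.toFinset_eq_empty] using hne.ne_empty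
  rw [hsum, smul_eq_zero_iff_right hr, ← Nat.cast_smul_eq_nsmul ℝ] at hV'
  exact (smul_eq_zero_iff_right (Nat.cast_ne_zero.2 hcard)).1 hV'

theorem norm_apply_of_centred (hfin : V.Finite) (hne : V.Nonempty) (hV : ∑ᶠ x ∈ V, x = 0)
    (hV' : ∑ᶠ x ∈ V', x = 0) (hr : r ≠ 0) (hg : (fun x => r • g x) '' V = V') (x : E3) :
    ‖g x‖ = ‖x‖ := by
  simpa only [apply_zero_of_centred hfin hne hV hV' hr hg, dist_zero_right] using
    g.isometry.dist_eq x 0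

end Centred

namespace Skeletal

variable {P : Skeletal} {w : ℤ → E3}

theorem norm_apply_of_mem_symmetryGroup (hP : P.IsPolyhedron) (hsum : ∑ᶠ x ∈ P.verts, x = 0)
    {g : E3 ≃ᵢ E3} (hg : g ∈ P.symmetryGroup) (x : E3) : ‖g x‖ = ‖x‖ := by
  obtain ⟨v⟩ := hP.connected.nonempty
  refine norm_apply_of_centred hP.finite_verts ⟨v, v.2⟩ hsum hsum one_ne_zero ?_ x
  simp only [one_smul]
  exact congrArg Skeletal.verts (show P.map g = P from hg)

/-- The orbit of a point under the symmetry group of a figure. -/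
def symmetryOrbit (P : Skeletal) (v : E3) : Set E3 :=
  {w | ∃ g ∈ P.symmetryGroup, g v = w}

theorem symmetryOrbit_eq {O : Set E3} {v₀ v : E3} (hO : O ⊆ P.symmetryOrbit v₀)
    (hinv : ∀ g ∈ P.symmetryGroup, ∀ x ∈ O, g x ∈ O) (hv : v ∈ O) : P.symmetryOrbit v = O := by
  refine Set.Subset.antisymm (fun x ⟨g, hg, hgx⟩ => hgx ▸ hinv g hg v hv) fun x hx => ?_
  obtain ⟨g, hg, rfl⟩ := hO hv
  obtain ⟨g', hg', rfl⟩ := hO hx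
  exact ⟨g' * g⁻¹, mul_mem hg' (inv_mem hg), congrArg g' (g.symm_apply_apply _)⟩

/-! ### Polyhedra with two layers of vertices -/

/-- A polyhedron with vertices on two concentric spheres, whose edges join the two spheres. -/
structure TwoLayered (P : Skeletal) (A B : Set E3) (r s : ℝ) : Prop where
  poly : P.IsPolyhedron
  verts_eq : P.verts = A ∪ B
  norm_left : ∀ x ∈ A, ‖x‖ = r
  norm_right : ∀ x ∈ B, ‖x‖ = s
  radii_ne : r ≠ s
  sum_eq : ∑ᶠ x ∈ P.verts, x = 0
  edge_left : ∀ x y, s(x, y) ∈ P.edges → x ∈ A → y ∈ B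
  edge_right : ∀ x y, s(x, y) ∈ P.edges → x ∈ B → y ∈ A

namespace TwoLayered

section

variable {A B : Set E3} {r s : ℝ} (hP : P.TwoLayered A B r s)
include hP

theorem left_subset : A ⊆ P.verts := hP.verts_eq ▸ Set.subset_union_left

theorem right_subset : B ⊆ P.verts := hP.verts_eq ▸ Set.subset_union_right

theorem mem_or_mem {x : E3} (hx : x ∈ P.verts) : x ∈ A ∨ x ∈ B := by
  rwa [hP.verts_eq] at hx

theorem mem_left {x : E3} (hx : x ∈ P.verts) (h : ‖x‖ = r) : x ∈ A :=
  (hP.mem_or_mem hx).resolve_right fun hB => hP.radii_ne (h.symm.trans (hP.norm_right x hB))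

theorem mem_right {x : E3} (hx : x ∈ P.verts) (h : ‖x‖ = s) : x ∈ B :=
  (hP.mem_or_mem hx).resolve_left fun hA => hP.radii_ne ((hP.norm_left x hA).symm.trans h)

theorem apply_mem_left {g : E3 ≃ᵢ E3} (hg : g ∈ P.symmetryGroup) {x : E3} (hx : x ∈ A) :
    g x ∈ A :=
  hP.mem_left ((mem_of_map_eq hg).1 x (hP.left_subset hx))
    ((norm_apply_of_mem_symmetryGroup hP.poly hP.sum_eq hg x).trans (hP.norm_left x hx))

theorem apply_mem_right {g : E3 ≃ᵢ E3} (hg : g ∈ P.symmetryGroup) {x : E3} (hx : x ∈ B) :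
    g x ∈ B :=
  hP.mem_right ((mem_of_map_eq hg).1 x (hP.right_subset hx))
    ((norm_apply_of_mem_symmetryGroup hP.poly hP.sum_eq hg x).trans (hP.norm_right x hx))

theorem notMem_right {x : E3} (hx : x ∈ A) : x ∉ B := fun hB =>
  hP.radii_ne ((hP.norm_left x hx).symm.trans (hP.norm_right x hB))

section Transitive

variable (hw : P.Tracks w) (hwA : w 0 ∈ A)
  (hA : ∀ a, P.Tracks a → a 0 ∈ A → ∃ L : E3 ≃ₗᵢ[ℝ] E3, P.map L = P ∧ ∀ i, L (w i) = a i)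
  (hB : ∀ a, P.Tracks a → a 0 ∈ B → ∃ f : Equiv.Perm E3, P.map f = P ∧ ∀ i, f (w i) = a i)
include hA

theorem mem_range_symmetryToAut {γ : P.Aut} {x : P.verts}
    (hx : γ (hP.poly.vert hw) = .vertex x) (hxA : (x : E3) ∈ A) : γ ∈ P.symmetryToAut.range := by
  obtain ⟨b, hb, hγ⟩ := hP.poly.exists_carries γ hw
  have hbx : b 0 = x := congrArg Subtype.val (Cell.vertex.inj (hγ.1.symm.trans hx))
  obtain ⟨L, hL, hLa⟩ := hA b hb (hbx ▸ hxA)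
  exact ⟨_, hP.poly.eq_of_carries (hP.poly.carries_symmetryToAut hL hw hb hLa) hγ⟩

include hB in
theorem exists_perm {a : ℤ → E3} (ha : P.Tracks a) :
    ∃ f : Equiv.Perm E3, P.map f = P ∧ ∀ i, f (w i) = a i := by
  rcases hP.mem_or_mem (hP.poly.apply_mem_verts ha 0) with h | h
  · obtain ⟨L, hL, hLa⟩ := hA a ha h
    exact ⟨L.toEquiv, hL, hLa⟩
  · exact hB a ha h

include hw hwA hB in
theorem index_eq_two : P.index = 2 := by
  have hw1 : w 1 ∈ B := hP.edge_left _ _ (hP.poly.mk_mem_edges hw 0) hwA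
  obtain ⟨f, hf, hfw⟩ := hB _ (hw.shift 1) (by simpa using hw1)
  have hf0 : f (w 0) = w 1 := by simpa using hfw 0
  unfold index
  rw [Subgroup.index_eq_two_iff_exists_notMem_and]
  refine ⟨permAut f hf, ?_, fun γ => ?_⟩
  · rintro ⟨g, hg⟩
    have hgf : (g : E3 ≃ᵢ E3) (w 0) = f (w 0) :=
      congrArg Subtype.val (Cell.vertex.inj (DFunLike.congr_fun hg (hP.poly.vert hw)))
    exact hP.notMem_right (hP.apply_mem_left g.2 hwA) (by rwa [hgf, hf0])
  · obtain ⟨b, hb, hγ⟩ := hP.poly.exists_carries γ hw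
    rcases hP.mem_or_mem (hP.poly.apply_mem_verts hb 0) with hb0 | hb0
    · exact .inr (hP.mem_range_symmetryToAut hw hA hγ.1 hb0)
    · obtain ⟨f', hf', hfb⟩ := hP.exists_perm hA hB hb
      obtain rfl := hP.poly.eq_of_carries (hP.poly.carries_permAut hf' hw hb hfb) hγ
      refine .inl (hP.mem_range_symmetryToAut hw hA
        (x := ⟨b 1, hP.poly.apply_mem_verts hb 1⟩) ?_
        (hP.edge_right _ _ (hP.poly.mk_mem_edges hb 0) hb0))
      exact congrArg Cell.vertex (Subtype.ext ((congrArg f' hf0).trans (hfb 1)))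

include hw hwA hB in
theorem isRegularOfIndexTwo : P.IsRegularOfIndexTwo :=
  ⟨hP.poly.isCombinatoriallyRegular_of_forall_tracks hw fun _ ha => hP.exists_perm hA hB ha,
    hP.index_eq_two hw hwA hA hB⟩

theorem symmetryOrbit_eq_left {v : E3} (hv : v ∈ A) : P.symmetryOrbit v = A := by
  refine symmetryOrbit_eq (v₀ := w 0) (fun x hx => ?_) (fun g hg x => hP.apply_mem_left hg) hv
  obtain ⟨y, hy⟩ := hP.poly.exists_edge (hP.left_subset hx)
  obtain ⟨a, ha, h0, -⟩ := hP.poly.exists_tracks_of_edge hy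
  obtain ⟨L, hL, hLa⟩ := hA a ha (h0 ▸ hx)
  exact ⟨L.toIsometryEquiv, hL, (hLa 0).trans h0⟩

theorem symmetryOrbit_eq_right {v : E3} (hv : v ∈ B) : P.symmetryOrbit v = B := by
  refine symmetryOrbit_eq (v₀ := w 1) (fun x hx => ?_) (fun g hg x => hP.apply_mem_right hg) hv
  obtain ⟨y, hy⟩ := hP.poly.exists_edge (hP.right_subset hx)
  obtain ⟨a, ha, h0, h1⟩ := hP.poly.exists_tracks_of_edge hy
  obtain ⟨L, hL, hLa⟩ := hA _ (ha.reflect 1) (by simpa [h1] using hP.edge_right _ _ hy hx)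
  exact ⟨L.toIsometryEquiv, hL, (hLa 1).trans (by simpa using h0)⟩

include hw hwA in
theorem vertexOrbits_ncard : P.vertexOrbits.ncard = 2 := by
  have hw1 : w 1 ∈ B := hP.edge_left _ _ (hP.poly.mk_mem_edges hw 0) hwA
  have hAB : A ≠ B := fun h => hP.notMem_right hwA (h ▸ hwA)
  suffices P.vertexOrbits = {A, B} by rw [this, Set.ncard_pair hAB]
  ext O
  constructor
  · rintro ⟨v, hv, rfl⟩
    exact (hP.mem_or_mem hv).imp (hP.symmetryOrbit_eq_left hA) (hP.symmetryOrbit_eq_right hA)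
  · rintro (rfl | rfl)
    · exact ⟨w 0, hP.left_subset hwA, (hP.symmetryOrbit_eq_left hA hwA).symm⟩
    · exact ⟨w 1, hP.right_subset hw1, (hP.symmetryOrbit_eq_right hA hw1).symm⟩

end Transitive

end

theorem eq_or_eq_inv_of_similar {P' : Skeletal} {A B A' B' : Set E3} {R t u : ℝ} (hR : 0 < R)
    (h : P.TwoLayered A B R (t * R)) (h' : P'.TwoLayered A' B' R (u * R))
    (hA : A.Nonempty) (hB : B.Nonempty) (hsim : P.Similar P') : u = t ∨ u = t⁻¹ := by
  obtain ⟨ρ, hρ, g, rfl⟩ := hsim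
  obtain ⟨x, hx⟩ := hA
  obtain ⟨y, hy⟩ := hB
  have hxP := h.left_subset hx
  have hg := norm_apply_of_centred h.poly.finite_verts ⟨x, hxP⟩ h.sum_eq h'.sum_eq hρ.ne' rfl
  have hnorm : ∀ z ∈ P.verts, ρ * ‖z‖ = R ∨ ρ * ‖z‖ = u * R := by
    intro z hz
    have hz' : ‖ρ • g z‖ = ρ * ‖z‖ := by rw [norm_smul, hg, Real.norm_of_nonneg hρ.le]
    exact (h'.mem_or_mem ⟨z, hz, rfl⟩).imp (fun hz => hz' ▸ h'.norm_left _ hz)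
      fun hz => hz' ▸ h'.norm_right _ hz
  have hx' := hnorm x hxP
  have hy' := hnorm y (h.right_subset hy)
  rw [h.norm_left x hx] at hx'
  rw [h.norm_right y hy, ← mul_assoc] at hy'
  have ht : t ≠ 1 := fun e => h.radii_ne (by rw [e, one_mul])
  have hcancel : ∀ {p q : ℝ}, p * R = q * R → p = q := mul_right_cancel₀ hR.ne'
  rcases hx' with hx' | hx'
  · obtain rfl : ρ = 1 := hcancel (hx'.trans (one_mul R).symm)
    rcases hy' with hy' | hy'
    · exact (ht (hcancel (by linarith))).elim
    · exact .inl (hcancel (by linarith))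
  · obtain rfl : ρ = u := hcancel hx'
    rcases hy' with hy' | hy'
    · exact .inr (eq_inv_of_mul_eq_one_left (hcancel (hy'.trans (one_mul R).symm)))
    · exact (ht (mul_left_cancel₀ hρ.ne' ((hcancel hy').trans (mul_one ρ).symm))).elim

end TwoLayered

end Skeletal

/-! ### Coplanarity -/

theorem coplanar_iff_exists_inner {S : Set E3} :
    Coplanar ℝ S ↔ ∃ n : E3, n ≠ 0 ∧ ∃ k : ℝ, ∀ x ∈ S, inner ℝ n x = k := by
  have hdim := (vectorSpan ℝ S).finrank_add_finrank_orthogonal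
  rw [finrank_euclideanSpace_fin] at hdim
  rw [coplanar_iff_finrank_le_two]
  constructor
  · intro h
    rcases S.eq_empty_or_nonempty with rfl | ⟨x₀, hx₀⟩
    · exact ⟨EuclideanSpace.single 0 1, by simp, 0, by simp⟩
    have hne : (vectorSpan ℝ S)ᗮ ≠ ⊥ := by
      intro hb
      rw [hb, finrank_bot] at hdim
      omega
    obtain ⟨n, hn, hn0⟩ := Submodule.exists_mem_ne_zero_of_ne_bot hne
    refine ⟨n, hn0, inner ℝ n x₀, fun x hx => ?_⟩
    have := (Submodule.mem_orthogonal' _ _).1 hn _ (vsub_mem_vectorSpan ℝ hx hx₀)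
    rwa [vsub_eq_sub, inner_sub_right, sub_eq_zero] at this
  · rintro ⟨n, hn0, k, hk⟩
    have hle : vectorSpan ℝ S ≤ (Submodule.span ℝ {n})ᗮ := by
      rw [vectorSpan, Submodule.span_le]
      rintro _ ⟨x, hx, y, hy, rfl⟩
      refine Submodule.mem_orthogonal_singleton_iff_inner_right.2 ?_
      exact (inner_sub_right n x y).trans (sub_eq_zero.2 ((hk x hx).trans (hk y hy).symm))
    have hn := (Submodule.span ℝ {n}).finrank_add_finrank_orthogonal
    rw [finrank_span_singleton hn0, finrank_euclideanSpace_fin] at hn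
    have := Submodule.finrank_mono hle
    omega

/-! ### Criteria for polyhedra and symmetries -/

namespace Skeletal

variable {P Q : Skeletal} {w a : ℤ → E3} {R t : ℝ}

/-- The tracings of faces of `P` that begin at `x` and proceed to `y`. -/
def tracksFrom (P : Skeletal) (x y : E3) : Set (ℤ → E3) :=
  {a | P.Tracks a ∧ a 0 = x ∧ a 1 = y}

/-- The local part of the definition of a polyhedron: finitely many vertices, edges that join
distinct vertices, and faces that are polygons formed by edges. -/
structure IsPrepolyhedron (P : Skeletal) : Prop where
  finite_verts : P.verts.Finite
  edge_spec : ∀ e ∈ P.edges, ¬ e.IsDiag ∧ ∀ x ∈ e, x ∈ P.verts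
  face_spec : ∀ F ∈ P.faces, (∃ p, IsPolygon p F) ∧ F ⊆ P.edges

theorem IsPolyhedron.isPrepolyhedron (hP : P.IsPolyhedron) : P.IsPrepolyhedron :=
  ⟨hP.finite_verts, hP.edge_spec, hP.face_spec⟩

namespace IsPrepolyhedron

variable (hP : P.IsPrepolyhedron)
include hP

theorem ncard_faces_eq_ncard_tracksFrom (x y : E3) :
    {F | F ∈ P.faces ∧ s(x, y) ∈ F}.ncard = (P.tracksFrom x y).ncard := by
  have hinj : Set.InjOn traceEdges (P.tracksFrom x y) := fun a ha b hb hab =>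
    ha.1.ext hb.1 hab (ha.2.1.trans hb.2.1.symm) (ha.2.2.trans hb.2.2.symm)
  rw [← hinj.ncard_image]
  congr 1
  ext F
  constructor
  · rintro ⟨hF, he⟩
    obtain ⟨p, hp⟩ := (hP.face_spec F hF).1
    obtain ⟨w, hw, rfl⟩ := isPolygon_iff_exists_isTracing.1 hp
    obtain ⟨a, ha, hE, h0, h1⟩ := Tracks.exists_start ⟨⟨p, hw⟩, hF⟩ he
    exact ⟨a, ⟨ha, h0, h1⟩, hE⟩
  · rintro ⟨a, ⟨ha, rfl, rfl⟩, rfl⟩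
    exact ⟨ha.2, mk_mem_traceEdges (zero_add 1).symm⟩

theorem edgeGraph_connected {x₀ : E3} (hx₀ : x₀ ∈ P.verts)
    (h : ∀ S : Set E3, x₀ ∈ S → (∀ x y, s(x, y) ∈ P.edges → x ∈ S → y ∈ S) → P.verts ⊆ S) :
    P.edgeGraph.Connected := by
  rw [SimpleGraph.connected_iff_exists_forall_reachable]
  let S : Set E3 := {x | ∃ hx : x ∈ P.verts, P.edgeGraph.Reachable ⟨x₀, hx₀⟩ ⟨x, hx⟩}
  have hS : ∀ x y, s(x, y) ∈ P.edges → x ∈ S → y ∈ S := fun x y hxy ⟨hx, hr⟩ =>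
    have hadj : P.edgeGraph.Adj ⟨x, hx⟩ ⟨y, (hP.edge_spec _ hxy).2 y (Sym2.mem_mk_right x y)⟩ :=
      ⟨fun e => (hP.edge_spec _ hxy).1 (congrArg Subtype.val e), hxy⟩
    ⟨_, hr.trans hadj.reachable⟩
  exact ⟨⟨x₀, hx₀⟩, fun v => (h S ⟨hx₀, .refl _⟩ hS v.2).2⟩

theorem vertexFigure_connected {x y₀ : E3} (hx : x ∈ P.verts) (hy₀ : s(x, y₀) ∈ P.edges)
    (h : ∀ S : Set E3, y₀ ∈ S →
      (∀ a, P.Tracks a → a 0 = x → a (-1) ∈ S → a 1 ∈ S) → ∀ y, s(x, y) ∈ P.edges → y ∈ S) :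
    (P.vertexFigure ⟨x, hx⟩).Connected := by
  rw [SimpleGraph.connected_iff_exists_forall_reachable]
  let node : ∀ z, s(x, z) ∈ P.edges → {u : P.verts // P.edgeGraph.Adj ⟨x, hx⟩ u} := fun z hz =>
    ⟨⟨z, (hP.edge_spec _ hz).2 z (Sym2.mem_mk_right x z)⟩,
      fun e => (hP.edge_spec _ hz).1 (congrArg Subtype.val e), hz⟩
  let S : Set E3 := {z | ∃ hz, (P.vertexFigure ⟨x, hx⟩).Reachable (node y₀ hy₀) (node z hz)}
  have hS : ∀ a, P.Tracks a → a 0 = x → a (-1) ∈ S → a 1 ∈ S := by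
    rintro a ha rfl ⟨hy, hr⟩
    have h₀ : s(a (-1), a 0) ∈ traceEdges a := mk_mem_traceEdges (by norm_num)
    have h₁ : s(a 0, a 1) ∈ traceEdges a := mk_mem_traceEdges (by norm_num)
    have hz := (hP.face_spec _ ha.2).2 h₁
    have hadj : (P.vertexFigure ⟨a 0, hx⟩).Adj (node _ hy) (node _ hz) :=
      ⟨fun e => ha.apply_neg_one_ne_apply_one (congrArg (fun u => (u.1 : E3)) e), _, ha.2, h₀, h₁⟩
    exact ⟨hz, hr.trans hadj.reachable⟩
  exact ⟨node y₀ hy₀, fun v => (h S ⟨hy₀, .refl _⟩ hS v.1 v.2.2).2⟩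

theorem isPolyhedron {x₀ : E3} (hx₀ : x₀ ∈ P.verts)
    (hconn : ∀ S : Set E3, x₀ ∈ S → (∀ x y, s(x, y) ∈ P.edges → x ∈ S → y ∈ S) → P.verts ⊆ S)
    (hfig : ∀ x ∈ P.verts, ∃ y₀, s(x, y₀) ∈ P.edges ∧ ∀ S : Set E3, y₀ ∈ S →
      (∀ a, P.Tracks a → a 0 = x → a (-1) ∈ S → a 1 ∈ S) → ∀ y, s(x, y) ∈ P.edges → y ∈ S)
    (htwo : ∀ x y, s(x, y) ∈ P.edges → (P.tracksFrom x y).ncard = 2) : P.IsPolyhedron where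
  finite_verts := hP.finite_verts
  edge_spec := hP.edge_spec
  face_spec := hP.face_spec
  connected := hP.edgeGraph_connected hx₀ hconn
  vertexFigure_connected := fun ⟨x, hx⟩ =>
    let ⟨_, hy₀, h⟩ := hfig x hx
    hP.vertexFigure_connected hx hy₀ h
  two_faces := by
    rintro ⟨x, y⟩ hxy
    exact (hP.ncard_faces_eq_ncard_tracksFrom x y).trans (htwo x y hxy)

end IsPrepolyhedron

theorem IsPolyhedron.ncard_tracksFrom (hP : P.IsPolyhedron) {x y : E3} (hxy : s(x, y) ∈ P.edges) :
    (P.tracksFrom x y).ncard = 2 :=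
  (hP.isPrepolyhedron.ncard_faces_eq_ncard_tracksFrom x y).symm.trans (hP.two_faces _ hxy)

/-- `f` maps vertices, edges and faces of `P` to such. -/
def Stable (P : Skeletal) (f : E3 → E3) : Prop :=
  (∀ v ∈ P.verts, f v ∈ P.verts) ∧ (∀ e ∈ P.edges, Sym2.map f e ∈ P.edges) ∧
    ∀ F ∈ P.faces, Sym2.map f '' F ∈ P.faces

theorem map_eq_of_stable {f : Equiv.Perm E3} (h : P.Stable f) (h' : P.Stable f.symm) :
    P.map f = P := by
  have hinv : ∀ e : Sym2 E3, Sym2.map f (Sym2.map f.symm e) = e := by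
    intro e
    rw [Sym2.map_map, show f ∘ f.symm = id from funext f.apply_symm_apply, Sym2.map_id, id]
  refine Skeletal.ext ?_ ?_ ?_
  · exact Set.Subset.antisymm (Set.image_subset_iff.2 h.1) fun v hv =>
      ⟨_, h'.1 v hv, f.apply_symm_apply v⟩
  · exact Set.Subset.antisymm (Set.image_subset_iff.2 h.2.1) fun e he =>
      ⟨_, h'.2.1 e he, hinv e⟩
  · refine Set.Subset.antisymm (Set.image_subset_iff.2 h.2.2) fun F hF => ⟨_, h'.2.2 F hF, ?_⟩
    simp only [Set.image_image, hinv, Set.image_id']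

/-! ### Centred regular polyhedra -/

/-- A polyhedron with vertices on a sphere about their centroid `0` and with a tracing `w` of a face
which is mapped to all others by linear isometries preserving the polyhedron; the last condition
says that the vertices of the traced face with even and odd index have centroids that agree up to
sign. -/
structure CentredRegular (Q : Skeletal) (w : ℤ → E3) (R : ℝ) : Prop where
  poly : Q.IsPolyhedron
  tracks : Q.Tracks w
  trans : ∀ a, Q.Tracks a → ∃ L : E3 ≃ₗᵢ[ℝ] E3, Q.map L = Q ∧ ∀ i, L (w i) = a i
  pos : 0 < R
  norm_eq : ∀ x ∈ Q.verts, ‖x‖ = R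
  sum_eq : ∑ᶠ x ∈ Q.verts, x = 0
  span : ∀ n : E3, inner ℝ n (w 0) = 0 → inner ℝ n (w 1) = 0 → inner ℝ n (w 2) = 0 → n = 0
  balanced : ∃ N : ℕ, 0 < N ∧ ∃ ε : ℝ, (ε = 1 ∨ ε = -1) ∧
    ∑ j ∈ Finset.range N, w (2 * j) = ε • ∑ j ∈ Finset.range N, w (2 * j + 1)

theorem CentredRegular.isRegular (h : Q.CentredRegular w R) : Q.IsRegular :=
  h.poly.isRegular_of_forall_tracks h.tracks h.trans

/-- The sequence `w 0, t w 1, w 2, t w 3, …`; it is `alternate` for sequences indexed by `ℤ`. -/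
def alt (w : ℤ → E3) (t : ℝ) (j : ℤ) : E3 :=
  if Even j then w j else t • w j

theorem alt_even {j : ℤ} (h : Even j) : alt w t j = w j := if_pos h

theorem alt_odd {j : ℤ} (h : ¬ Even j) : alt w t j = t • w j := if_neg h

theorem alt_shift {k : ℤ} (hk : Even k) (j : ℤ) :
    alt w t (k + j) = alt (fun i => w (k + i)) t j := by
  simp only [alt, Int.even_add, hk, true_iff]

theorem alt_reflect {k : ℤ} (hk : Even k) (j : ℤ) :
    alt w t (k - j) = alt (fun i => w (k - i)) t j := by
  simp only [alt, Int.even_sub, hk, true_iff]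

theorem map_alt (L : E3 ≃ₗᵢ[ℝ] E3) (h : ∀ i, L (w i) = a i) (j : ℤ) :
    L (alt w t j) = alt a t j := by
  unfold alt
  split_ifs
  · exact h j
  · rw [map_smul, h]

theorem alt_injective (ht : t ≠ 0) : Function.Injective fun w => alt w t := by
  intro w a e
  funext j
  have hj : alt w t j = alt a t j := congrFun e j
  unfold alt at hj
  split_ifs at hj
  · exact hj
  · exact smul_right_injective E3 ht hj

theorem CentredRegular.not_coplanar_alt (h : Q.CentredRegular w R) (ht : 0 < t) (ht1 : t ≠ 1)
    (ha : Q.Tracks a) : ¬ Coplanar ℝ (Set.range (alt a t)) := by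
  rw [coplanar_iff_exists_inner]
  rintro ⟨n, hn, k, hk⟩
  obtain ⟨L, -, hL⟩ := h.trans a ha
  have hw : ∀ j, inner ℝ (L.symm n) (alt w t j) = k := fun j => by
    rw [← hk _ ⟨j, rfl⟩, ← map_alt L hL, LinearIsometryEquiv.inner_map_eq_flip,
      LinearIsometryEquiv.symm_symm]
  have heven : ∀ j : ℤ, inner ℝ (L.symm n) (w (2 * j)) = k := fun j => by
    rw [← hw (2 * j), alt_even (even_two_mul j)]
  have hodd : ∀ j : ℤ, t * inner ℝ (L.symm n) (w (2 * j + 1)) = k := fun j => by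
    rw [← hw (2 * j + 1), alt_odd (Int.not_even_two_mul_add_one j), inner_smul_right]
  -- Pairing the balance condition with the normal vector gives `N t k = ε N k`, where `t ≠ ε`.
  have hk0 : k = 0 := by
    obtain ⟨N, hN, ε, hε, hsum⟩ := h.balanced
    have hpair := congrArg (fun x => t * inner ℝ (L.symm n) x) hsum
    simp only [inner_smul_right, inner_sum, heven, mul_left_comm t ε, Finset.mul_sum, hodd,
      Finset.sum_const, Finset.card_range, nsmul_eq_mul] at hpair
    have htε : t ≠ ε := by
      rcases hε with rfl | rfl
      · exact ht1
      · linarith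
    have hN' : (N : ℝ) ≠ 0 := Nat.cast_ne_zero.2 hN.ne'
    have hprod : (N : ℝ) * ((t - ε) * k) = 0 := by linarith
    simpa only [mul_eq_zero, hN', sub_eq_zero, htε, false_or] using hprod
  subst hk0
  have hL0 := h.span (L.symm n) (heven 0)
    ((mul_eq_zero.1 (hodd 0)).resolve_left ht.ne') (heven 1)
  exact hn (by simpa using hL0)

end Skeletal

theorem IsTracing.alt {p : ℕ} {w : ℤ → E3} {R t : ℝ} (h : IsTracing p w) (hw : ∀ i, ‖w i‖ = R)
    (hR : 0 < R) (ht : 0 < t) (ht1 : t ≠ 1) :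
    IsTracing (Nat.lcm 2 p) (Skeletal.alt w t) := by
  have hp := h.three_le
  refine ⟨?_, fun i j => ?_⟩
  · exact hp.trans (Nat.le_of_dvd (Nat.lcm_pos two_pos (by omega)) (Nat.dvd_lcm_right 2 p))
  · have hne : ∀ x y : E3, ‖x‖ = R → ‖y‖ = R → x ≠ t • y := by
      intro x y hx hy e
      rw [e, norm_smul, hy, Real.norm_of_nonneg ht.le] at hx
      exact ht1 (mul_right_cancel₀ hR.ne' (hx.trans (one_mul R).symm))
    have hdvd : ((Nat.lcm 2 p : ℕ) : ℤ) ∣ i - j ↔ (Even i ↔ Even j) ∧ (p : ℤ) ∣ i - j := by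
      rw [← Int.even_sub, even_iff_two_dvd, ← Int.natAbs_dvd_natAbs, Int.natAbs_natCast,
        Nat.lcm_dvd_iff, ← Int.natAbs_dvd_natAbs (a := 2), ← Int.natAbs_dvd_natAbs (a := (p : ℤ))]
      rfl
    rw [hdvd, ← h.apply_eq_iff]
    unfold Skeletal.alt
    split_ifs with hi hj hj
    · simp only [hi, hj, true_and]
    · simp only [hi, hj, hne _ _ (hw i) (hw j), iff_false, not_true, false_and]
    · simp only [hi, hj, (hne _ _ (hw j) (hw i)).symm, iff_true, false_and]
    · simp only [hi, hj, (smul_right_injective E3 ht.ne').eq_iff, true_and]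

/-! ### The crossing of a polyhedron with a homothetic copy -/

/-- The permutation of space interchanging the spheres of radii `R` and `t * R` about the origin. -/
noncomputable def sphereSwap {R t : ℝ} (hR : 0 < R) (ht : 0 < t) (ht1 : t ≠ 1) :
    Equiv.Perm E3 :=
  have hne : t * R ≠ R := fun e => ht1 (mul_right_cancel₀ hR.ne' (e.trans (one_mul R).symm))
  Function.Involutive.toPerm
    (fun x => if ‖x‖ = R then t • x else if ‖x‖ = t * R then t⁻¹ • x else x) <| by
    intro x
    by_cases h1 : ‖x‖ = R
    · simp [h1, norm_smul, abs_of_pos ht, hne, ht.ne', smul_smul]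
    · by_cases h2 : ‖x‖ = t * R
      · simp [h2, hne, norm_smul, abs_of_pos ht, ht.ne', smul_smul]
      · simp [h1, h2]

namespace Skeletal

variable {P Q : Skeletal} {w a : ℤ → E3} {R t : ℝ}

theorem mem_cross_faces {F : Set (Sym2 E3)} :
    F ∈ (Q.cross t).faces ↔ ∃ w, Q.Tracks w ∧ F = traceEdges (alt w t) := by
  constructor
  · rintro ⟨p, hp, v, hv, hF, rfl⟩
    refine ⟨fun j => v (j : ZMod p), ⟨⟨p, isTracing_intCast hp hv⟩, ?_⟩, rfl⟩
    rwa [← polygon_eq_traceEdges]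
  · rintro ⟨w, ⟨⟨p, hp⟩, hF⟩, rfl⟩
    obtain ⟨v, hv, rfl⟩ := hp.exists_zmod
    exact ⟨p, hp.three_le, v, hv, by rwa [polygon_eq_traceEdges], rfl⟩

theorem mk_smul_mem_cross_edges {x y : E3} (hxy : s(x, y) ∈ Q.edges) :
    s(x, t • y) ∈ (Q.cross t).edges :=
  ⟨x, y, hxy, rfl⟩

theorem mk_smul_mem_cross_edges' {x y : E3} (hxy : s(x, y) ∈ Q.edges) :
    s(t • x, y) ∈ (Q.cross t).edges :=
  ⟨y, x, by rwa [Sym2.eq_swap], Sym2.eq_swap⟩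

theorem traceEdges_alt_subset (hQ : Q.IsPolyhedron) (hw : Q.Tracks w) :
    traceEdges (alt w t) ⊆ (Q.cross t).edges := by
  rintro _ ⟨i, rfl⟩
  change s(alt w t i, alt w t (i + 1)) ∈ _
  by_cases hi : Even i
  · rw [alt_even hi, alt_odd (by simpa only [Int.even_add_one, not_not] using hi)]
    exact mk_smul_mem_cross_edges (hQ.mk_mem_edges hw i)
  · rw [alt_odd hi, alt_even (by simpa only [Int.even_add_one] using hi)]
    exact mk_smul_mem_cross_edges' (hQ.mk_mem_edges hw i)

theorem cross_stable (L : E3 ≃ₗᵢ[ℝ] E3) (hL : Q.map L = Q) : (Q.cross t).Stable L := by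
  have hm := mem_of_map_eq hL
  refine ⟨?_, ?_, ?_⟩
  · rintro v (hv | ⟨y, hy, rfl⟩)
    · exact .inl (hm.1 v hv)
    · exact .inr ⟨_, hm.1 y hy, map_smul L t y⟩
  · rintro _ ⟨x, y, hxy, rfl⟩
    rw [Sym2.map_mk, map_smul]
    exact mk_smul_mem_cross_edges (hm.2.1 _ hxy)
  · intro F hF
    obtain ⟨w, hw, rfl⟩ := mem_cross_faces.1 hF
    rw [image_traceEdges, mem_cross_faces]
    refine ⟨_, hw.of_map_eq L.injective hL, ?_⟩
    simp only [map_alt L fun _ => rfl]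

theorem cross_map_eq (L : E3 ≃ₗᵢ[ℝ] E3) (hL : Q.map L = Q) : (Q.cross t).map L = Q.cross t :=
  map_eq_of_stable (f := L.toEquiv) (cross_stable L hL)
    (cross_stable L.symm (map_symm_eq (f := L.toEquiv) hL))

namespace CentredRegular

variable (h : Q.CentredRegular w R) (ht : 0 < t) (ht1 : t ≠ 1)
include h ht ht1

theorem ne_smul {x y : E3} (hx : x ∈ Q.verts) (hy : y ∈ Q.verts) : x ≠ t • y := by
  intro e
  have hnorm := h.norm_eq x hx
  rw [e, norm_smul, h.norm_eq y hy, Real.norm_of_nonneg ht.le] at hnorm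
  exact ht1 (mul_right_cancel₀ h.pos.ne' (hnorm.trans (one_mul R).symm))

theorem tracks_alt (ha : Q.Tracks a) : (Q.cross t).Tracks (alt a t) := by
  obtain ⟨p, hp⟩ := ha.1
  exact ⟨⟨_, hp.alt (fun i => h.norm_eq _ (h.poly.apply_mem_verts ha i)) h.pos ht ht1⟩,
    mem_cross_faces.2 ⟨a, ha, rfl⟩⟩

theorem even_of_alt_mem (ha : Q.Tracks a) {k : ℤ} (hk : alt a t k ∈ Q.verts) : Even k := by
  by_contra hodd
  rw [alt_odd hodd] at hk
  exact h.ne_smul ht ht1 hk (h.poly.apply_mem_verts ha k) rfl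

theorem exists_eq_alt {u : ℤ → E3} (hu : (Q.cross t).Tracks u) (hu0 : u 0 ∈ Q.verts) :
    ∃ a, Q.Tracks a ∧ u = alt a t := by
  obtain ⟨a, ha, hua⟩ := mem_cross_faces.1 hu.2
  obtain ⟨k, rfl | rfl⟩ := (h.tracks_alt ht ht1 ha).eq_shift_or_reflect hu hua.symm
  · have hk := h.even_of_alt_mem ht ht1 ha (by simpa using hu0)
    exact ⟨_, ha.shift k, funext fun j => alt_shift hk j⟩
  · have hk := h.even_of_alt_mem ht ht1 ha (by simpa using hu0)
    exact ⟨_, ha.reflect k, funext fun j => alt_reflect hk j⟩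

theorem exists_of_mem_cross_edges {x y : E3} (he : s(x, y) ∈ (Q.cross t).edges)
    (hx : x ∈ Q.verts) : ∃ z, s(x, z) ∈ Q.edges ∧ y = t • z := by
  obtain ⟨x', y', hxy, he⟩ := he
  rcases Sym2.eq_iff.1 he with ⟨rfl, rfl⟩ | ⟨rfl, rfl⟩
  · exact ⟨y', hxy, rfl⟩
  · exact (h.ne_smul ht ht1 hx (h.poly.right_mem_verts hxy) rfl).elim

theorem mk_mem_of_smul_mem_cross_edges {x y : E3} (he : s(t • x, y) ∈ (Q.cross t).edges)
    (hx : x ∈ Q.verts) : s(x, y) ∈ Q.edges := by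
  obtain ⟨x', y', hxy, he⟩ := he
  rcases Sym2.eq_iff.1 he with ⟨rfl, rfl⟩ | ⟨h1, rfl⟩
  · exact (h.ne_smul ht ht1 (h.poly.left_mem_verts hxy) hx rfl).elim
  · rwa [smul_right_injective E3 ht.ne' h1, Sym2.eq_swap]

theorem sphereSwap_apply {x : E3} (hx : x ∈ Q.verts) : sphereSwap h.pos ht ht1 x = t • x :=
  if_pos (h.norm_eq x hx)

theorem sphereSwap_apply_smul {x : E3} (hx : x ∈ Q.verts) :
    sphereSwap h.pos ht ht1 (t • x) = x := by
  rw [← h.sphereSwap_apply ht ht1 hx]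
  exact (sphereSwap h.pos ht ht1).symm_apply_apply x

theorem sphereSwap_alt (ha : Q.Tracks a) (j : ℤ) :
    sphereSwap h.pos ht ht1 (alt a t j) = alt (fun i => a (1 + i)) t (-1 + j) := by
  have hj' : Even (-1 + j) ↔ ¬ Even j := by rw [neg_add_eq_sub, Int.even_sub_one]
  have hj := h.poly.apply_mem_verts ha j
  by_cases hev : Even j
  · rw [alt_even hev, alt_odd (by rwa [hj', not_not]), h.sphereSwap_apply ht ht1 hj,
      add_neg_cancel_left]
  · rw [alt_odd hev, alt_even (hj'.2 hev), h.sphereSwap_apply_smul ht ht1 hj, add_neg_cancel_left]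

theorem cross_map_sphereSwap : (Q.cross t).map (sphereSwap h.pos ht ht1) = Q.cross t := by
  have hst : (Q.cross t).Stable (sphereSwap h.pos ht ht1) := by
    refine ⟨?_, ?_, ?_⟩
    · rintro v (hv | ⟨y, hy, rfl⟩)
      · exact h.sphereSwap_apply ht ht1 hv ▸ .inr ⟨v, hv, rfl⟩
      · exact (h.sphereSwap_apply_smul ht ht1 hy).symm ▸ .inl hy
    · rintro _ ⟨x, y, hxy, rfl⟩
      rw [Sym2.map_mk, h.sphereSwap_apply ht ht1 (h.poly.left_mem_verts hxy),
        h.sphereSwap_apply_smul ht ht1 (h.poly.right_mem_verts hxy)]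
      exact mk_smul_mem_cross_edges' hxy
    · intro F hF
      obtain ⟨a, ha, rfl⟩ := mem_cross_faces.1 hF
      rw [image_traceEdges]
      simp only [h.sphereSwap_alt ht ht1 ha]
      rw [traceEdges_shift]
      exact mem_cross_faces.2 ⟨_, ha.shift 1, rfl⟩
  exact map_eq_of_stable hst hst

theorem cross_isPrepolyhedron : (Q.cross t).IsPrepolyhedron where
  finite_verts := by
    refine h.poly.finite_verts.union ((h.poly.finite_verts.image (t • ·)).subset ?_)
    rintro _ ⟨y, hy, rfl⟩
    exact ⟨y, hy, rfl⟩
  edge_spec := by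
    rintro _ ⟨x, y, hxy, rfl⟩
    have hx := h.poly.left_mem_verts hxy
    have hy := h.poly.right_mem_verts hxy
    refine ⟨h.ne_smul ht ht1 hx hy, fun z hz => ?_⟩
    rcases Sym2.mem_iff.1 hz with rfl | rfl
    · exact .inl hx
    · exact .inr ⟨y, hy, rfl⟩
  face_spec := by
    intro F hF
    obtain ⟨a, ha, rfl⟩ := mem_cross_faces.1 hF
    obtain ⟨p, hp⟩ := (h.tracks_alt ht ht1 ha).1
    exact ⟨⟨p, isPolygon_iff_exists_isTracing.2 ⟨_, hp, rfl⟩⟩, traceEdges_alt_subset h.poly ha⟩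

theorem tracksFrom_cross {x : E3} (hx : x ∈ Q.verts) (y : E3) :
    (Q.cross t).tracksFrom x (t • y) = (fun a => alt a t) '' Q.tracksFrom x y := by
  ext u
  constructor
  · rintro ⟨hu, hu0, hu1⟩
    obtain ⟨a, ha, rfl⟩ := h.exists_eq_alt ht ht1 hu (hu0 ▸ hx)
    exact ⟨a, ⟨ha, hu0, smul_right_injective E3 ht.ne' hu1⟩, rfl⟩
  · rintro ⟨a, ⟨ha, rfl, rfl⟩, rfl⟩
    exact ⟨h.tracks_alt ht ht1 ha, rfl, rfl⟩

omit ht ht1 in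
theorem subset_of_cross_edges (hbip : ¬ Q.edgeGraph.IsBipartite) {S : Set E3} (h0 : w 0 ∈ S)
    (hS : ∀ x y, s(x, y) ∈ (Q.cross t).edges → x ∈ S → y ∈ S) : (Q.cross t).verts ⊆ S := by
  have hmem : ∀ x y, s(x, y) ∈ Q.edges → (x ∈ S ↔ t • y ∈ S) := fun x y hxy =>
    have hyx : s(t • y, x) ∈ (Q.cross t).edges :=
      mk_smul_mem_cross_edges' (by rwa [Sym2.eq_swap])
    ⟨hS _ _ (mk_smul_mem_cross_edges hxy), hS _ _ hyx⟩
  have hmem' : ∀ x y, s(x, y) ∈ Q.edges → (t • x ∈ S ↔ y ∈ S) := fun x y hxy =>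
    (hmem y x (by rwa [Sym2.eq_swap])).symm
  have hw0 := h.poly.apply_mem_verts h.tracks 0
  by_cases h1 : t • w 0 ∈ S
  · have hall := h.poly.edge_induction (p := fun x => x ∈ S ∧ t • x ∈ S) hw0 ⟨h0, h1⟩
      fun x y hxy hx => ⟨(hmem' x y hxy).1 hx.2, (hmem x y hxy).1 hx.1⟩
    rintro v (hv | ⟨y, hy, rfl⟩)
    exacts [(hall v hv).1, (hall y hy).2]
  · -- otherwise membership in `S` is a proper colouring
    classical
    have hone := h.poly.edge_induction (p := fun x => x ∈ S ↔ ¬ t • x ∈ S) hw0 (by simp [h0, h1])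
      fun x y hxy hx => by rw [← hmem' x y hxy, ← hmem x y hxy, hx, not_not]
    refine (hbip ⟨⟨fun x => if (x : E3) ∈ S then 0 else 1, fun {x y} hxy => ?_⟩⟩).elim
    have hx : (x : E3) ∈ S ↔ ¬ (y : E3) ∈ S := by rw [hone x x.2, hmem' x y hxy.2]
    by_cases hy : (y : E3) ∈ S <;> simp [hx, hy]

theorem mem_of_vertexFigure_cross {v : E3} (hv : v ∈ (Q.cross t).verts) :
    ∃ y₀, s(v, y₀) ∈ (Q.cross t).edges ∧ ∀ S : Set E3, y₀ ∈ S →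
      (∀ a, (Q.cross t).Tracks a → a 0 = v → a (-1) ∈ S → a 1 ∈ S) →
      ∀ y, s(v, y) ∈ (Q.cross t).edges → y ∈ S := by
  rcases hv with hv | ⟨x, hx, rfl⟩
  · obtain ⟨y₀, hy₀⟩ := h.poly.exists_edge hv
    refine ⟨t • y₀, mk_smul_mem_cross_edges hy₀, fun S h0 hS y hy => ?_⟩
    obtain ⟨z, hz, rfl⟩ := h.exists_of_mem_cross_edges ht ht1 hy hv
    exact h.poly.vertexFigure_induction (p := fun y => t • y ∈ S) hy₀ h0
      (fun a ha ha0 => hS _ (h.tracks_alt ht ht1 ha) ha0) z hz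
  · obtain ⟨y₀, hy₀⟩ := h.poly.exists_edge hx
    refine ⟨y₀, mk_smul_mem_cross_edges' hy₀, fun S h0 hS y hy => ?_⟩
    refine h.poly.vertexFigure_induction (p := fun y => y ∈ S) hy₀ h0 (fun a ha ha0 hp => ?_) y
      (h.mk_mem_of_smul_mem_cross_edges ht ht1 hy hx)
    have := hS _ ((h.tracks_alt ht ht1 (ha.shift 1)).shift (-1)) (by simp [alt, ha0])
    simp only [alt] at this
    exact this hp

theorem cross_isPolyhedron (hbip : ¬ Q.edgeGraph.IsBipartite) : (Q.cross t).IsPolyhedron := by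
  refine (h.cross_isPrepolyhedron ht ht1).isPolyhedron
    (.inl (h.poly.apply_mem_verts h.tracks 0)) (fun S => h.subset_of_cross_edges hbip)
    (fun x => h.mem_of_vertexFigure_cross ht ht1) fun x y hxy => ?_
  obtain ⟨x', y', hxy', he⟩ := hxy
  have htwo : ((Q.cross t).tracksFrom x' (t • y')).ncard = 2 := by
    rw [h.tracksFrom_cross ht ht1 (h.poly.left_mem_verts hxy'),
      Set.ncard_image_of_injective _ (alt_injective ht.ne'), h.poly.ncard_tracksFrom hxy']
  rw [← (h.cross_isPrepolyhedron ht ht1).ncard_faces_eq_ncard_tracksFrom] at htwo ⊢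
  rwa [he]

theorem cross_twoLayered (hbip : ¬ Q.edgeGraph.IsBipartite) :
    (Q.cross t).TwoLayered Q.verts {x | ∃ y ∈ Q.verts, x = t • y} R (t * R) where
  poly := h.cross_isPolyhedron ht ht1 hbip
  verts_eq := rfl
  norm_left := h.norm_eq
  norm_right := by
    rintro _ ⟨y, hy, rfl⟩
    rw [norm_smul, h.norm_eq y hy, Real.norm_of_nonneg ht.le]
  radii_ne := fun e => ht1 (mul_right_cancel₀ h.pos.ne' (e.symm.trans (one_mul R).symm))
  sum_eq := by
    have himg : (Q.cross t).verts = Q.verts ∪ (t • ·) '' Q.verts :=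
      congrArg (Q.verts ∪ ·) (Set.ext fun x => by simp [eq_comm])
    have hdisj : Disjoint Q.verts ((t • ·) '' Q.verts) := by
      rw [Set.disjoint_left]
      rintro _ hx ⟨y, hy, rfl⟩
      exact h.ne_smul ht ht1 hx hy rfl
    have hfin := h.poly.finite_verts
    rw [himg, finsum_mem_union hdisj hfin (hfin.image _), h.sum_eq, zero_add,
      finsum_mem_image (smul_right_injective E3 ht.ne').injOn, ← smul_finsum_mem hfin, h.sum_eq,
      smul_zero]
  edge_left := fun x y hxy hx => by
    obtain ⟨z, hz, rfl⟩ := h.exists_of_mem_cross_edges ht ht1 hxy hx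
    exact ⟨z, h.poly.right_mem_verts hz, rfl⟩
  edge_right := by
    rintro _ y hxy ⟨x, hx, rfl⟩
    exact h.poly.right_mem_verts (h.mk_mem_of_smul_mem_cross_edges ht ht1 hxy hx)

theorem exists_isometry_cross (ha : (Q.cross t).Tracks a) (ha0 : a 0 ∈ Q.verts) :
    ∃ L : E3 ≃ₗᵢ[ℝ] E3, (Q.cross t).map L = Q.cross t ∧ ∀ i, L (alt w t i) = a i := by
  obtain ⟨b, hb, rfl⟩ := h.exists_eq_alt ht ht1 ha ha0
  obtain ⟨L, hL, hLb⟩ := h.trans b hb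
  exact ⟨L, cross_map_eq L hL, map_alt L hLb⟩

theorem exists_perm_cross (ha : (Q.cross t).Tracks a) (ha0 : ∃ y ∈ Q.verts, a 0 = t • y) :
    ∃ f : Equiv.Perm E3, (Q.cross t).map f = Q.cross t ∧ ∀ i, f (alt w t i) = a i := by
  obtain ⟨x, hx, hax⟩ := ha0
  let σ := sphereSwap h.pos ht ht1
  have hσ : (Q.cross t).map σ = Q.cross t := h.cross_map_sphereSwap ht ht1
  obtain ⟨L, hL, hLa⟩ := h.exists_isometry_cross ht ht1 (ha.of_map_eq σ.injective hσ)
    (by rwa [hax, h.sphereSwap_apply_smul ht ht1 hx])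
  refine ⟨L.toEquiv.trans σ.symm, ?_, fun i => ?_⟩
  · have hcomp : ⇑(L.toEquiv.trans σ.symm) = σ.symm ∘ L := rfl
    rw [hcomp, ← map_map, hL, map_symm_eq hσ]
  · exact (congrArg σ.symm (hLa i)).trans (σ.symm_apply_apply _)

theorem cross_spec (hbip : ¬ Q.edgeGraph.IsBipartite) :
    (Q.cross t).IsRegularOfIndexTwo ∧ (Q.cross t).vertexOrbits.ncard = 2 ∧
      ∀ F ∈ (Q.cross t).faces, ¬ Coplanar ℝ (polygonVertices F) := by
  have h2 := h.cross_twoLayered ht ht1 hbip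
  have hw := h.tracks_alt ht ht1 h.tracks
  have hw0 : alt w t 0 ∈ Q.verts := h.poly.apply_mem_verts h.tracks 0
  have hA := fun a => h.exists_isometry_cross (a := a) ht ht1
  have hB := fun a => h.exists_perm_cross (a := a) ht ht1
  refine ⟨h2.isRegularOfIndexTwo hw hw0 hA hB, h2.vertexOrbits_ncard hw hw0 hA, fun F hF => ?_⟩
  obtain ⟨a, ha, rfl⟩ := mem_cross_faces.1 hF
  rw [polygonVertices_traceEdges]
  exact h.not_coplanar_alt ht ht1 ha

omit ht ht1 in
theorem eq_or_eq_inv_of_cross_similar {u : ℝ} (hbip : ¬ Q.edgeGraph.IsBipartite) (ht : 0 < t)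
    (ht1 : t ≠ 1) (hu : 0 < u) (hu1 : u ≠ 1) (hsim : (Q.cross t).Similar (Q.cross u)) :
    u = t ∨ u = t⁻¹ :=
  have hw0 := h.poly.apply_mem_verts h.tracks 0
  TwoLayered.eq_or_eq_inv_of_similar h.pos (h.cross_twoLayered ht ht1 hbip)
    (h.cross_twoLayered hu hu1 hbip) ⟨_, hw0⟩ ⟨_, _, hw0, rfl⟩ hsim

end CentredRegular

end Skeletal

/-! ### Images of polyhedra under permutations of space -/

namespace Skeletal

variable {P Q : Skeletal} {w a : ℤ → E3} {R t : ℝ}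

theorem IsPolyhedron.map_congr (hQ : Q.IsPolyhedron) {f g : E3 → E3}
    (h : ∀ x ∈ Q.verts, f x = g x) : Q.map f = Q.map g := by
  have hE : ∀ e ∈ Q.edges, Sym2.map f e = Sym2.map g e := fun e he =>
    Sym2.map_congr fun x hx => h x ((hQ.edge_spec e he).2 x hx)
  refine Skeletal.ext (Set.image_congr h) (Set.image_congr hE) (Set.image_congr fun F hF => ?_)
  exact Set.image_congr fun e he => hE e ((hQ.face_spec F hF).2 he)

theorem Tracks.symm_comp {f : Equiv.Perm E3} (h : (Q.map f).Tracks w) :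
    Q.Tracks fun i => f.symm (w i) := by
  have hQ := h.map f.symm.injective
  rwa [map_map, show f.symm ∘ f = id from funext f.symm_apply_apply, map_id] at hQ

theorem mk_mem_map_edges {f : Equiv.Perm E3} {x y : E3} :
    s(f x, f y) ∈ (Q.map f).edges ↔ s(x, y) ∈ Q.edges :=
  (Sym2.map.injective f.injective).mem_set_image (s := Q.edges) (a := s(x, y))

theorem tracksFrom_map (f : Equiv.Perm E3) (x y : E3) :
    (Q.map f).tracksFrom (f x) (f y) = (fun a i => f (a i)) '' Q.tracksFrom x y := by
  ext u
  constructor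
  · rintro ⟨hu, hu0, hu1⟩
    exact ⟨_, ⟨hu.symm_comp, f.symm_apply_eq.2 hu0, f.symm_apply_eq.2 hu1⟩,
      funext fun i => f.apply_symm_apply (u i)⟩
  · rintro ⟨a, ⟨ha, rfl, rfl⟩, rfl⟩
    exact ⟨ha.map f.injective, rfl, rfl⟩

theorem IsPrepolyhedron.map (hQ : Q.IsPrepolyhedron) (f : Equiv.Perm E3) :
    (Q.map f).IsPrepolyhedron where
  finite_verts := hQ.finite_verts.image f
  edge_spec := by
    rintro _ ⟨⟨x, y⟩, he, rfl⟩
    obtain ⟨hne, hmem⟩ := hQ.edge_spec _ he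
    refine ⟨fun e => hne (f.injective e), fun z hz => ?_⟩
    obtain ⟨z', hz', rfl⟩ := Sym2.mem_map.1 hz
    exact ⟨z', hmem z' hz', rfl⟩
  face_spec := by
    rintro _ ⟨F, hF, rfl⟩
    obtain ⟨⟨p, hp⟩, hFE⟩ := hQ.face_spec F hF
    obtain ⟨a, ha, rfl⟩ := isPolygon_iff_exists_isTracing.1 hp
    exact ⟨⟨p, isPolygon_iff_exists_isTracing.2
      ⟨_, ha.comp f.injective.injOn, image_traceEdges f a⟩⟩, Set.image_mono hFE⟩

theorem IsPolyhedron.map (hQ : Q.IsPolyhedron) (f : Equiv.Perm E3) : (Q.map f).IsPolyhedron := by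
  obtain ⟨⟨x₀, hx₀⟩⟩ := hQ.connected.nonempty
  refine (hQ.isPrepolyhedron.map f).isPolyhedron (x₀ := f x₀) ⟨x₀, hx₀, rfl⟩ ?_ ?_ ?_
  · rintro S h0 hS _ ⟨x, hx, rfl⟩
    exact hQ.edge_induction (p := fun x => f x ∈ S) hx₀ h0
      (fun x y hxy => hS _ _ (mk_mem_map_edges.2 hxy)) x hx
  · rintro _ ⟨x, hx, rfl⟩
    obtain ⟨y₀, hy₀⟩ := hQ.exists_edge hx
    refine ⟨f y₀, mk_mem_map_edges.2 hy₀, fun S h0 hS y hy => ?_⟩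
    obtain ⟨y, rfl⟩ := f.surjective y
    exact hQ.vertexFigure_induction (p := fun y => f y ∈ S) hy₀ h0
      (fun a ha ha0 => hS _ (ha.map f.injective) (congrArg f ha0)) y (mk_mem_map_edges.1 hy)
  · intro x y hxy
    obtain ⟨x, rfl⟩ := f.surjective x
    obtain ⟨y, rfl⟩ := f.surjective y
    rw [tracksFrom_map]
    exact (Set.ncard_image_of_injective _ f.injective.comp_left).trans
      (hQ.ncard_tracksFrom (mk_mem_map_edges.1 hxy))

theorem CentredRegular.exists_perm_map (h : Q.CentredRegular w R) (f : Equiv.Perm E3)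
    (ha : (Q.map f).Tracks a) :
    ∃ g : Equiv.Perm E3, (Q.map f).map g = Q.map f ∧ ∀ i, g (f (w i)) = a i := by
  obtain ⟨L, hL, hLa⟩ := h.trans _ ha.symm_comp
  refine ⟨(f.symm.trans L.toEquiv).trans f, ?_, fun i => ?_⟩
  · have hcomp : (f.symm.trans L.toEquiv).trans f ∘ f = f ∘ L := by
      funext x
      exact congrArg (f ∘ L) (f.symm_apply_apply x)
    rw [map_map, hcomp, ← map_map, hL]
  · change f (L (f.symm (f (w i)))) = a i
    rw [f.symm_apply_apply, hLa, f.apply_symm_apply]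

/-! ### Rescaling every other vertex of the cube -/

/-- The product of the coordinates, which tells apart the two tetrahedra inscribed in the cube. -/
def coordProd (x : E3) : ℝ := x 0 * x 1 * x 2

theorem coordProd_smul (r : ℝ) (x : E3) : coordProd (r • x) = r ^ 3 * coordProd x := by
  simp only [coordProd, PiLp.smul_apply, smul_eq_mul]
  ring

theorem coordProd_eq_of_mem_cubeVerts {x : E3} (hx : x ∈ cubeVerts) :
    coordProd x = 1 ∨ coordProd x = -1 := by
  unfold coordProd
  rcases hx 0 with h0 | h0 <;> rcases hx 1 with h1 | h1 <;> rcases hx 2 with h2 | h2 <;>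
    norm_num [h0, h1, h2]

/-- The vertices of the cube outside `tetrahedronVerts`. -/
def oddCubeVerts : Set E3 :=
  {x | x ∈ cubeVerts ∧ coordProd x = -1}

theorem cubeVerts_eq_union : cubeVerts = tetrahedronVerts ∪ oddCubeVerts := by
  ext x
  constructor
  · exact fun hx => (coordProd_eq_of_mem_cubeVerts hx).imp (⟨hx, ·⟩) (⟨hx, ·⟩)
  · rintro (hx | hx)
    exacts [hx.1, hx.1]

theorem disjoint_tetrahedronVerts_oddCubeVerts : Disjoint tetrahedronVerts oddCubeVerts := by
  rw [Set.disjoint_left]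
  rintro x ⟨-, h⟩ ⟨-, h'⟩
  exact absurd (h.symm.trans h') (by norm_num)

open Classical in
/-- Scaling the points with non-positive product of coordinates by `t`; unlike the map in
`rescaleHalf`, with which it agrees on the vertices of the cube, it is a permutation of space. -/
noncomputable def signScale (ht : 0 < t) : Equiv.Perm E3 :=
  have hpos : ∀ {r : ℝ}, 0 < r → ∀ x, 0 < coordProd (r • x) ↔ 0 < coordProd x := fun hr x => by
    rw [coordProd_smul, mul_pos_iff_of_pos_left (pow_pos hr 3)]
  { toFun := fun x => if 0 < coordProd x then x else t • x
    invFun := fun x => if 0 < coordProd x then x else t⁻¹ • x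
    left_inv := fun x => by
      by_cases h : 0 < coordProd x <;> simp [h, hpos ht, smul_smul, ht.ne']
    right_inv := fun x => by
      by_cases h : 0 < coordProd x <;> simp [h, hpos (inv_pos.2 ht), smul_smul, ht.ne'] }

theorem signScale_of_eq_one (ht : 0 < t) {x : E3} (h : coordProd x = 1) :
    signScale ht x = x :=
  if_pos (by rw [h]; norm_num)

theorem signScale_of_eq_neg_one (ht : 0 < t) {x : E3} (h : coordProd x = -1) :
    signScale ht x = t • x :=
  if_neg (by rw [h]; norm_num)

theorem signScale_map (ht : 0 < t) (L : E3 ≃ₗᵢ[ℝ] E3) {x : E3} (hx : x ∈ cubeVerts)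
    (hL : coordProd (L x) = coordProd x) : signScale ht (L x) = L (signScale ht x) := by
  rcases coordProd_eq_of_mem_cubeVerts hx with h | h
  · rw [signScale_of_eq_one ht h, signScale_of_eq_one ht (hL.trans h)]
  · rw [signScale_of_eq_neg_one ht h, signScale_of_eq_neg_one ht (hL.trans h), map_smul]

theorem signScale_image_cubeVerts (ht : 0 < t) :
    signScale ht '' cubeVerts = tetrahedronVerts ∪ (t • ·) '' oddCubeVerts := by
  rw [cubeVerts_eq_union, Set.image_union,
    Set.image_congr fun x (hx : x ∈ tetrahedronVerts) => signScale_of_eq_one ht hx.2,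
    Set.image_congr fun x (hx : x ∈ oddCubeVerts) => signScale_of_eq_neg_one ht hx.2,
    Set.image_id']

namespace CentredRegular

variable (h : Q.CentredRegular w R) (hV : Q.verts = cubeVerts)
  (hE : ∀ x y, s(x, y) ∈ Q.edges → coordProd x = -coordProd y)
  (hw : coordProd (w 0) = 1) (hS : ∑ᶠ x ∈ tetrahedronVerts, x = 0)
  (ht : 0 < t) (ht1 : t ≠ 1)

include h

include hE in
theorem coordProd_apply (ha : Q.Tracks a) (ha0 : coordProd (a 0) = 1) (j : ℤ) :
    coordProd (a j) = (-1) ^ j := by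
  have hstep : ∀ i : ℤ, coordProd (a i) = -coordProd (a (i + 1)) := fun i =>
    hE _ _ (h.poly.mk_mem_edges ha i)
  induction j using Int.induction_on with
  | zero => simpa using ha0
  | succ i ih =>
    rw [zpow_add_one₀ (by norm_num)]
    linarith [hstep i]
  | pred i ih =>
    rw [zpow_sub_one₀ (by norm_num), hstep, sub_add_cancel, ih]
    norm_num

include hE in
theorem signScale_apply (ha : Q.Tracks a) (ha0 : coordProd (a 0) = 1) (j : ℤ) :
    signScale ht (a j) = alt a t j := by
  have hj := h.coordProd_apply hE ha ha0 j
  by_cases hev : Even j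
  · rw [alt_even hev, signScale_of_eq_one ht (by rw [hj, hev.neg_one_zpow])]
  · rw [alt_odd hev, signScale_of_eq_neg_one ht (by
      rw [hj, (Int.not_even_iff_odd.1 hev).neg_one_zpow])]

include hV

theorem rescaleHalf_eq_map : Q.rescaleHalf t = Q.map (signScale ht) := by
  refine h.poly.map_congr fun x hx => ?_
  rcases coordProd_eq_of_mem_cubeVerts (hV ▸ hx) with h1 | h1
  · rw [signScale_of_eq_one ht h1, if_pos ⟨hV ▸ hx, h1⟩]
  · rw [signScale_of_eq_neg_one ht h1, if_neg fun hx' => ?_]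
    exact disjoint_tetrahedronVerts_oddCubeVerts.notMem_of_mem_left hx' ⟨hx'.1, h1⟩

include hS in
theorem finsum_oddCubeVerts : ∑ᶠ x ∈ oddCubeVerts, x = 0 := by
  have hfin := h.poly.finite_verts
  have hsum := h.sum_eq
  rw [hV, cubeVerts_eq_union] at hfin hsum
  rwa [finsum_mem_union disjoint_tetrahedronVerts_oddCubeVerts (hfin.subset Set.subset_union_left)
    (hfin.subset Set.subset_union_right), hS, zero_add] at hsum

include hE in
theorem mem_of_map_signScale_edges {x y : E3} (hxy : s(x, y) ∈ (Q.map (signScale ht)).edges) :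
    (x ∈ tetrahedronVerts ∧ y ∈ (t • ·) '' oddCubeVerts) ∨
      (x ∈ (t • ·) '' oddCubeVerts ∧ y ∈ tetrahedronVerts) := by
  obtain ⟨x, rfl⟩ := (signScale ht).surjective x
  obtain ⟨y, rfl⟩ := (signScale ht).surjective y
  rw [mk_mem_map_edges] at hxy
  have hx := hV ▸ h.poly.left_mem_verts hxy
  have hy := hV ▸ h.poly.right_mem_verts hxy
  have hprod := hE x y hxy
  rcases coordProd_eq_of_mem_cubeVerts hy with h1 | h1 <;> rw [h1] at hprod
  · rw [signScale_of_eq_one ht h1, signScale_of_eq_neg_one ht hprod]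
    exact .inr ⟨⟨x, ⟨hx, hprod⟩, rfl⟩, hy, h1⟩
  · rw [neg_neg] at hprod
    rw [signScale_of_eq_one ht hprod, signScale_of_eq_neg_one ht h1]
    exact .inl ⟨⟨hx, hprod⟩, y, ⟨hy, h1⟩, rfl⟩

include ht ht1 hS hE in
theorem rescaleHalf_twoLayered :
    (Q.rescaleHalf t).TwoLayered tetrahedronVerts ((t • ·) '' oddCubeVerts) R (t * R) := by
  have hnorm : ∀ x ∈ tetrahedronVerts, ‖x‖ = R := fun x hx => h.norm_eq x (hV ▸ hx.1)
  have hnorm' : ∀ x ∈ (t • ·) '' oddCubeVerts, ‖x‖ = t * R := by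
    rintro _ ⟨x, hx, rfl⟩
    rw [norm_smul, h.norm_eq x (hV ▸ hx.1), Real.norm_of_nonneg ht.le]
  have hRt : R ≠ t * R := fun e => ht1 (mul_right_cancel₀ h.pos.ne' (e.symm.trans (one_mul R).symm))
  have hdisj : Disjoint tetrahedronVerts ((t • ·) '' oddCubeVerts) :=
    Set.disjoint_left.2 fun x hx hx' => hRt ((hnorm x hx).symm.trans (hnorm' x hx'))
  have hverts : (Q.map (signScale ht)).verts = tetrahedronVerts ∪ (t • ·) '' oddCubeVerts :=
    (congrArg (signScale ht '' ·) hV).trans (signScale_image_cubeVerts ht)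
  have hfin : (tetrahedronVerts ∪ oddCubeVerts).Finite :=
    cubeVerts_eq_union ▸ hV ▸ h.poly.finite_verts
  rw [h.rescaleHalf_eq_map hV ht]
  refine ⟨h.poly.map _, hverts, hnorm, hnorm', hRt, ?_, fun x y hxy hx => ?_, fun x y hxy hx => ?_⟩
  · have hfin' := hfin.subset Set.subset_union_right
    rw [hverts, finsum_mem_union hdisj (hfin.subset Set.subset_union_left) (hfin'.image _), hS,
      zero_add, finsum_mem_image (smul_right_injective E3 ht.ne').injOn, ← smul_finsum_mem hfin',
      h.finsum_oddCubeVerts hV hS, smul_zero]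
  · exact ((h.mem_of_map_signScale_edges hV hE ht hxy).resolve_right fun h' =>
      hdisj.notMem_of_mem_left hx h'.1).2
  · exact ((h.mem_of_map_signScale_edges hV hE ht hxy).resolve_left fun h' =>
      hdisj.notMem_of_mem_left h'.1 hx).2

include hw hE

theorem exists_isometry_rescaleHalf (ha : (Q.rescaleHalf t).Tracks a)
    (ha0 : a 0 ∈ tetrahedronVerts) :
    ∃ L : E3 ≃ₗᵢ[ℝ] E3, (Q.rescaleHalf t).map L = Q.rescaleHalf t ∧
      ∀ i, L (signScale ht (w i)) = a i := by
  rw [h.rescaleHalf_eq_map hV ht] at ha ⊢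
  obtain ⟨L, hL, hLa⟩ := h.trans _ ha.symm_comp
  have hw0 := h.poly.apply_mem_verts h.tracks 0
  have hLw : L (w 0) = a 0 :=
    (hLa 0).trans ((Equiv.symm_apply_eq _).2 (signScale_of_eq_one ht ha0.2).symm)
  have hpres : ∀ x ∈ Q.verts, coordProd (L x) = coordProd x := by
    refine h.poly.edge_induction hw0 (by rw [hLw, hw]; exact ha0.2) fun x y hxy hx => ?_
    have hLxy := hE (L x) (L y) ((mem_of_map_eq hL).2.1 _ hxy)
    rw [hx, hE x y hxy] at hLxy
    exact (neg_injective hLxy).symm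
  have hcomm : ∀ x ∈ Q.verts, signScale ht (L x) = L (signScale ht x) := fun x hx =>
    signScale_map ht L (hV ▸ hx) (hpres x hx)
  refine ⟨L, ?_, fun i => ?_⟩
  · rw [map_map, ← h.poly.map_congr (f := signScale ht ∘ L) (g := L ∘ signScale ht) hcomm,
      ← map_map, hL]
  · rw [← hcomm _ (h.poly.apply_mem_verts h.tracks i), hLa, Equiv.apply_symm_apply]

omit hw in
include ht in
theorem not_coplanar_rescaleHalf (ht1 : t ≠ 1) {F : Set (Sym2 E3)}
    (hF : F ∈ (Q.rescaleHalf t).faces) : ¬ Coplanar ℝ (polygonVertices F) := by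
  rw [h.rescaleHalf_eq_map hV ht] at hF
  obtain ⟨F, hF, rfl⟩ := hF
  obtain ⟨b, hb, rfl, hb0⟩ : ∃ b, Q.Tracks b ∧ traceEdges b = F ∧ coordProd (b 0) = 1 := by
    obtain ⟨a, ha, rfl⟩ := h.poly.exists_tracks hF
    rcases coordProd_eq_of_mem_cubeVerts (hV ▸ h.poly.apply_mem_verts ha 0) with h1 | h1
    · exact ⟨a, ha, rfl, h1⟩
    · refine ⟨_, ha.shift 1, traceEdges_shift a 1, ?_⟩
      have hstep := hE _ _ (h.poly.mk_mem_edges ha 0)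
      rw [h1, neg_inj] at hstep
      exact hstep.symm
  beta_reduce
  rw [image_traceEdges, polygonVertices_traceEdges]
  simp only [h.signScale_apply hE ht hb hb0]
  exact h.not_coplanar_alt ht ht1 hb

include hS

include ht ht1 in
theorem rescaleHalf_spec :
    (Q.rescaleHalf t).IsRegularOfIndexTwo ∧ (Q.rescaleHalf t).vertexOrbits.ncard = 2 ∧
      ∀ F ∈ (Q.rescaleHalf t).faces, ¬ Coplanar ℝ (polygonVertices F) := by
  have h2 := h.rescaleHalf_twoLayered hV hE hS ht ht1
  have heq := h.rescaleHalf_eq_map hV ht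
  have hw' : (Q.rescaleHalf t).Tracks fun i => signScale ht (w i) :=
    heq ▸ h.tracks.map (signScale ht).injective
  have hw0 : signScale ht (w 0) ∈ tetrahedronVerts := by
    rw [signScale_of_eq_one ht hw]
    exact ⟨hV ▸ h.poly.apply_mem_verts h.tracks 0, hw⟩
  have hA := fun a => h.exists_isometry_rescaleHalf (a := a) hV hE hw ht
  refine ⟨h2.isRegularOfIndexTwo hw' hw0 hA fun a ha _ => ?_, h2.vertexOrbits_ncard hw' hw0 hA,
    fun F => h.not_coplanar_rescaleHalf hV hE ht ht1⟩
  rw [heq] at ha ⊢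
  exact h.exists_perm_map _ ha

theorem eq_or_eq_inv_of_rescaleHalf_similar {u : ℝ} (ht : 0 < t) (ht1 : t ≠ 1) (hu : 0 < u)
    (hu1 : u ≠ 1) (hsim : (Q.rescaleHalf t).Similar (Q.rescaleHalf u)) : u = t ∨ u = t⁻¹ := by
  have hw0 := hV ▸ h.poly.apply_mem_verts h.tracks 0
  have hw1 := hV ▸ h.poly.apply_mem_verts h.tracks 1
  have hprod := h.coordProd_apply hE h.tracks hw 1
  rw [zpow_one] at hprod
  exact TwoLayered.eq_or_eq_inv_of_similar h.pos (h.rescaleHalf_twoLayered hV hE hS ht ht1)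
    (h.rescaleHalf_twoLayered hV hE hS hu hu1) ⟨_, hw0, hw⟩ ⟨_, _, ⟨hw1, hprod⟩, rfl⟩ hsim

end CentredRegular

end Skeletal

/-! ### Generators of the symmetry group -/

namespace Skeletal

variable {P : Skeletal} {w : ℤ → E3} {ρ₀ ρ₁ ρ₂ : E3 ≃ₗᵢ[ℝ] E3}

/-- The linear isometries that map `P` to itself. -/
def linearSymmetryGroup (P : Skeletal) : Subgroup (E3 ≃ₗᵢ[ℝ] E3) where
  carrier := {L | P.map L = P}
  one_mem' := P.map_id
  mul_mem' {L M} (hL : P.map L = P) (hM : P.map M = P) := by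
    change P.map (L ∘ M) = P
    rw [← map_map, hM, hL]
  inv_mem' {L} (hL : P.map L = P) := map_symm_eq (f := L.toEquiv) hL

section linearSymmetryGroup

variable {L : E3 ≃ₗᵢ[ℝ] E3} (hL : L ∈ P.linearSymmetryGroup)
include hL

theorem mk_map_mem_edges_iff {x y : E3} : s(L x, L y) ∈ P.edges ↔ s(x, y) ∈ P.edges := by
  have hL' : P.map L = P := hL
  conv_lhs => rw [← hL']
  exact mk_mem_map_edges (f := L.toEquiv)

theorem Tracks.map_mem (h : P.Tracks w) : P.Tracks fun i => L (w i) :=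
  h.of_map_eq L.injective hL

theorem apply_mem_verts_iff {x : E3} : L x ∈ P.verts ↔ x ∈ P.verts := by
  have hL' : P.map L = P := hL
  conv_lhs => rw [← hL']
  exact L.injective.mem_set_image

theorem tracksFrom_apply (x y : E3) :
    P.tracksFrom (L x) (L y) = (fun a i => L (a i)) '' P.tracksFrom x y := by
  have hL' : P.map L = P := hL
  conv_lhs => rw [← hL']
  exact tracksFrom_map L.toEquiv x y

end linearSymmetryGroup

theorem mem_iff_mem_of_eqvGen {α : Type*} {r : α → α → Prop} {S : Set α}
    (hS : ∀ x y, r x y → (x ∈ S ↔ y ∈ S)) {x y : α} (hxy : Relation.EqvGen r x y) :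
    x ∈ S ↔ y ∈ S := by
  induction hxy with
  | rel x y h => exact hS x y h
  | refl => rfl
  | symm _ _ _ ih => exact ih.symm
  | trans _ _ _ _ _ ih₁ ih₂ => exact ih₁.trans ih₂

theorem eqvGen_apply_of_mem_closure {r : E3 → E3 → Prop} {s : Set (E3 ≃ₗᵢ[ℝ] E3)}
    (hs : ∀ L ∈ s, ∀ x y, r (L x) (L y) ↔ r x y) {x : E3} (hx : ∀ L ∈ s, Relation.EqvGen r (L x) x)
    {L : E3 ≃ₗᵢ[ℝ] E3} (hL : L ∈ Subgroup.closure s) : Relation.EqvGen r (L x) x := by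
  have apply_apply (M : E3 ≃ₗᵢ[ℝ] E3) (hM : ∀ x y, r (M x) (M y) ↔ r x y) {x y : E3}
      (hxy : Relation.EqvGen r x y) : Relation.EqvGen r (M x) (M y) :=
    ((Relation.EqvGen.is_equivalence r).comap M).eqvGen_iff.1
      (Relation.EqvGen.mono (fun x y h => .rel _ _ ((hM x y).2 h)) _ _ hxy)
  have key : (∀ x y, r (L x) (L y) ↔ r x y) ∧ Relation.EqvGen r (L x) x := by
    induction hL using Subgroup.closure_induction with
    | mem L hL => exact ⟨hs L hL, hx L hL⟩
    | one => exact ⟨fun _ _ => .rfl, .refl x⟩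
    | mul L M _ _ hL hM =>
      exact ⟨fun x y => (hL.1 _ _).trans (hM.1 x y), .trans _ _ _ (apply_apply L hL.1 hM.2) hL.2⟩
    | inv L _ hL =>
      have hinv : ∀ x y, r (L⁻¹ x) (L⁻¹ y) ↔ r x y := fun x y => by
        rw [← hL.1, LinearIsometryEquiv.coe_inv, L.apply_symm_apply, L.apply_symm_apply]
      have hx' := apply_apply L⁻¹ hinv hL.2
      rw [LinearIsometryEquiv.coe_inv, L.symm_apply_apply] at hx'
      exact ⟨hinv, .symm _ _ hx'⟩
  exact key.2

/-- Isometries `ρ₀`, `ρ₁`, `ρ₂` that act on the flag formed by the vertex `w 0`, the edge from `w 0`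
to `w 1` and the face traced by `w` as the standard generators of the symmetry group of a regular
polyhedron: `ρᵢ` replaces the element of rank `i` of the flag. That `P` is a polyhedron is a
consequence. -/
structure FlagGenerators (P : Skeletal) (w : ℤ → E3) (ρ₀ ρ₁ ρ₂ : E3 ≃ₗᵢ[ℝ] E3) : Prop where
  isPrepolyhedron : P.IsPrepolyhedron
  tracks : P.Tracks w
  mem₀ : ρ₀ ∈ P.linearSymmetryGroup
  mem₁ : ρ₁ ∈ P.linearSymmetryGroup
  mem₂ : ρ₂ ∈ P.linearSymmetryGroup
  apply₀ : ∀ i, ρ₀ (w i) = w (1 - i)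
  apply₁ : ∀ i, ρ₁ (w i) = w (-i)
  apply₂_zero : ρ₂ (w 0) = w 0
  apply₂_one : ρ₂ (w 1) = w 1
  apply₂_two_ne : ρ₂ (w 2) ≠ w 2
  eq_or_eq : ∀ a, P.Tracks a → a 0 = w 0 → a 1 = w 1 → a = w ∨ a = fun i => ρ₂ (w i)
  exists_apply_zero : ∀ x ∈ P.verts, ∃ L ∈ Subgroup.closure {ρ₀, ρ₁, ρ₂}, L (w 0) = x
  exists_apply_one : ∀ y, s(w 0, y) ∈ P.edges → ∃ L ∈ Subgroup.closure {ρ₁, ρ₂}, L (w 1) = y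
  fixed : ∀ n, ρ₀ n = n → ρ₁ n = n → ρ₂ n = n → n = 0
  span : ∀ n : E3, inner ℝ n (w 0) = 0 → inner ℝ n (w 1) = 0 → inner ℝ n (w 2) = 0 → n = 0

namespace FlagGenerators

variable (h : P.FlagGenerators w ρ₀ ρ₁ ρ₂)
include h

theorem mk_mem_edges : s(w 0, w 1) ∈ P.edges :=
  (h.isPrepolyhedron.face_spec _ h.tracks.2).2 (mk_mem_traceEdges rfl)

theorem zero_mem_verts : w 0 ∈ P.verts :=
  (h.isPrepolyhedron.edge_spec _ h.mk_mem_edges).2 _ (Sym2.mem_mk_left _ _)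

theorem closure_le : Subgroup.closure {ρ₀, ρ₁, ρ₂} ≤ P.linearSymmetryGroup := by
  rw [Subgroup.closure_le]
  rintro L (rfl | rfl | rfl)
  exacts [h.mem₀, h.mem₁, h.mem₂]

theorem apply_zero_of_mem_closure {L : E3 ≃ₗᵢ[ℝ] E3} (hL : L ∈ Subgroup.closure {ρ₁, ρ₂}) :
    L (w 0) = w 0 := by
  induction hL using Subgroup.closure_induction with
  | mem L hL =>
    rcases hL with rfl | rfl
    · simpa using h.apply₁ 0
    · exact h.apply₂_zero
  | one => rfl
  | mul L M _ _ hL hM => exact (congrArg L hM).trans hL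
  | inv L _ hL => exact L.symm_apply_eq.2 hL.symm

theorem exists_apply_edge {x y : E3} (hxy : s(x, y) ∈ P.edges) :
    ∃ L ∈ P.linearSymmetryGroup, L (w 0) = x ∧ L (w 1) = y := by
  have hx := (h.isPrepolyhedron.edge_spec _ hxy).2 x (Sym2.mem_mk_left x y)
  obtain ⟨L, hL, rfl⟩ := h.exists_apply_zero x hx
  have hL' := h.closure_le hL
  obtain ⟨y, rfl⟩ := L.surjective y
  obtain ⟨M, hM, rfl⟩ := h.exists_apply_one y ((mk_map_mem_edges_iff hL').1 hxy)
  have hM' : M ∈ P.linearSymmetryGroup :=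
    h.closure_le (Subgroup.closure_mono (Set.subset_insert _ _) hM)
  exact ⟨L * M, mul_mem hL' hM', congrArg L (h.apply_zero_of_mem_closure hM), rfl⟩

theorem exists_apply_eq {a : ℤ → E3} (ha : P.Tracks a) :
    ∃ L ∈ P.linearSymmetryGroup, ∀ i, L (w i) = a i := by
  obtain ⟨L, hL, h0, h1⟩ := h.exists_apply_edge
    ((h.isPrepolyhedron.face_spec _ ha.2).2 (mk_mem_traceEdges (zero_add 1).symm))
  have hLi := inv_mem hL
  rcases h.eq_or_eq _ (ha.map_mem hLi) (L.symm_apply_eq.2 h0.symm) (L.symm_apply_eq.2 h1.symm)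
    with e | e
  · exact ⟨L, hL, fun i => (L.symm_apply_eq.1 (congrFun e i)).symm⟩
  · exact ⟨L * ρ₂, mul_mem hL h.mem₂, fun i => (L.symm_apply_eq.1 (congrFun e i)).symm⟩

theorem eqvGen_edges {x : E3} (hx : x ∈ P.verts) :
    Relation.EqvGen (fun x y => s(x, y) ∈ P.edges) x (w 0) := by
  obtain ⟨L, hL, rfl⟩ := h.exists_apply_zero x hx
  refine eqvGen_apply_of_mem_closure (s := {ρ₀, ρ₁, ρ₂}) (fun M hM _ _ => ?_) ?_ hL
  · exact mk_map_mem_edges_iff (h.closure_le (Subgroup.subset_closure hM))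
  · rintro L (rfl | rfl | rfl)
    · rw [h.apply₀]
      exact .symm _ _ (.rel _ _ h.mk_mem_edges)
    · rw [h.apply₁]
      exact .refl _
    · rw [h.apply₂_zero]
      exact .refl _

theorem eqvGen_tracks {y : E3} (hy : s(w 0, y) ∈ P.edges) :
    Relation.EqvGen (fun x y => ∃ a, P.Tracks a ∧ a 0 = w 0 ∧ a (-1) = x ∧ a 1 = y) y (w 1) := by
  obtain ⟨L, hL, rfl⟩ := h.exists_apply_one y hy
  refine eqvGen_apply_of_mem_closure (s := {ρ₁, ρ₂}) (fun M hM x y => ?_) ?_ hL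
  · have hM' := Subgroup.subset_closure hM
    have hMP : M ∈ P.linearSymmetryGroup :=
      h.closure_le (Subgroup.closure_mono (Set.subset_insert _ _) hM')
    have hM0 := h.apply_zero_of_mem_closure hM'
    constructor
    · rintro ⟨a, ha, ha0, hx, hy⟩
      exact ⟨_, ha.map_mem (inv_mem hMP), M.symm_apply_eq.2 (ha0.trans hM0.symm),
        M.symm_apply_eq.2 hx, M.symm_apply_eq.2 hy⟩
    · rintro ⟨a, ha, ha0, rfl, rfl⟩
      exact ⟨_, ha.map_mem hMP, (congrArg M ha0).trans hM0, rfl, rfl⟩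
  · rintro L (rfl | rfl)
    · exact .rel _ _ ⟨w, h.tracks, rfl, (h.apply₁ 1).symm, rfl⟩
    · rw [h.apply₂_one]
      exact .refl _

theorem tracksFrom_eq : P.tracksFrom (w 0) (w 1) = {w, fun i => ρ₂ (w i)} := by
  ext a
  constructor
  · rintro ⟨ha, h0, h1⟩
    exact h.eq_or_eq a ha h0 h1
  · rintro (rfl | rfl)
    · exact ⟨h.tracks, rfl, rfl⟩
    · exact ⟨h.tracks.map_mem h.mem₂, h.apply₂_zero, h.apply₂_one⟩

theorem isPolyhedron : P.IsPolyhedron := by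
  refine h.isPrepolyhedron.isPolyhedron h.zero_mem_verts ?_ ?_ ?_
  · intro S h0 hS x hx
    have hE : ∀ x y, s(x, y) ∈ P.edges → (x ∈ S ↔ y ∈ S) := fun x y hxy =>
      ⟨hS x y hxy, hS y x (Sym2.eq_swap ▸ hxy)⟩
    exact mem_iff_mem_of_eqvGen hE (h.eqvGen_edges hx) |>.2 h0
  · intro x hx
    obtain ⟨L, hL, rfl⟩ := h.exists_apply_zero x hx
    replace hL := h.closure_le hL
    refine ⟨L (w 1), (mk_map_mem_edges_iff hL).2 h.mk_mem_edges, fun S h1 hS y hy => ?_⟩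
    obtain ⟨y, rfl⟩ := L.surjective y
    have hE : ∀ x y, (∃ a, P.Tracks a ∧ a 0 = w 0 ∧ a (-1) = x ∧ a 1 = y) →
        (x ∈ L ⁻¹' S ↔ y ∈ L ⁻¹' S) := by
      rintro _ _ ⟨a, ha, h0, rfl, rfl⟩
      have ha' := ha.map_mem hL
      exact ⟨hS _ ha' (congrArg L h0), hS _ (ha'.reflect 0) (congrArg L h0)⟩
    exact mem_iff_mem_of_eqvGen hE (h.eqvGen_tracks ((mk_map_mem_edges_iff hL).1 hy)) |>.2 h1
  · intro x y hxy
    obtain ⟨L, hL, rfl, rfl⟩ := h.exists_apply_edge hxy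
    rw [tracksFrom_apply hL, h.tracksFrom_eq,
      Set.ncard_image_of_injective _ fun a b e => funext fun i => L.injective (congrFun e i),
      Set.ncard_pair fun e => h.apply₂_two_ne (congrFun e 2).symm]

theorem sum_verts_eq_zero : ∑ᶠ x ∈ P.verts, x = 0 := by
  have apply_sum (L : E3 ≃ₗᵢ[ℝ] E3) (hL : L ∈ P.linearSymmetryGroup) :
      L (∑ᶠ x ∈ P.verts, x) = ∑ᶠ x ∈ P.verts, x := by
    have hLP : L '' P.verts = P.verts := congrArg verts (hL : P.map L = P)
    conv_rhs => rw [← hLP, finsum_mem_image L.injective.injOn]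
    exact L.toLinearEquiv.toAddMonoidHom.map_finsum_mem _ h.isPrepolyhedron.finite_verts
  exact h.fixed _ (apply_sum ρ₀ h.mem₀) (apply_sum ρ₁ h.mem₁) (apply_sum ρ₂ h.mem₂)

theorem centredRegular {N : ℕ} (hN : 0 < N) {ε : ℝ} (hε : ε = 1 ∨ ε = -1)
    (hsum : ∑ j ∈ Finset.range N, w (2 * j) = ε • ∑ j ∈ Finset.range N, w (2 * j + 1)) :
    P.CentredRegular w ‖w 0‖ where
  poly := h.isPolyhedron
  tracks := h.tracks
  trans _ ha := h.exists_apply_eq ha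
  pos := by
    refine norm_pos_iff.2 fun h0 => h.isPolyhedron.ne_of_edge h.mk_mem_edges ?_
    simpa [h0] using h.apply₀ 0
  norm_eq x hx := by
    obtain ⟨L, -, rfl⟩ := h.exists_apply_zero x hx
    exact L.norm_map _
  sum_eq := h.sum_verts_eq_zero
  span := h.span
  balanced := ⟨N, hN, ε, hε, hsum⟩

end FlagGenerators

end Skeletal

/-! ### Petrie duals -/

theorem exists_isTracing_of_finite_range {α : Type*} {z : ℤ → α}
    (hadd : ∀ i j k, z (i + k) = z (j + k) ↔ z i = z j) (hz : (Set.range z).Finite)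
    (h1 : z 1 ≠ z 0) (h2 : z 2 ≠ z 0) : ∃ p, IsTracing p z := by
  have hsub : ∀ i j, z i = z j ↔ z (i - j) = z 0 := fun i j => by
    rw [← hadd (i - j) 0 j, sub_add_cancel, zero_add]
  let periods : AddSubgroup ℤ :=
    { carrier := {k | z k = z 0}
      zero_mem' := rfl
      add_mem' := fun {i j} (hi : z i = z 0) (hj : z j = z 0) =>
        ((hadd i 0 j).2 hi).trans ((congrArg z (zero_add j)).trans hj)
      neg_mem' := fun {i} (hi : z i = z 0) => by simpa [eq_comm] using (hsub 0 i).1 hi.symm }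
  obtain ⟨g, hg⟩ := Int.subgroup_cyclic periods
  have hdvd : ∀ k, z k = z 0 ↔ (g.natAbs : ℤ) ∣ k := fun k => by
    rw [Int.natCast_natAbs, abs_dvd, ← Int.mem_zmultiples_iff, AddSubgroup.zmultiples_eq_closure,
      ← hg]
    rfl
  refine ⟨g.natAbs, ?_, fun i j => (hsub i j).trans (hdvd _)⟩
  have hg0 : g.natAbs ≠ 0 := fun h0 =>
    Set.infinite_range_of_injective (fun i j hij => by
      simpa [h0, sub_eq_zero] using (hdvd _).1 ((hsub i j).1 hij)) hz
  have hg1 : g.natAbs ≠ 1 := fun h => h1 ((hdvd 1).2 (by simp [h]))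
  have hg2 : g.natAbs ≠ 2 := fun h => h2 ((hdvd 2).2 (by simp [h]))
  omega

namespace Skeletal

variable {P : Skeletal} {w z a b : ℤ → E3} {x y u v v' : E3} {ρ₀ ρ₁ ρ₂ : E3 ≃ₗᵢ[ℝ] E3}

/-- Any two, but not all three, of the consecutive segments joining `x`, `y`, `u`, `v` are edges of
a common face. -/
def IsPetrieArc (P : Skeletal) (x y u v : E3) : Prop :=
  (∃ G ∈ P.faces, s(x, y) ∈ G ∧ s(y, u) ∈ G) ∧ (∃ G ∈ P.faces, s(y, u) ∈ G ∧ s(u, v) ∈ G) ∧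
    ¬ ∃ G ∈ P.faces, s(x, y) ∈ G ∧ s(y, u) ∈ G ∧ s(u, v) ∈ G

theorem IsPetrieArc.symm (h : P.IsPetrieArc x y u v) : P.IsPetrieArc v u y x := by
  simp only [IsPetrieArc, Sym2.eq_swap (a := v), Sym2.eq_swap (a := u) (b := y),
    Sym2.eq_swap (a := y) (b := x)]
  obtain ⟨⟨G, hG, h₁, h₂⟩, ⟨H, hH, h₃, h₄⟩, h₅⟩ := h
  exact ⟨⟨H, hH, h₄, h₃⟩, ⟨G, hG, h₂, h₁⟩,
    fun ⟨K, hK, h₆, h₇, h₈⟩ => h₅ ⟨K, hK, h₈, h₇, h₆⟩⟩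

theorem IsPetrieArc.map {f : Equiv.Perm E3} (hf : P.map f = P) (h : P.IsPetrieArc x y u v) :
    P.IsPetrieArc (f x) (f y) (f u) (f v) := by
  have face_map := (mem_of_map_eq hf).2.2
  obtain ⟨⟨G, hG, h₁, h₂⟩, ⟨H, hH, h₃, h₄⟩, h₅⟩ := h
  refine ⟨⟨_, face_map G hG, ⟨_, h₁, rfl⟩, ⟨_, h₂, rfl⟩⟩,
    ⟨_, face_map H hH, ⟨_, h₃, rfl⟩, ⟨_, h₄, rfl⟩⟩, ?_⟩
  rintro ⟨K, hK, h₆, h₇, h₈⟩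
  refine h₅ ⟨_, (mem_of_map_eq (map_symm_eq hf)).2.2 K hK, ⟨_, h₆, ?_⟩, ⟨_, h₇, ?_⟩,
    ⟨_, h₈, ?_⟩⟩ <;> simp

/-- Any two, but no three, consecutive edges of the path `z` belong to a common face. -/
def IsPetriePath (P : Skeletal) (z : ℤ → E3) : Prop :=
  ∀ i, P.IsPetrieArc (z i) (z (i + 1)) (z (i + 2)) (z (i + 3))

namespace IsPetriePath

theorem shift (h : P.IsPetriePath z) (k : ℤ) : P.IsPetriePath fun j => z (k + j) := fun i => by
  simpa only [add_assoc] using h (k + i)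

theorem reflect (h : P.IsPetriePath z) (k : ℤ) : P.IsPetriePath fun j => z (k - j) := fun i => by
  convert (h (k - i - 3)).symm using 2 <;> ring

theorem map {f : Equiv.Perm E3} (hf : P.map f = P) (h : P.IsPetriePath z) :
    P.IsPetriePath fun i => f (z i) := fun i => (h i).map hf

end IsPetriePath

theorem mem_petrieDual_faces {F : Set (Sym2 E3)} : F ∈ P.petrieDual.faces ↔
    ∃ z, (∃ p, IsTracing p z) ∧ P.IsPetriePath z ∧ traceEdges z ⊆ P.edges ∧ F = traceEdges z := by
  constructor
  · rintro ⟨p, hp, v, hv, rfl, hF, h⟩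
    refine ⟨fun j => v j, ⟨p, isTracing_intCast hp hv⟩, fun i => ⟨?_, ?_, ?_⟩, ?_,
      polygon_eq_traceEdges v⟩
    · simpa using (h i).1
    · have h' := (h (i + 1)).1
      simp only [add_assoc, one_add_one_eq_two, show (1 : ZMod p) + 2 = 3 by norm_num] at h'
      simpa using h'
    · simpa using (h i).2
    · rwa [← polygon_eq_traceEdges]
  · rintro ⟨z, ⟨p, hp⟩, hz, hF, rfl⟩
    obtain ⟨v, hv, rfl⟩ := hp.exists_zmod
    refine ⟨p, hp.three_le, v, hv, (polygon_eq_traceEdges v).symm, hF, fun i => ?_⟩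
    obtain ⟨i, rfl⟩ := ZMod.intCast_surjective i
    obtain ⟨h₁, -, h₂⟩ := hz i
    exact ⟨by simpa using h₁, by simpa using h₂⟩

theorem Tracks.isPetriePath (h : P.petrieDual.Tracks z) : P.IsPetriePath z := by
  obtain ⟨a, ⟨p, hp⟩, ha, -, he⟩ := mem_petrieDual_faces.1 h.2
  obtain ⟨q, hq⟩ := h.1
  obtain ⟨k, rfl | rfl⟩ := hp.eq_shift_or_reflect hq he.symm
  · exact ha.shift k
  · exact ha.reflect k

theorem Stable.petrieDual {f : Equiv.Perm E3} (hf : P.map f = P) : P.petrieDual.Stable f := by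
  obtain ⟨vert_map, edge_map, -⟩ := mem_of_map_eq hf
  refine ⟨vert_map, edge_map, fun F hF => ?_⟩
  obtain ⟨z, ⟨p, hp⟩, hz, hE, rfl⟩ := mem_petrieDual_faces.1 hF
  rw [image_traceEdges]
  refine mem_petrieDual_faces.2 ⟨_, ⟨p, hp.comp f.injective.injOn⟩, hz.map hf, ?_, rfl⟩
  rw [← image_traceEdges]
  exact Set.image_subset_iff.2 fun e he => edge_map e (hE he)

theorem linearSymmetryGroup_le_petrieDual :
    P.linearSymmetryGroup ≤ P.petrieDual.linearSymmetryGroup := fun L (hL : P.map L.toEquiv = P) =>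
  map_eq_of_stable (.petrieDual hL) (.petrieDual (map_symm_eq hL))

theorem IsPrepolyhedron.petrieDual (hP : P.IsPrepolyhedron) : P.petrieDual.IsPrepolyhedron where
  finite_verts := hP.finite_verts
  edge_spec := hP.edge_spec
  face_spec F hF := by
    obtain ⟨z, ⟨p, hp⟩, -, hE, rfl⟩ := mem_petrieDual_faces.1 hF
    exact ⟨⟨p, isPolygon_iff_exists_isTracing.2 ⟨z, hp, rfl⟩⟩, hE⟩

namespace IsPolyhedron

variable (hP : P.IsPolyhedron)
include hP

theorem exists_tracks_corner {G : Set (Sym2 E3)} (hG : G ∈ P.faces) (hxy : s(x, y) ∈ G)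
    (hyu : s(y, u) ∈ G) (hxu : x ≠ u) :
    ∃ a, P.Tracks a ∧ traceEdges a = G ∧ a 0 = x ∧ a 1 = y ∧ a 2 = u := by
  obtain ⟨a, ha, rfl, rfl, rfl⟩ := hP.exists_tracks_start hG hxy
  refine ⟨a, ha, rfl, rfl, rfl, ?_⟩
  rcases (ha.shift 1).eq_one_or_neg_one_of_mk_mem (by simpa [traceEdges_shift] using hyu)
    with h | h
  · exact h.symm
  · exact (hxu (h.trans (by norm_num)).symm).elim

theorem petrieArc_unique (h : P.IsPetrieArc x y u v) (h' : P.IsPetrieArc x y u v') (hv : y ≠ v)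
    (hv' : y ≠ v') : v = v' := by
  obtain ⟨⟨G, hG, hxy, hyu⟩, ⟨H, hH, hyu₁, huv⟩, hne⟩ := h
  obtain ⟨-, ⟨K, hK, hyu₂, huv'⟩, hne'⟩ := h'
  obtain ⟨O, -, -, -, hO⟩ := hP.exists_other_face ((hP.face_spec G hG).2 hyu) hG hyu
  have hHO : H = O := (hO H hH hyu₁).resolve_left fun e => hne ⟨G, hG, hxy, hyu, e ▸ huv⟩
  have hKO : K = O := (hO K hK hyu₂).resolve_left fun e => hne' ⟨G, hG, hxy, hyu, e ▸ huv'⟩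
  obtain ⟨a, ha, hae, rfl, rfl, rfl⟩ := hP.exists_tracks_corner hH hyu₁ huv hv
  obtain ⟨b, hb, hbe, b0, b1, rfl⟩ := hP.exists_tracks_corner hK hyu₂ huv' hv'
  rw [ha.ext hb (by rw [hae, hbe, hHO, hKO]) b0.symm b1.symm]

theorem petriePath_natCast_eq {p q : ℕ} (hz : P.IsPetriePath z) (ha : P.IsPetriePath a)
    (hp : IsTracing p z) (hq : IsTracing q a) (h0 : z 0 = a 0) (h1 : z 1 = a 1) (h2 : z 2 = a 2)
    (n : ℕ) : z n = a n := by
  induction n generalizing z a with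
  | zero => exact h0
  | succ n ih =>
    have h3 : z 3 = a 3 := by
      have harc : P.IsPetrieArc (z 0) (z 1) (z 2) (a 3) := by
        simpa only [h0, h1, h2, zero_add] using ha 0
      have hz3 : z 1 ≠ z 3 := hp.apply_ne_apply_add 1 two_pos (by norm_num)
      have ha3 : a 1 ≠ a 3 := hq.apply_ne_apply_add 1 two_pos (by norm_num)
      exact hP.petrieArc_unique (hz 0) harc hz3 (h1 ▸ ha3)
    simpa only [Nat.cast_add, Nat.cast_one, add_comm] using
      ih (hz.shift 1) (ha.shift 1) (hp.shift 1) (hq.shift 1) h1 h2 h3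

theorem petrieDual_tracks_ext (hz : P.petrieDual.Tracks z) (ha : P.petrieDual.Tracks a)
    (h0 : z 0 = a 0) (h1 : z 1 = a 1) (h2 : z 2 = a 2) : z = a := by
  obtain ⟨p, hp⟩ := hz.1
  obtain ⟨q, hq⟩ := ha.1
  have hz' := hz.isPetriePath
  have ha' := ha.isPetriePath
  funext i
  obtain ⟨n, rfl | rfl⟩ := i.eq_nat_or_neg
  · exact hP.petriePath_natCast_eq hz' ha' hp hq h0 h1 h2 n
  · have h := hP.petriePath_natCast_eq (hz'.reflect 2) (ha'.reflect 2) (hp.reflect 2)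
      (hq.reflect 2) h2 h1 h0 (n + 2)
    simpa using h

theorem exists_tracks_of_petrieDual (hz : P.petrieDual.Tracks z) :
    ∃ a, P.Tracks a ∧ a 0 = z 0 ∧ a 1 = z 1 ∧ a 2 = z 2 := by
  obtain ⟨G, hG, h₁, h₂⟩ := (hz.isPetriePath 0).1
  obtain ⟨a, ha, -, h⟩ := hP.exists_tracks_corner hG h₁ h₂ (hz.apply_ne_apply_add_two 0)
  exact ⟨a, ha, h⟩

end IsPolyhedron

end Skeletal

namespace Skeletal

variable {P : Skeletal} {w : ℤ → E3} {ρ₀ ρ₁ ρ₂ : E3 ≃ₗᵢ[ℝ] E3}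

namespace FlagGenerators

variable (h : P.FlagGenerators w ρ₀ ρ₁ ρ₂)
include h

theorem isometry_ext {L M : E3 ≃ₗᵢ[ℝ] E3} (h0 : L (w 0) = M (w 0)) (h1 : L (w 1) = M (w 1))
    (h2 : L (w 2) = M (w 2)) : L = M := by
  have inner_sub (x y : E3) (hx : L x = M x) : inner ℝ (L.symm (L y - M y)) x = 0 := by
    rw [← L.inner_map_map, L.apply_symm_apply, inner_sub_left, L.inner_map_map, hx,
      M.inner_map_map, sub_self]
  ext1 y
  have hy := h.span _ (inner_sub _ y h0) (inner_sub _ y h1) (inner_sub _ y h2)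
  rwa [map_eq_zero_iff _ L.symm.injective, sub_eq_zero] at hy

theorem tracks_map₂ : P.Tracks fun i => ρ₂ (w i) :=
  h.tracks.map_mem h.mem₂

theorem mul_self₀ : ρ₀ * ρ₀ = 1 :=
  h.isometry_ext (by simp [h.apply₀]) (by simp [h.apply₀]) (by simp [h.apply₀])

theorem mul_self₁ : ρ₁ * ρ₁ = 1 :=
  h.isometry_ext (by simp [h.apply₁]) (by simp [h.apply₁]) (by simp [h.apply₁])

theorem mul_self₂ : ρ₂ * ρ₂ = 1 := by
  have h22 : ρ₂ (ρ₂ (w 2)) = w 2 := by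
    rcases h.eq_or_eq _ (h.tracks_map₂.map_mem h.mem₂)
      (by simp [h.apply₂_zero]) (by simp [h.apply₂_one]) with e | e
    · exact congrFun e 2
    · exact (h.apply₂_two_ne (ρ₂.injective (congrFun e 2))).elim
  exact h.isometry_ext (by simp [h.apply₂_zero]) (by simp [h.apply₂_one]) (by simpa using h22)

theorem mul_comm₀₂ : ρ₀ * ρ₂ = ρ₂ * ρ₀ := by
  have hw (i) : ρ₀ (ρ₂ (w (1 - i))) = ρ₂ (w i) := by
    rcases h.eq_or_eq _ ((h.tracks_map₂.map_mem h.mem₀).reflect 1)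
      (by simp [h.apply₂_one, h.apply₀]) (by simp [h.apply₂_zero, h.apply₀]) with e | e
    · refine (h.apply₂_two_ne (ρ₀.injective ?_)).elim
      simpa [h.apply₀] using congrFun e (-1)
    · exact congrFun e i
  have hw' (i) : (ρ₀ * ρ₂) (w i) = (ρ₂ * ρ₀) (w i) := by
    simpa [h.apply₀] using hw (1 - i)
  exact h.isometry_ext (hw' 0) (hw' 1) (hw' 2)

theorem mul_self₀₂ : ρ₀ * ρ₂ * (ρ₀ * ρ₂) = 1 := by
  rw [mul_assoc, h.mul_comm₀₂, ← mul_assoc ρ₂, h.mul_self₂, one_mul, h.mul_self₀]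

theorem apply₂_neg_one_ne : ρ₂ (w (-1)) ≠ w (-1) := fun e => by
  have hw := DFunLike.congr_fun h.mul_comm₀₂ (w (-1))
  simp [e, h.apply₀] at hw
  exact h.apply₂_two_ne hw.symm

theorem isPetrieArc : P.IsPetrieArc (w (-1)) (w 0) (w 1) (ρ₂ (w 2)) := by
  have h₂ : s(w 0, w 1) ∈ traceEdges fun i => ρ₂ (w i) := by
    simpa only [h.apply₂_zero, h.apply₂_one] using
      mk_mem_traceEdges (w := fun i => ρ₂ (w i)) (zero_add 1).symm
  have h₃ : s(w 1, ρ₂ (w 2)) ∈ traceEdges fun i => ρ₂ (w i) := by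
    simpa only [h.apply₂_one] using
      mk_mem_traceEdges (w := fun i => ρ₂ (w i)) (one_add_one_eq_two (R := ℤ)).symm
  refine ⟨⟨_, h.tracks.2, mk_mem_traceEdges rfl, mk_mem_traceEdges rfl⟩,
    ⟨_, h.tracks_map₂.2, h₂, h₃⟩, ?_⟩
  rintro ⟨G, hG, h₄, h₅, h₆⟩
  obtain ⟨a, ha, rfl, a0, a1⟩ := h.isPolyhedron.exists_tracks_start hG h₅
  rcases h.eq_or_eq a ha a0 a1 with rfl | rfl
  · rcases (ha.shift 1).eq_one_or_neg_one_of_mk_mem (by rwa [traceEdges_shift]) with e | e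
    · exact h.apply₂_two_ne e
    · refine ha.apply_ne_apply_add_two 0 (ρ₂.injective ?_)
      simpa [h.apply₂_zero] using e.symm
  · rw [Sym2.eq_swap, ← h.apply₂_zero] at h₄
    rcases ha.eq_one_or_neg_one_of_mk_mem h₄ with e | e
    · exact h.tracks.apply_neg_one_ne_apply_one (e.trans a1)
    · exact h.apply₂_neg_one_ne e.symm

end FlagGenerators

/-- The path through `x` along which the isometry `σ` moves by one step; it is a Petrie polygon if
`σ` is the product of the three generators of the symmetry group. -/
noncomputable def orbitPath (σ : E3 ≃ₗᵢ[ℝ] E3) (x : E3) (i : ℤ) : E3 :=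
  (σ ^ i) x

section orbitPath

variable {σ τ : E3 ≃ₗᵢ[ℝ] E3} {x : E3}

@[simp]
theorem orbitPath_zero : orbitPath σ x 0 = x := rfl

theorem zpow_orbitPath (i j : ℤ) : (σ ^ i) (orbitPath σ x j) = orbitPath σ x (i + j) :=
  (DFunLike.congr_fun (zpow_add σ i j) x).symm

theorem apply_orbitPath (j : ℤ) : σ (orbitPath σ x j) = orbitPath σ x (1 + j) := by
  rw [← zpow_orbitPath, zpow_one]

theorem orbitPath_add_eq_iff (i j k : ℤ) :
    orbitPath σ x (i + k) = orbitPath σ x (j + k) ↔ orbitPath σ x i = orbitPath σ x j := by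
  rw [add_comm i, add_comm j, ← zpow_orbitPath, ← zpow_orbitPath, (σ ^ k).injective.eq_iff]

theorem conj_apply_orbitPath (hσ : τ * σ * τ⁻¹ = σ⁻¹) (i : ℤ) :
    τ (orbitPath σ x i) = (σ ^ (-i)) (τ x) := by
  rw [zpow_neg, ← inv_zpow, ← hσ, conj_zpow]
  change _ = τ ((σ ^ i) (τ.symm (τ x)))
  rw [τ.symm_apply_apply]
  rfl

theorem sum_orbitPath_eq_neg {p : ℕ} (hp : orbitPath σ x p = x) (hσ : ∀ n, σ n = n → n = 0) :
    ∑ j ∈ Finset.range p, orbitPath σ x (2 * j) =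
      (-1 : ℝ) • ∑ j ∈ Finset.range p, orbitPath σ x (2 * j + 1) := by
  have sum_eq : σ (∑ j ∈ Finset.range p, orbitPath σ x (2 * j)) =
      ∑ j ∈ Finset.range p, orbitPath σ x (2 * j + 1) := by
    simp only [map_sum, apply_orbitPath, add_comm]
  have h2p : orbitPath σ x (2 * p) = x := by
    rw [two_mul, ← zpow_orbitPath, hp]
    exact hp
  have sum_eq' : σ (∑ j ∈ Finset.range p, orbitPath σ x (2 * j + 1)) =
      ∑ j ∈ Finset.range p, orbitPath σ x (2 * j) := by
    have hstep (j : ℕ) : σ (orbitPath σ x (2 * j + 1)) = orbitPath σ x (2 * (j + 1 : ℕ)) := by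
      rw [apply_orbitPath]
      congr 1
      push_cast
      ring
    simp only [map_sum, hstep]
    refine add_right_cancel (b := orbitPath σ x (2 * (0 : ℕ))) ?_
    rw [← Finset.sum_range_succ' fun j => orbitPath σ x (2 * j), Finset.sum_range_succ, h2p]
    simp
  rw [neg_one_smul, ← add_eq_zero_iff_eq_neg]
  exact hσ _ (by rw [map_add, sum_eq, sum_eq', add_comm])

end orbitPath

namespace FlagGenerators

variable (h : P.FlagGenerators w ρ₀ ρ₁ ρ₂)
include h

theorem coxeter_apply_neg_one : (ρ₂ * ρ₀ * ρ₁) (w (-1)) = w 0 := by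
  simp [h.apply₁, h.apply₀, h.apply₂_zero]

theorem coxeter_apply_zero : (ρ₂ * ρ₀ * ρ₁) (w 0) = w 1 := by
  simp [h.apply₁, h.apply₀, h.apply₂_one]

theorem coxeter_apply_one : (ρ₂ * ρ₀ * ρ₁) (w 1) = ρ₂ (w 2) := by
  simp [h.apply₁, h.apply₀]

theorem coxeter_mem : ρ₂ * ρ₀ * ρ₁ ∈ P.linearSymmetryGroup :=
  mul_mem (mul_mem h.mem₂ h.mem₀) h.mem₁

local notation "ζ" => orbitPath (ρ₂ * ρ₀ * ρ₁) (w 0)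

theorem petrie_neg_one : ζ (-1) = w (-1) :=
  (ρ₂ * ρ₀ * ρ₁).symm_apply_eq.2 h.coxeter_apply_neg_one.symm

theorem petrie_one : ζ 1 = w 1 :=
  h.coxeter_apply_zero

theorem petrie_two : ζ 2 = ρ₂ (w 2) := by
  have h2 : ζ 2 = (ρ₂ * ρ₀ * ρ₁) (ζ 1) := (apply_orbitPath 1).symm
  rw [h2, h.petrie_one, h.coxeter_apply_one]

theorem petrie_isPetriePath : P.IsPetriePath ζ := fun i => by
  have h0 : P.IsPetrieArc (ζ (-1)) (ζ 0) (ζ 1) (ζ 2) := by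
    rw [h.petrie_neg_one, h.petrie_one, h.petrie_two]
    exact h.isPetrieArc
  convert h0.map (f := ((ρ₂ * ρ₀ * ρ₁) ^ (i + 1)).toEquiv) (zpow_mem h.coxeter_mem (i + 1)) using 1
    <;> exact (congrArg _ (by ring)).trans (zpow_orbitPath (i + 1) _).symm

theorem exists_isTracing_petrie : ∃ p, IsTracing p ζ := by
  refine exists_isTracing_of_finite_range orbitPath_add_eq_iff
    (h.isPrepolyhedron.finite_verts.subset ?_) ?_ ?_
  · rintro _ ⟨i, rfl⟩
    exact (apply_mem_verts_iff (zpow_mem h.coxeter_mem i)).2 h.zero_mem_verts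
  · rw [h.petrie_one]
    exact (h.isPolyhedron.ne_of_edge h.mk_mem_edges).symm
  · rw [h.petrie_two, orbitPath_zero, ← h.apply₂_zero, ρ₂.injective.ne_iff]
    exact (h.tracks.apply_ne_apply_add_two 0).symm

theorem petrie_tracks : P.petrieDual.Tracks ζ := by
  refine ⟨h.exists_isTracing_petrie, mem_petrieDual_faces.2
    ⟨_, h.exists_isTracing_petrie, h.petrie_isPetriePath, ?_, rfl⟩⟩
  rintro _ ⟨i, rfl⟩
  obtain ⟨G, hG, hi, -⟩ := (h.petrie_isPetriePath i).1
  exact (h.isPrepolyhedron.face_spec G hG).2 hi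

theorem petrie_eq_or_eq {a : ℤ → E3} (ha : P.petrieDual.Tracks a) (h0 : a 0 = w 0)
    (h1 : a 1 = w 1) : a = ζ ∨ a = fun i => ρ₂ (ζ i) := by
  have hP := h.isPolyhedron
  have hζ := h.petrie_tracks
  obtain ⟨b, hb, b0, b1, b2⟩ := hP.exists_tracks_of_petrieDual ha
  rcases h.eq_or_eq b hb (b0.trans h0) (b1.trans h1) with rfl | rfl
  · refine .inr (hP.petrieDual_tracks_ext ha
      (hζ.map_mem (linearSymmetryGroup_le_petrieDual h.mem₂)) ?_ ?_ ?_)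
    · rw [h0, orbitPath_zero, h.apply₂_zero]
    · rw [h1, h.petrie_one, h.apply₂_one]
    · rw [← b2, h.petrie_two]
      exact (DFunLike.congr_fun h.mul_self₂ _).symm
  · exact .inl (hP.petrieDual_tracks_ext ha hζ h0 (h1.trans h.petrie_one.symm)
      (b2.symm.trans h.petrie_two.symm))

theorem petrie_apply₁ (i : ℤ) : ρ₁ (ζ i) = ζ (-i) := by
  have hσ : ρ₁ * (ρ₂ * ρ₀ * ρ₁) * ρ₁⁻¹ = (ρ₂ * ρ₀ * ρ₁)⁻¹ := by
    rw [← mul_assoc, mul_inv_cancel_right, mul_inv_rev, inv_eq_of_mul_eq_one_right h.mul_self₁,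
      ← h.mul_comm₀₂, inv_eq_of_mul_eq_one_right h.mul_self₀₂]
  have h1 : ρ₁ (w 0) = w 0 := h.apply₁ 0
  exact (conj_apply_orbitPath hσ i).trans (congrArg _ h1)

theorem petrie_apply₀ (i : ℤ) : (ρ₀ * ρ₂) (ζ i) = ζ (1 - i) := by
  have hσ : ρ₀ * ρ₂ * (ρ₂ * ρ₀ * ρ₁) * (ρ₀ * ρ₂)⁻¹ = (ρ₂ * ρ₀ * ρ₁)⁻¹ := by
    rw [← h.mul_comm₀₂, ← mul_assoc, h.mul_self₀₂, one_mul, mul_inv_rev _ ρ₁,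
      inv_eq_of_mul_eq_one_right h.mul_self₁]
  have h1 : (ρ₀ * ρ₂) (w 0) = ζ 1 := by
    rw [h.petrie_one]
    simp [h.apply₂_zero, h.apply₀]
  rw [conj_apply_orbitPath hσ, h1, zpow_orbitPath, neg_add_eq_sub]

theorem apply₂_apply₂ (x : E3) : ρ₂ (ρ₂ x) = x :=
  DFunLike.congr_fun h.mul_self₂ x

theorem petrieDual : P.petrieDual.FlagGenerators ζ (ρ₀ * ρ₂) ρ₁ ρ₂ where
  isPrepolyhedron := h.isPrepolyhedron.petrieDual
  tracks := h.petrie_tracks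
  mem₀ := linearSymmetryGroup_le_petrieDual (mul_mem h.mem₀ h.mem₂)
  mem₁ := linearSymmetryGroup_le_petrieDual h.mem₁
  mem₂ := linearSymmetryGroup_le_petrieDual h.mem₂
  apply₀ := h.petrie_apply₀
  apply₁ := h.petrie_apply₁
  apply₂_zero := h.apply₂_zero
  apply₂_one := by rw [h.petrie_one, h.apply₂_one]
  apply₂_two_ne := by
    rw [h.petrie_two, h.apply₂_apply₂]
    exact h.apply₂_two_ne.symm
  eq_or_eq a ha h0 h1 := h.petrie_eq_or_eq ha h0 (h1.trans h.petrie_one)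
  exists_apply_zero x hx := by
    obtain ⟨L, hL, hLx⟩ := h.exists_apply_zero x hx
    refine ⟨L, (Subgroup.closure_le _).2 ?_ hL, hLx⟩
    have subset := Subgroup.subset_closure (k := {ρ₀ * ρ₂, ρ₁, ρ₂})
    rintro M (rfl | rfl | rfl)
    · exact (mul_mem_cancel_right (subset (by simp))).1 (subset (.inl rfl))
    · exact subset (by simp)
    · exact subset (by simp)
  exists_apply_one y hy := by
    rw [h.petrie_one]
    exact h.exists_apply_one y hy
  fixed n h0 h1 h2 := h.fixed n (by simpa [h2] using h0) h1 h2
  span n h0 h1 h2 := by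
    rw [h.petrie_one] at h1
    rw [h.petrie_two] at h2
    refine (map_eq_zero_iff _ ρ₂.injective).1 (h.span _ ?_ ?_ ?_)
    · rwa [← h.apply₂_zero, ρ₂.inner_map_map]
    · rwa [← h.apply₂_one, ρ₂.inner_map_map]
    · rwa [← ρ₂.inner_map_map, h.apply₂_apply₂]

theorem centredRegular_petrieDual (hσ : ∀ n, ρ₂ (ρ₀ (ρ₁ n)) = n → n = 0) :
    P.petrieDual.CentredRegular ζ ‖w 0‖ := by
  obtain ⟨p, hp⟩ := h.petrieDual.tracks.1
  exact h.petrieDual.centredRegular (by linarith [hp.three_le]) (.inr rfl)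
    (sum_orbitPath_eq_neg ((hp.apply_eq_iff p 0).2 (by simp)) hσ)

end FlagGenerators

end Skeletal

/-! ### Figures given by vertices and inner products -/

namespace Skeletal

variable {V : Set E3} {c : ℝ} {p : ℕ} {a : ℤ → E3}

theorem mk_mem_ofVertices_edges {x y : E3} :
    s(x, y) ∈ (ofVertices V c p).edges ↔ x ∈ V ∧ y ∈ V ∧ x ≠ y ∧ inner ℝ x y = c := by
  constructor
  · rintro ⟨x', hx, y', hy, hne, hc, h⟩
    rcases Sym2.eq_iff.1 h with ⟨rfl, rfl⟩ | ⟨rfl, rfl⟩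
    exacts [⟨hx, hy, hne, hc⟩, ⟨hy, hx, hne.symm, (real_inner_comm _ _).trans hc⟩]
  · rintro ⟨hx, hy, hne, hc⟩
    exact ⟨x, hx, y, hy, hne, hc, rfl⟩

theorem isPrepolyhedron_ofVertices (hV : V.Finite) : (ofVertices V c p).IsPrepolyhedron where
  finite_verts := hV
  edge_spec := by
    rintro _ ⟨x, hx, y, hy, hne, -, rfl⟩
    refine ⟨hne, fun z hz => ?_⟩
    rcases Sym2.mem_iff.1 hz with rfl | rfl
    exacts [hx, hy]
  face_spec _ hF := ⟨⟨p, hF.1⟩, hF.2.1⟩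

theorem ofVertices_tracks_iff : (ofVertices V c p).Tracks a ↔
    IsTracing p a ∧ (∀ i, s(a i, a (i + 1)) ∈ (ofVertices V c p).edges) ∧
      Coplanar ℝ (Set.range a) := by
  rw [← polygonVertices_traceEdges a]
  constructor
  · rintro ⟨⟨q, hq⟩, hpoly, hedges, hplanar⟩
    obtain ⟨b, hb, hE⟩ := isPolygon_iff_exists_isTracing.1 hpoly
    refine ⟨?_, fun i => hedges _ (mk_mem_traceEdges rfl), hplanar⟩
    obtain ⟨k, rfl | rfl⟩ := hb.eq_shift_or_reflect hq hE.symm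
    exacts [hb.shift k, hb.reflect k]
  · rintro ⟨ha, hedges, hplanar⟩
    refine ⟨⟨p, ha⟩, isPolygon_iff_exists_isTracing.2 ⟨a, ha, rfl⟩, ?_, hplanar⟩
    rintro _ ⟨i, rfl⟩
    exact hedges i

theorem stable_ofVertices {L : E3 ≃ₗᵢ[ℝ] E3} (hL : ∀ x ∈ V, L x ∈ V) :
    (ofVertices V c p).Stable L := by
  have hedges : ∀ x y, s(x, y) ∈ (ofVertices V c p).edges →
      s(L x, L y) ∈ (ofVertices V c p).edges := fun x y hxy => by
    rw [mk_mem_ofVertices_edges, L.inner_map_map] at *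
    exact ⟨hL _ hxy.1, hL _ hxy.2.1, L.injective.ne hxy.2.2.1, hxy.2.2.2⟩
  refine ⟨hL, fun e => e.ind hedges, fun F hF => ?_⟩
  obtain ⟨a, ha, rfl⟩ := isPolygon_iff_exists_isTracing.1 hF.1
  obtain ⟨-, hadj, hplanar⟩ := ofVertices_tracks_iff.1 ⟨⟨p, ha⟩, hF⟩
  rw [image_traceEdges]
  refine (ofVertices_tracks_iff.2 ⟨ha.comp L.injective.injOn, fun i => hedges _ _ (hadj i), ?_⟩).2
  rw [coplanar_iff_exists_inner] at hplanar ⊢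
  obtain ⟨n, hn, k, hk⟩ := hplanar
  refine ⟨L n, by simpa using hn, k, ?_⟩
  rintro _ ⟨i, rfl⟩
  exact (L.inner_map_map _ _).trans (hk _ ⟨i, rfl⟩)

theorem mem_linearSymmetryGroup_ofVertices {L : E3 ≃ₗᵢ[ℝ] E3} (hL : ∀ x ∈ V, L x ∈ V)
    (hL' : ∀ x ∈ V, L.symm x ∈ V) : L ∈ (ofVertices V c p).linearSymmetryGroup :=
  map_eq_of_stable (f := L.toEquiv) (stable_ofVertices hL) (stable_ofVertices hL')

end Skeletal

/-! ### Reflections -/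

/-- The reflection in the plane through `0` with normal vector `m`. -/
noncomputable def mirrorReflection (m : E3) : E3 ≃ₗᵢ[ℝ] E3 :=
  (ℝ ∙ m)ᗮ.reflection

theorem mirrorReflection_apply (m x : E3) :
    mirrorReflection m x = x - (2 * (inner ℝ m x / inner ℝ m m)) • m := by
  rw [mirrorReflection, Submodule.reflection_orthogonal_apply,
    Submodule.reflection_singleton_apply, neg_sub, real_inner_self_eq_norm_sq, mul_smul, two_smul,
    two_smul]
  rfl

theorem mirrorReflection_mirrorReflection (m x : E3) :
    mirrorReflection m (mirrorReflection m x) = x :=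
  Submodule.reflection_reflection _ x

theorem mirrorReflection_eq_of_smul_sub_eq {m x y : E3} (hm : m ≠ 0)
    (h : (inner ℝ m m : ℝ) • (x - y) = (2 * inner ℝ m x : ℝ) • m) : mirrorReflection m x = y := by
  rw [mirrorReflection_apply, sub_eq_iff_eq_add, ← sub_eq_iff_eq_add', mul_div_assoc',
    div_eq_inv_mul, mul_smul, ← h, inv_smul_smul₀ (inner_self_ne_zero.2 hm)]

theorem mirrorReflection_eq_self_iff {m x : E3} : mirrorReflection m x = x ↔ inner ℝ m x = 0 := by
  rw [mirrorReflection, Submodule.reflection_eq_self_iff,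
    Submodule.mem_orthogonal_singleton_iff_inner_right]

theorem linearIndependent_of_forall_inner {m : Fin 3 → E3}
    (h : ∀ n : E3, (∀ i, inner ℝ (m i) n = 0) → n = 0) : LinearIndependent ℝ m := by
  have hspan : ⊤ ≤ Submodule.span ℝ (Set.range m) := by
    rw [top_le_iff, ← Submodule.orthogonal_eq_bot_iff, Submodule.eq_bot_iff]
    exact fun n hn => h n fun i => hn _ (Submodule.subset_span ⟨i, rfl⟩)
  exact linearIndependent_of_top_le_span_of_card_eq_finrank hspan (by simp)

theorem eq_zero_of_mirrorReflection_mirrorReflection_mirrorReflection_eq {m : Fin 3 → E3} {n : E3}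
    (hm : ∀ n : E3, (∀ i, inner ℝ (m i) n = 0) → n = 0)
    (h : mirrorReflection (m 2) (mirrorReflection (m 0) (mirrorReflection (m 1) n)) = n) :
    n = 0 := by
  replace h : mirrorReflection (m 0) (mirrorReflection (m 1) n) = mirrorReflection (m 2) n := by
    rw [← (mirrorReflection (m 2)).injective.eq_iff, h, mirrorReflection_mirrorReflection]
  set n' := mirrorReflection (m 1) n with hn'
  rw [mirrorReflection_apply, mirrorReflection_apply (m 2)] at h
  rw [mirrorReflection_apply] at hn'
  have hzero := Fintype.linearIndependent_iff.1 (linearIndependent_of_forall_inner hm)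
    ![2 * (inner ℝ (m 0) n' / inner ℝ (m 0) (m 0)), 2 * (inner ℝ (m 1) n / inner ℝ (m 1) (m 1)),
      -(2 * (inner ℝ (m 2) n / inner ℝ (m 2) (m 2)))]
    (by
      simp only [Fin.sum_univ_three, Matrix.cons_val]
      linear_combination (norm := module) hn' - h)
  have hn : n' = n := by
    have h₁ := hzero 1
    simp only [Matrix.cons_val] at h₁
    rw [hn', h₁, zero_smul, sub_zero]
  rw [hn] at hzero
  refine hm n fun i => ?_
  rw [← mirrorReflection_eq_self_iff, mirrorReflection_apply]
  have hi := hzero i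
  fin_cases i <;> simpa using hi

/-! ### Vectors with golden coordinates -/

open Matrix

/-- The ring `ℤ[φ]` with `φ² = 1 + φ`. Inner products of the vertices of the classical polyhedra lie
in it, and equality in it is decidable. -/
abbrev GoldenInt : Type := QuadraticAlgebra ℤ 1 1

namespace GoldenInt

/-- The embedding of `ℤ[φ]` in the reals. -/
noncomputable def toReal : GoldenInt →ₐ[ℤ] ℝ :=
  QuadraticAlgebra.lift ⟨Real.goldenRatio, by
    rw [← sq, Real.goldenRatio_sq, one_smul, one_smul, add_comm]⟩

theorem toReal_apply (x : GoldenInt) : toReal x = x.re + x.im * Real.goldenRatio := by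
  simp [toReal]

theorem toReal_injective : Function.Injective toReal := by
  rw [injective_iff_map_eq_zero]
  intro x hx
  rw [toReal_apply] at hx
  have him : x.im = 0 := by
    by_contra him
    refine (Real.goldenRatio_irrational.intCast_mul him).ne_int (-x.re) ?_
    push_cast
    linarith
  refine QuadraticAlgebra.ext ?_ him
  simpa [him] using hx

end GoldenInt

open GoldenInt

/-- Vectors with coordinates in `ℤ[φ]`. -/
abbrev GoldenVec : Type := Fin 3 → GoldenInt

namespace GoldenVec

variable {x y z : GoldenVec}

/-- The embedding of the vectors with coordinates in `ℤ[φ]` in Euclidean space. -/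
noncomputable def toE3 : GoldenVec →+ E3 where
  toFun x := WithLp.toLp 2 fun i => toReal (x i)
  map_zero' := by ext; simp
  map_add' x y := by ext; simp

theorem toE3_apply (x : GoldenVec) (i : Fin 3) : toE3 x i = toReal (x i) := rfl

theorem toE3_injective : Function.Injective toE3 := fun _ _ h =>
  funext fun i => toReal_injective (congrArg (fun v : E3 => v i) h)

theorem toE3_smul (r : GoldenInt) (x : GoldenVec) : toE3 (r • x) = toReal r • toE3 x := by
  ext i
  simp [toE3_apply]

theorem inner_toE3 (x y : GoldenVec) : inner ℝ (toE3 x) (toE3 y) = toReal (x ⬝ᵥ y) := by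
  simp [PiLp.inner_apply, dotProduct, toE3_apply, mul_comm]

theorem exists_orthogonal_iff : (∃ n : E3, n ≠ 0 ∧ inner ℝ (toE3 x) n = 0 ∧
    inner ℝ (toE3 y) n = 0 ∧ inner ℝ (toE3 z) n = 0) ↔ x ⬝ᵥ y ⨯₃ z = 0 := by
  have hdet : toReal (x ⬝ᵥ y ⨯₃ z) = ((Matrix.of ![x, y, z]).map toReal).det := by
    rw [triple_product_eq_det]
    exact RingHom.map_det (toReal : GoldenInt →+* ℝ) _
  rw [← map_eq_zero_iff _ toReal_injective, hdet, ← Matrix.exists_mulVec_eq_zero_iff]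
  have hmul (n : E3) : ((Matrix.of ![x, y, z]).map toReal) *ᵥ n.ofLp =
      ![inner ℝ (toE3 x) n, inner ℝ (toE3 y) n, inner ℝ (toE3 z) n] := by
    ext i
    fin_cases i <;> simp [mulVec, dotProduct, PiLp.inner_apply, toE3_apply, mul_comm]
  constructor
  · rintro ⟨n, hn, hx, hy, hz⟩
    exact ⟨n.ofLp, fun h => hn (PiLp.ext (congrFun h)), by simp [hmul, hx, hy, hz]⟩
  · rintro ⟨n, hn, h⟩
    have h' := (hmul (WithLp.toLp 2 n)).symm.trans h
    exact ⟨WithLp.toLp 2 n, fun e => hn ((WithLp.toLp_eq_zero 2).1 e), congrFun h' 0, congrFun h' 1,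
      congrFun h' 2⟩

/-- The vector `m` is normal to a plane through `0` in which `x` and `y` are mirror images. -/
def Reflects (m x y : GoldenVec) : Prop :=
  (m ⬝ᵥ m) • (x - y) = (2 * m ⬝ᵥ x) • m

instance (m x y : GoldenVec) : Decidable (Reflects m x y) :=
  inferInstanceAs (Decidable (_ = _))

theorem Reflects.mirrorReflection_eq {m : GoldenVec} (hm : m ≠ 0) (h : Reflects m x y) :
    mirrorReflection (toE3 m) (toE3 x) = toE3 y := by
  refine mirrorReflection_eq_of_smul_sub_eq ((map_ne_zero_iff _ toE3_injective).2 hm) ?_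
  simpa only [inner_toE3, toE3_smul, map_sub, map_mul, map_ofNat] using congrArg toE3 h

/-- The points `x`, `y`, `z`, `u` lie in a plane. -/
def IsCoplanar (x y z u : GoldenVec) : Prop :=
  (y - x) ⬝ᵥ (z - x) ⨯₃ (u - x) = 0

instance (x y z u : GoldenVec) : Decidable (IsCoplanar x y z u) :=
  inferInstanceAs (Decidable (_ = _))

theorem isCoplanar_of_coplanar {S : Set E3} (hS : Coplanar ℝ S) {u : GoldenVec} (hx : toE3 x ∈ S)
    (hy : toE3 y ∈ S) (hz : toE3 z ∈ S) (hu : toE3 u ∈ S) : IsCoplanar x y z u := by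
  obtain ⟨n, hn, k, hk⟩ := coplanar_iff_exists_inner.1 hS
  refine exists_orthogonal_iff.1 ⟨n, hn, ?_⟩
  simp only [map_sub, real_inner_comm n, inner_sub_right, hk _ hx, hk _ hy, hk _ hz, hk _ hu,
    sub_self, and_self]

theorem coplanar_range_toE3 {ι : Type*} {v : ι → GoldenVec} {n : GoldenVec} (hn : n ≠ 0)
    {k : GoldenInt} (h : ∀ i, n ⬝ᵥ v i = k) : Coplanar ℝ (Set.range fun i => toE3 (v i)) := by
  refine coplanar_iff_exists_inner.2 ⟨toE3 n, (map_ne_zero_iff _ toE3_injective).2 hn, toReal k, ?_⟩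
  rintro _ ⟨i, rfl⟩
  rw [inner_toE3, h]

end GoldenVec

/-! ### Regular polyhedra from finite computations -/

open GoldenVec Skeletal

/-- Normal vectors of the mirrors of the reflections that generate the symmetry group of a
polyhedron with vertices `V i`: the first two preserve the face with vertices `V (f i)`, and the
last one maps it to the other face at the edge from `V (f 0)` to `V (f 1)`, with next vertex
`V t`. -/
def mirror {m p : ℕ} (V : Fin m → GoldenVec) (f : ZMod p → Fin m) (t : Fin m) :
    Fin 3 → GoldenVec :=
  ![V (f 0) - V (f 1), V (f 1) - V (f (-1)), V (f 2) - V t]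

/-- The computations from which the figure with vertices `V i`, inner product `c` along edges and
planar `p`-gonal faces is recognised as a regular polyhedron: `f` is a face, `t` is as in `mirror`,
and the increasing function `depth` witnesses that the reflections in the mirrors permute the
vertices transitively. -/
structure GoldenModel {m : ℕ} (V : Fin m → GoldenVec) (c : GoldenInt) (p : ℕ) [NeZero p]
    (f : ZMod p → Fin m) (t : Fin m) (depth : Fin m → ℕ) : Prop where
  three_le : 3 ≤ p := by decide +kernel
  face_injective : ∀ i j, V (f i) = V (f j) → i = j := by decide +kernel
  face_edge : ∀ i, V (f i) ⬝ᵥ V (f (i + 1)) = c := by decide +kernel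
  face_sum_ne_zero : ∑ i, V (f i) ≠ 0 := by decide +kernel
  face_coplanar : ∀ i, (∑ j, V (f j)) ⬝ᵥ V (f i) = (∑ j, V (f j)) ⬝ᵥ V (f 0) := by decide +kernel
  face_span : V (f 0) ⬝ᵥ V (f 1) ⨯₃ V (f 2) ≠ 0 := by decide +kernel
  face_balanced :
    ∑ j ∈ Finset.range p, V (f (2 * j)) = ∑ j ∈ Finset.range p, V (f (2 * j + 1)) := by
    decide +kernel
  mirror_span : mirror V f t 0 ⬝ᵥ mirror V f t 1 ⨯₃ mirror V f t 2 ≠ 0 := by decide +kernel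
  exists_reflects : ∀ k i, ∃ j, Reflects (mirror V f t k) (V i) (V j) := by decide +kernel
  reflects₀ : ∀ i, Reflects (mirror V f t 0) (V (f i)) (V (f (1 - i))) := by decide +kernel
  reflects₁ : ∀ i, Reflects (mirror V f t 1) (V (f i)) (V (f (-i))) := by decide +kernel
  reflects₂_zero : Reflects (mirror V f t 2) (V (f 0)) (V (f 0)) := by decide +kernel
  reflects₂_one : Reflects (mirror V f t 2) (V (f 1)) (V (f 1)) := by decide +kernel
  reflects₂_two : Reflects (mirror V f t 2) (V (f 2)) (V t) := by decide +kernel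
  eq_or_eq_of_isCoplanar : ∀ z u, V (f 1) ⬝ᵥ V z = c → V (f 0) ⬝ᵥ V u = c → z ≠ f 0 → u ≠ f 1 →
    IsCoplanar (V (f 0)) (V (f 1)) (V z) (V u) → (p = 3 ↔ V u = V z) → z = f 2 ∨ z = t := by
    decide +kernel
  face_unique : ∀ i y, V (f (i + 2)) ⬝ᵥ V y = c →
    IsCoplanar (V (f i)) (V (f (i + 1))) (V (f (i + 2))) (V y) → y = f (i + 1) ∨ y = f (i + 3) := by
    decide +kernel
  exists_depth_lt : ∀ i, i = f 0 ∨
    ∃ j, depth j < depth i ∧ ∃ k, Reflects (mirror V f t k) (V j) (V i) := by decide +kernel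
  exists_depth_lt_of_edge : ∀ i, V (f 0) ⬝ᵥ V i = c → i = f 1 ∨
    ∃ j, depth j < depth i ∧ V (f 0) ⬝ᵥ V j = c ∧
      ∃ k, k ≠ 0 ∧ Reflects (mirror V f t k) (V j) (V i) := by decide +kernel

namespace GoldenModel

variable {m p : ℕ} [NeZero p] {V : Fin m → GoldenVec} {c : GoldenInt} {f : ZMod p → Fin m}
  {t : Fin m} {depth : Fin m → ℕ}

/-- The tracing of the base face. -/
noncomputable def trace (V : Fin m → GoldenVec) (f : ZMod p → Fin m) (i : ℤ) : E3 :=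
  toE3 (V (f i))

/-- The reflections in the mirrors of a model. -/
noncomputable def generator (V : Fin m → GoldenVec) (f : ZMod p → Fin m) (t : Fin m) (k : Fin 3) :
    E3 ≃ₗᵢ[ℝ] E3 :=
  mirrorReflection (toE3 (mirror V f t k))

/-- The figure described by a model. -/
noncomputable def figure (V : Fin m → GoldenVec) (c : GoldenInt) (p : ℕ) : Skeletal :=
  .ofVertices (Set.range fun i => toE3 (V i)) (toReal c) p

variable (h : GoldenModel V c p f t depth)
include h

theorem isTracing : IsTracing p (trace V f) :=
  isTracing_intCast h.three_le fun i j hij => h.face_injective i j (toE3_injective hij)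

theorem tracks : (figure V c p).Tracks (trace V f) := by
  refine ofVertices_tracks_iff.2 ⟨h.isTracing, fun i => ?_, ?_⟩
  · have hne := h.isTracing.apply_ne_apply_add i one_pos (by norm_num)
    refine mk_mem_ofVertices_edges.2 ⟨⟨_, rfl⟩, ⟨_, rfl⟩, hne, ?_⟩
    rw [trace, trace, inner_toE3, Int.cast_add, Int.cast_one, h.face_edge]
  · exact coplanar_range_toE3 h.face_sum_ne_zero fun i => h.face_coplanar i

theorem mirror_ne_zero (k : Fin 3) : mirror V f t k ≠ 0 := by
  intro h0
  refine h.mirror_span ?_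
  fin_cases k <;> simp_all

theorem generator_eq {k : Fin 3} {x y : GoldenVec} (hk : Reflects (mirror V f t k) x y) :
    generator V f t k (toE3 x) = toE3 y :=
  hk.mirrorReflection_eq (h.mirror_ne_zero k)

theorem generator_mem (k : Fin 3) : generator V f t k ∈ (figure V c p).linearSymmetryGroup := by
  have hmaps : ∀ x ∈ Set.range fun i => toE3 (V i),
      generator V f t k x ∈ Set.range fun i => toE3 (V i) := by
    rintro _ ⟨i, rfl⟩
    obtain ⟨j, hj⟩ := h.exists_reflects k i
    exact ⟨j, (h.generator_eq hj).symm⟩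
  refine mem_linearSymmetryGroup_ofVertices hmaps ?_
  rwa [generator, mirrorReflection, Submodule.reflection_symm]

theorem exists_apply_zero {x : E3} (hx : x ∈ (figure V c p).verts) :
    ∃ L ∈ Subgroup.closure {generator V f t 0, generator V f t 1, generator V f t 2},
      L (trace V f 0) = x := by
  obtain ⟨i, rfl⟩ := hx
  induction hd : depth i using Nat.strong_induction_on generalizing i with
  | _ d ih =>
  subst hd
  obtain rfl | ⟨j, hj, k, hk⟩ := h.exists_depth_lt i
  · exact ⟨1, one_mem _, by simp [trace]⟩
  · obtain ⟨L, hL, hj⟩ := ih _ hj j rfl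
    refine ⟨generator V f t k * L, mul_mem (Subgroup.subset_closure ?_) hL, ?_⟩
    · fin_cases k <;> simp
    · exact (congrArg _ hj).trans (h.generator_eq hk)

theorem exists_apply_one {y : E3} (hy : s(trace V f 0, y) ∈ (figure V c p).edges) :
    ∃ L ∈ Subgroup.closure {generator V f t 1, generator V f t 2}, L (trace V f 1) = y := by
  obtain ⟨-, ⟨i, rfl⟩, -, hi⟩ := mk_mem_ofVertices_edges.1 hy
  rw [trace, inner_toE3, toReal_injective.eq_iff, Int.cast_zero] at hi
  clear hy
  induction hd : depth i using Nat.strong_induction_on generalizing i with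
  | _ d ih =>
  subst hd
  obtain rfl | ⟨j, hj, hij, k, hk0, hk⟩ := h.exists_depth_lt_of_edge i hi
  · exact ⟨1, one_mem _, by simp [trace]⟩
  · obtain ⟨L, hL, hj⟩ := ih _ hj j hij rfl
    refine ⟨generator V f t k * L, mul_mem (Subgroup.subset_closure ?_) hL, ?_⟩
    · fin_cases k <;> simp_all
    · exact (congrArg _ hj).trans (h.generator_eq hk)

-- Planarity determines a face, vertex by vertex, from its first three vertices.
theorem eq_trace_of_tracks {a : ℤ → E3} (ha : (figure V c p).Tracks a) (h0 : a 0 = trace V f 0)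
    (h1 : a 1 = trace V f 1) (h2 : a 2 = trace V f 2) : a = trace V f := by
  obtain ⟨htr, hedge, hplanar⟩ := ofVertices_tracks_iff.1 ha
  have next (i : ℤ) (e0 : a i = trace V f i) (e1 : a (i + 1) = trace V f (i + 1))
      (e2 : a (i + 2) = trace V f (i + 2)) : a (i + 3) = trace V f (i + 3) := by
    have hi := hedge (i + 2)
    rw [show i + 2 + 1 = i + 3 by ring] at hi
    obtain ⟨-, ⟨y, hy⟩, -, hin⟩ := mk_mem_ofVertices_edges.1 hi
    have hne := ha.apply_ne_apply_add_two (i + 1)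
    rw [show i + 1 + 2 = i + 3 by ring, e1] at hne
    rw [e2, ← hy, trace, inner_toE3, toReal_injective.eq_iff, Int.cast_add, Int.cast_two] at hin
    have hcop := isCoplanar_of_coplanar hplanar ⟨i, e0⟩ ⟨i + 1, e1⟩ ⟨i + 2, e2⟩ ⟨i + 3, hy.symm⟩
    simp only [Int.cast_add, Int.cast_one, Int.cast_two] at hcop
    rcases h.face_unique i y hin hcop with rfl | rfl
    · exact absurd (by simp [trace, ← hy]) hne
    · simp [trace, ← hy]
  have hnat (i : ℕ) : a i = trace V f i ∧ a (i + 1) = trace V f (i + 1) ∧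
      a (i + 2) = trace V f (i + 2) := by
    induction i with
    | zero => exact ⟨h0, h1, h2⟩
    | succ i ih =>
      have e3 := next i ih.1 ih.2.1 ih.2.2
      push_cast
      rw [show (i : ℤ) + 1 + 1 = i + 2 by ring, show (i : ℤ) + 1 + 2 = i + 3 by ring]
      exact ⟨ih.2.1, ih.2.2, e3⟩
  obtain ⟨v, -, rfl⟩ := htr.exists_zmod
  funext j
  simpa [trace] using (hnat (j : ZMod p).val).1

theorem apply_two_eq {a : ℤ → E3} (ha : (figure V c p).Tracks a) (h0 : a 0 = trace V f 0)
    (h1 : a 1 = trace V f 1) : a 2 = trace V f 2 ∨ a 2 = toE3 (V t) := by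
  obtain ⟨htr, hedge, hplanar⟩ := ofVertices_tracks_iff.1 ha
  obtain ⟨-, ⟨z, hz⟩, -, hz'⟩ := mk_mem_ofVertices_edges.1 (hedge 1)
  obtain ⟨⟨u, hu⟩, -, -, hu'⟩ := mk_mem_ofVertices_edges.1 (hedge (-1))
  rw [one_add_one_eq_two] at hz hz'
  rw [neg_add_cancel] at hu'
  rw [h1, ← hz, trace, inner_toE3, toReal_injective.eq_iff, Int.cast_one] at hz'
  rw [h0, ← hu, trace, real_inner_comm, inner_toE3, toReal_injective.eq_iff, Int.cast_zero] at hu'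
  have hcop := isCoplanar_of_coplanar hplanar ⟨0, h0⟩ ⟨1, h1⟩ ⟨2, hz.symm⟩ ⟨-1, hu.symm⟩
  rw [Int.cast_zero, Int.cast_one] at hcop
  have hz0 : z ≠ f 0 := by
    rintro rfl
    exact ha.apply_ne_apply_add_two 0 (by simp [h0, ← hz, trace])
  have hu1 : u ≠ f 1 := by
    rintro rfl
    exact ha.apply_neg_one_ne_apply_one (by simp [h1, ← hu, trace])
  have hp : p = 3 ↔ V u = V z := by
    rw [← toE3_injective.eq_iff]
    refine .trans ?_ (hu.congr_left.trans hz.congr_right).symm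
    rw [htr.apply_eq_iff, show (-1 : ℤ) - 2 = -3 by norm_num, Int.dvd_neg]
    refine ⟨fun e => by simp [e], fun e => h.three_le.antisymm' ?_⟩
    exact_mod_cast Int.le_of_dvd (by norm_num) e
  rcases h.eq_or_eq_of_isCoplanar z u hz' hu' hz0 hu1 hcop hp with rfl | rfl
  · exact .inl (by simp [← hz, trace])
  · exact .inr hz.symm

theorem eq_or_eq {a : ℤ → E3} (ha : (figure V c p).Tracks a) (h0 : a 0 = trace V f 0)
    (h1 : a 1 = trace V f 1) :
    a = trace V f ∨ a = fun i => generator V f t 2 (trace V f i) := by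
  rcases h.apply_two_eq ha h0 h1 with h2 | h2
  · exact .inl (h.eq_trace_of_tracks ha h0 h1 h2)
  have hgen (x : E3) : generator V f t 2 (generator V f t 2 x) = x :=
    mirrorReflection_mirrorReflection _ x
  have hrefl := h.eq_trace_of_tracks (ha.map_mem (h.generator_mem 2))
    ((congrArg _ h0).trans (by simpa [trace] using h.generator_eq h.reflects₂_zero))
    ((congrArg _ h1).trans (by simpa [trace] using h.generator_eq h.reflects₂_one))
    (by
      rw [h2, ← h.generator_eq h.reflects₂_two, hgen]
      simp [trace])
  exact .inr (funext fun i => by rw [← hrefl, hgen])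

theorem eq_zero_of_inner_mirror_eq_zero (n : E3)
    (hn : ∀ k, inner ℝ (toE3 (mirror V f t k)) n = 0) : n = 0 := by
  by_contra hn0
  exact h.mirror_span (exists_orthogonal_iff.1 ⟨n, hn0, hn 0, hn 1, hn 2⟩)

theorem flagGenerators : (figure V c p).FlagGenerators (trace V f) (generator V f t 0)
    (generator V f t 1) (generator V f t 2) where
  isPrepolyhedron := isPrepolyhedron_ofVertices (Set.finite_range _)
  tracks := h.tracks
  mem₀ := h.generator_mem 0
  mem₁ := h.generator_mem 1
  mem₂ := h.generator_mem 2
  apply₀ i := by simpa [trace] using h.generator_eq (h.reflects₀ i)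
  apply₁ i := by simpa [trace] using h.generator_eq (h.reflects₁ i)
  apply₂_zero := by simpa [trace] using h.generator_eq h.reflects₂_zero
  apply₂_one := by simpa [trace] using h.generator_eq h.reflects₂_one
  apply₂_two_ne e := by
    have e' : toE3 (V t) = toE3 (V (f 2)) := by
      rw [← h.generator_eq h.reflects₂_two]
      simpa [trace] using e
    exact h.mirror_ne_zero 2 (sub_eq_zero.2 (toE3_injective e').symm)
  eq_or_eq _ := h.eq_or_eq
  exists_apply_zero _ := h.exists_apply_zero
  exists_apply_one _ := h.exists_apply_one
  fixed n h₀ h₁ h₂ := h.eq_zero_of_inner_mirror_eq_zero n fun k => by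
    rw [← mirrorReflection_eq_self_iff]
    fin_cases k
    exacts [h₀, h₁, h₂]
  span n h₀ h₁ h₂ := by
    by_contra hn
    rw [real_inner_comm, trace] at h₀ h₁ h₂
    exact h.face_span (exists_orthogonal_iff.1
      ⟨n, hn, by simpa using h₀, by simpa using h₁, by simpa using h₂⟩)

theorem centredRegular : (figure V c p).CentredRegular (trace V f) ‖trace V f 0‖ := by
  refine h.flagGenerators.centredRegular (N := p) (NeZero.pos p) (.inl rfl) ?_
  simpa [trace] using congrArg toE3 h.face_balanced

theorem centredRegular_petrieDual : (figure V c p).petrieDual.CentredRegular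
    (orbitPath (generator V f t 2 * generator V f t 0 * generator V f t 1) (trace V f 0))
    ‖trace V f 0‖ :=
  h.flagGenerators.centredRegular_petrieDual fun _ =>
    eq_zero_of_mirrorReflection_mirrorReflection_mirrorReflection_eq
      (m := fun k => toE3 (mirror V f t k))
      h.eq_zero_of_inner_mirror_eq_zero

end GoldenModel

/-! ### The classical polyhedra -/

open scoped QuadraticAlgebra

theorem GoldenInt.toReal_omega : toReal ω = Real.goldenRatio := by simp [toReal_apply]

theorem GoldenInt.toReal_omega_sub_one : toReal (ω - 1) = Real.goldenRatio⁻¹ := by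
  rw [map_sub, map_one, toReal_omega]
  exact eq_inv_of_mul_eq_one_left (by linear_combination Real.goldenRatio_sq)

theorem GoldenInt.toReal_two_mul_omega_sub_one : toReal (2 * ω - 1) = √5 := by
  rw [map_sub, map_mul, map_ofNat, map_one, toReal_omega, Real.goldenRatio]
  ring

theorem GoldenVec.toE3_cons (a b c : GoldenInt) :
    toE3 ![a, b, c] = !₂[toReal a, toReal b, toReal c] := by
  ext i
  fin_cases i <;> rfl

/-- The vertices of the tetrahedron. -/
def tetrahedronVec : Fin 4 → GoldenVec :=
  ![![1, 1, 1], ![1, -1, -1], ![-1, 1, -1], ![-1, -1, 1]]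

/-- The vertices of the octahedron. -/
def octahedronVec : Fin 6 → GoldenVec :=
  ![![1, 0, 0], ![-1, 0, 0], ![0, 1, 0], ![0, -1, 0], ![0, 0, 1], ![0, 0, -1]]

/-- The vertices of the cube. -/
def cubeVec : Fin 8 → GoldenVec :=
  ![![1, 1, 1], ![1, 1, -1], ![1, -1, 1], ![1, -1, -1],
    ![-1, 1, 1], ![-1, 1, -1], ![-1, -1, 1], ![-1, -1, -1]]

/-- The vectors `(0, ±a, ±b)` and their cyclic shifts. -/
def cyclicVec (a b : GoldenInt) : Fin 12 → GoldenVec :=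
  ![![0, a, b], ![b, 0, a], ![a, b, 0], ![0, a, -b], ![-b, 0, a], ![a, -b, 0],
    ![0, -a, b], ![b, 0, -a], ![-a, b, 0], ![0, -a, -b], ![-b, 0, -a], ![-a, -b, 0]]

/-- The vertices of the icosahedron. -/
def icosahedronVec : Fin 12 → GoldenVec :=
  cyclicVec 1 ω

/-- The vertices of the dodecahedron. -/
def dodecahedronVec : Fin 20 → GoldenVec :=
  Fin.append cubeVec (cyclicVec (ω - 1) ω)

theorem eq_cons_iff {x : E3} {a b c : ℝ} : x = !₂[a, b, c] ↔ x 0 = a ∧ x 1 = b ∧ x 2 = c := by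
  constructor
  · rintro rfl
    simp
  · rintro ⟨rfl, rfl, rfl⟩
    ext i
    fin_cases i <;> rfl

theorem range_octahedronVec : (Set.range fun i => toE3 (octahedronVec i)) = octahedronVerts := by
  ext x
  simp [octahedronVec, octahedronVerts, Fin.exists_fin_succ, toE3_cons, or_and_right, exists_or,
    eq_comm (b := x)]
  tauto

theorem range_cubeVec : (Set.range fun i => toE3 (cubeVec i)) = cubeVerts := by
  ext x
  simp [cubeVec, cubeVerts, Fin.exists_fin_succ, Fin.forall_fin_succ, toE3_cons, eq_comm (b := x),
    eq_cons_iff]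
  tauto

theorem range_tetrahedronVec :
    (Set.range fun i => toE3 (tetrahedronVec i)) = tetrahedronVerts := by
  ext x
  rw [tetrahedronVerts, Set.mem_ofPred_eq, ← range_cubeVec]
  constructor
  · rintro ⟨i, rfl⟩
    have hi : ∃ j, cubeVec j = tetrahedronVec i := by revert i; decide +kernel
    refine ⟨hi.imp fun _ => congrArg toE3, ?_⟩
    fin_cases i <;> simp [tetrahedronVec, toE3_cons]
  · rintro ⟨⟨j, rfl⟩, hx⟩
    simp only [toE3_apply, ← map_mul, ← map_one toReal, toReal_injective.eq_iff] at hx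
    have hj : ∃ i, tetrahedronVec i = cubeVec j := by revert j; decide +kernel
    exact hj.imp fun _ => congrArg toE3

theorem range_cyclicVec (a b : GoldenInt) :
    (Set.range fun i => toE3 (cyclicVec a b i)) = cyclicPoints (toReal a) (toReal b) := by
  ext x
  simp [cyclicVec, cyclicPoints, Fin.exists_fin_succ, toE3_cons, or_and_right, exists_or, or_assoc,
    eq_comm (b := x)]

theorem range_icosahedronVec :
    (Set.range fun i => toE3 (icosahedronVec i)) = icosahedronVerts := by
  simp only [icosahedronVec]
  rw [range_cyclicVec, map_one, toReal_omega, icosahedronVerts]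

theorem range_dodecahedronVec :
    (Set.range fun i => toE3 (dodecahedronVec i)) = dodecahedronVerts := by
  have happend : (fun i => toE3 (dodecahedronVec i)) ∘ finSumFinEquiv =
      Sum.elim (fun i => toE3 (cubeVec i)) fun i => toE3 (cyclicVec (ω - 1) ω i) := by
    funext i
    rcases i with i | i
    exacts [congrArg toE3 (Fin.append_left _ _ i), congrArg toE3 (Fin.append_right _ _ i)]
  rw [← EquivLike.range_comp _ (finSumFinEquiv (m := 8) (n := 12)), happend,
    Set.Sum.elim_range, range_cubeVec, range_cyclicVec, toReal_omega, toReal_omega_sub_one,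
    dodecahedronVerts]

theorem tetrahedronModel :
    GoldenModel tetrahedronVec (-1) 3 ![0, 1, 2] 3 ![0, 1, 2, 3] := {}

theorem octahedronModel :
    GoldenModel octahedronVec 0 3 ![0, 2, 4] 5 ![0, 5, 1, 4, 2, 3] := {}

theorem cubeModel : GoldenModel cubeVec 1 4 ![0, 1, 3, 2] 5 ![0, 1, 2, 3, 3, 4, 5, 6] := {}

theorem icosahedronModel :
    GoldenModel icosahedronVec ω 3 ![0, 1, 2] 6 ![0, 1, 2, 7, 5, 6, 3, 5, 4, 10, 9, 8] := {}

theorem dodecahedronModel : GoldenModel dodecahedronVec (2 * ω - 1) 5 ![0, 8, 4, 16, 10] 14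
    ![0, 5, 5, 9, 3, 7, 7, 12, 1, 3, 2, 8, 6, 8, 4, 6, 4, 11, 9, 10] := {}

theorem greatDodecahedronModel : GoldenModel icosahedronVec ω 5 ![0, 1, 5, 11, 4] 7
    ![0, 1, 4, 5, 2, 3, 5, 4, 3, 6, 5, 4] := {}

theorem smallStellatedDodecahedronModel : GoldenModel icosahedronVec (-ω) 5 ![0, 3, 1, 8, 7] 4
    ![0, 3, 5, 1, 4, 4, 5, 2, 4, 6, 3, 5] := {}

theorem greatIcosahedronModel : GoldenModel icosahedronVec (-ω) 3 ![0, 3, 5] 11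
    ![0, 6, 7, 1, 5, 2, 9, 5, 8, 10, 4, 3] := {}

theorem greatStellatedDodecahedronModel :
    GoldenModel dodecahedronVec (-(2 * ω - 1)) 5 ![0, 17, 4, 15, 18] 14
      ![0, 5, 5, 9, 3, 7, 7, 12, 11, 10, 9, 8, 8, 6, 4, 4, 6, 1, 2, 3] := {}

/-! ### The two families -/

theorem not_isBipartite_of_odd {α : Type*} {G : SimpleGraph α} {v : ℤ → α} {p : ℕ} (hp : Odd p)
    (hv : v p = v 0) (hadj : ∀ i, G.Adj (v i) (v (i + 1))) : ¬ G.IsBipartite := by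
  rintro ⟨(C : G.Coloring (ZMod 2))⟩
  have hstep : ∀ x y : ZMod 2, x ≠ y → y = x + 1 := by decide
  have hcolour : ∀ n : ℕ, C (v n) = C (v 0) + n := fun n => by
    induction n with
    | zero => simp
    | succ n ih =>
      rw [Nat.cast_succ, hstep _ _ (C.valid (hadj n)), ih, add_assoc, Nat.cast_succ]
  have hzero : (p : ZMod 2) = 0 := left_eq_add.1 (hv ▸ hcolour p)
  exact Nat.not_even_iff_odd.2 hp (ZMod.natCast_eq_zero_iff_even.1 hzero)

namespace GoldenModel

variable {m p : ℕ} [NeZero p] {V : Fin m → GoldenVec} {c : GoldenInt} {f : ZMod p → Fin m}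
  {t : Fin m} {depth : Fin m → ℕ} {Q : Skeletal} (h : GoldenModel V c p f t depth)
  (hQ : Q = figure V c p ∨ Q = (figure V c p).petrieDual)
include h hQ

theorem exists_centredRegular : ∃ w R, Q.CentredRegular w R ∧ w 0 = trace V f 0 := by
  obtain rfl | rfl := hQ
  exacts [⟨_, _, h.centredRegular, rfl⟩, ⟨_, _, h.centredRegular_petrieDual, orbitPath_zero⟩]

theorem not_isBipartite (hp : Odd p) : ¬ Q.edgeGraph.IsBipartite := by
  suffices ¬ (figure V c p).edgeGraph.IsBipartite by obtain rfl | rfl := hQ <;> exact this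
  refine not_isBipartite_of_odd (v := fun i => ⟨trace V f i, f i, rfl⟩) hp
    (by simp [trace]) fun i => ⟨?_, h.centredRegular.poly.mk_mem_edges h.tracks i⟩
  exact fun he => h.isTracing.apply_ne_apply_add i one_pos (by norm_num) (congrArg Subtype.val he)

end GoldenModel

theorem ClassicalPolyhedron.exists_goldenModel (k : ClassicalPolyhedron) (hk : k ≠ cube) :
    ∃ (m p : ℕ) (_ : NeZero p) (V : Fin m → GoldenVec) (c : GoldenInt) (f : ZMod p → Fin m)
      (t : Fin m) (depth : Fin m → ℕ), GoldenModel V c p f t depth ∧ Odd p ∧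
        k.toSkeletal = GoldenModel.figure V c p := by
  cases k
  case cube => exact (hk rfl).elim
  case tetrahedron => exact ⟨_, 3, _, _, _, _, _, _, tetrahedronModel, by decide,
    by simp only [GoldenModel.figure, toSkeletal, range_tetrahedronVec, map_neg, map_one]⟩
  case octahedron => exact ⟨_, 3, _, _, _, _, _, _, octahedronModel, by decide,
    by simp only [GoldenModel.figure, toSkeletal, range_octahedronVec, map_zero]⟩
  case icosahedron => exact ⟨_, 3, _, _, _, _, _, _, icosahedronModel, by decide,
    by simp only [GoldenModel.figure, toSkeletal, range_icosahedronVec, toReal_omega]⟩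
  case dodecahedron => exact ⟨_, 5, _, _, _, _, _, _, dodecahedronModel, by decide,
    by simp only [GoldenModel.figure, toSkeletal, range_dodecahedronVec,
      toReal_two_mul_omega_sub_one]⟩
  case greatDodecahedron => exact ⟨_, 5, _, _, _, _, _, _, greatDodecahedronModel, by decide,
    by simp only [GoldenModel.figure, toSkeletal, range_icosahedronVec, toReal_omega]⟩
  case smallStellatedDodecahedron =>
    exact ⟨_, 5, _, _, _, _, _, _, smallStellatedDodecahedronModel, by decide,
      by simp only [GoldenModel.figure, toSkeletal, range_icosahedronVec, map_neg, toReal_omega]⟩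
  case greatIcosahedron => exact ⟨_, 3, _, _, _, _, _, _, greatIcosahedronModel, by decide,
    by simp only [GoldenModel.figure, toSkeletal, range_icosahedronVec, map_neg, toReal_omega]⟩
  case greatStellatedDodecahedron =>
    exact ⟨_, 5, _, _, _, _, _, _, greatStellatedDodecahedronModel, by decide,
      by simp only [GoldenModel.figure, toSkeletal, range_dodecahedronVec, map_neg,
        toReal_two_mul_omega_sub_one]⟩

theorem ClassicalPolyhedron.toSkeletal_cube :
    cube.toSkeletal = GoldenModel.figure cubeVec 1 4 := by
  simp only [GoldenModel.figure, toSkeletal, range_cubeVec, map_one]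

theorem finsum_tetrahedronVerts : ∑ᶠ x ∈ tetrahedronVerts, x = 0 := by
  rw [← range_tetrahedronVec]
  exact tetrahedronModel.centredRegular.sum_eq

theorem coordProd_eq_neg_of_inner_eq_one {x y : E3} (hx : x ∈ cubeVerts) (hy : y ∈ cubeVerts)
    (h : inner ℝ x y = 1) : coordProd x = -coordProd y := by
  have hmul : ∀ i, x i * y i = 1 ∨ x i * y i = -1 := fun i => by
    rcases hx i with hx | hx <;> rcases hy i with hy | hy <;> simp [hx, hy]
  have hprod : coordProd x * coordProd y = -1 := by
    have hexpand : coordProd x * coordProd y = (x 0 * y 0) * (x 1 * y 1) * (x 2 * y 2) := by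
      simp only [coordProd]
      ring
    simp only [PiLp.inner_apply, Fin.sum_univ_three, RCLike.inner_apply, conj_trivial,
      mul_comm (y _)] at h
    rcases hmul 0 with h0 | h0 <;> rcases hmul 1 with h1 | h1 <;> rcases hmul 2 with h2 | h2 <;>
      rw [h0, h1, h2] at h hexpand <;> linarith
  rcases coordProd_eq_of_mem_cubeVerts hy with hy | hy <;> rw [hy] at hprod ⊢ <;> linarith

theorem coordProd_eq_neg_of_mk_mem_edges {Q : Skeletal}
    (hQ : Q = ClassicalPolyhedron.cube.toSkeletal ∨
      Q = ClassicalPolyhedron.cube.toSkeletal.petrieDual)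
    (x y : E3) (hxy : s(x, y) ∈ Q.edges) : coordProd x = -coordProd y := by
  have hmem : s(x, y) ∈ (ofVertices cubeVerts 1 4).edges := by
    rcases hQ with rfl | rfl <;> exact hxy
  obtain ⟨hx, hy, -, hc⟩ := mk_mem_ofVertices_edges.1 hmem
  exact coordProd_eq_neg_of_inner_eq_one hx hy hc

theorem indexTwoFamily_eq_cross {k : ClassicalPolyhedron} (hk : k ≠ .cube) :
    indexTwoFamily k = cross := by
  cases k
  case cube => exact (hk rfl).elim
  all_goals rfl

theorem lemma10 (k : ClassicalPolyhedron) (Q : Skeletal)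
    (hQ : Q = k.toSkeletal ∨ Q = k.toSkeletal.petrieDual) :
    Q.IsRegular ∧
    (∀ t : ℝ, 0 < t → t ≠ 1 →
      (indexTwoFamily k Q t).IsRegularOfIndexTwo ∧
      (indexTwoFamily k Q t).vertexOrbits.ncard = 2 ∧
      ∀ F ∈ (indexTwoFamily k Q t).faces, ¬ Coplanar ℝ (polygonVertices F)) ∧
    (∀ t u : ℝ, 0 < t → t ≠ 1 → 0 < u → u ≠ 1 →
      (indexTwoFamily k Q t).Similar (indexTwoFamily k Q u) → u = t ∨ u = t⁻¹) := by
  obtain rfl | hk := eq_or_ne k .cube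
  · have hV : Q.verts = cubeVerts := by rcases hQ with rfl | rfl <;> rfl
    have hE := coordProd_eq_neg_of_mk_mem_edges hQ
    rw [ClassicalPolyhedron.toSkeletal_cube] at hQ
    obtain ⟨w, R, h, hw⟩ := cubeModel.exists_centredRegular hQ
    have hw0 : coordProd (w 0) = 1 := by
      simp [hw, GoldenModel.trace, cubeVec, toE3_cons, coordProd]
    have hS := finsum_tetrahedronVerts
    exact ⟨h.isRegular, fun t ht ht1 => h.rescaleHalf_spec hV hE hw0 hS ht ht1,
      fun t u ht ht1 hu hu1 => h.eq_or_eq_inv_of_rescaleHalf_similar hV hE hw0 hS ht ht1 hu hu1⟩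
  · obtain ⟨m, p, _, V, c, f, t, depth, model, hp, hfigure⟩ := k.exists_goldenModel hk
    rw [hfigure] at hQ
    obtain ⟨w, R, h, -⟩ := model.exists_centredRegular hQ
    have hbip := model.not_isBipartite hQ hp
    rw [indexTwoFamily_eq_cross hk]
    exact ⟨h.isRegular, fun t ht ht1 => h.cross_spec ht ht1 hbip,
      fun t u ht ht1 hu hu1 => h.eq_or_eq_inv_of_cross_similar hbip ht ht1 hu hu1⟩
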